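/- **Setting.** Let $\Theta\in\mathbb R^{d\times d}$ be symmetric positive definite, $\sigma\in\mathbb R^{d\times d}$ diagonal with positive diagonal, $b\in\mathbb R^d$. Let $X=(X_\tau)_{\tau\in\mathbb R}$ be a centred, jointly measurable $\mathbb R^d$-valued process with $X_0=0$, stationary increments, finite fourth moments and uncorrelated components; $V(\tau)=\mathrm{Cov}(X_\tau)$, with $V(1/N)$ invertible for all large $N$. Let $r$ solve $dr_\tau=\Theta(b-r_\tau)d\tau+\sigma\,dX_\tau$ on $[0,\infty)$ with square-integrable $r_0$. Let $U_\tau=e^{-\Theta \tau}\int_{-\infty}^\tau e^{\Theta s}\sigma\,dX_s=\sigma X_\tau-\Theta\int_{-\infty}^\tau e^{-\Theta(\tau-s)}\sigma X_s\,ds$ be the stationary solution for $b=0$, and $\gamma(s)=\mathbb E[U_sU_0^\top]$. Fix $t\ge 0$ and put $$B_t=\int_0^t(\gamma(s)-\gamma(s)^\top)ds,\quad C_t=\int_0^t\!\int_0^t\gamma(u-s)\,du\,ds,\quad D_t=\sigma V(t)\sigma^\top-\mathrm{Cov}(U_t-U_0).$$ **Estimators.** $\hat b_T=\frac1T\int_0^Tr_s\,ds$;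 $\ \hat\gamma_{U,T}(s)=\frac1T\int_0^TU_{s+v}U_v^\top dv$; $\ \hat\gamma_{r,T}(s)=\frac1T\int_0^Tr_{s+v}r_v^\top dv-\hat b_T\hat b_T^\top$ for $s\ge0$, $\hat\gamma_{r,T}(-s)=\hat\gamma_{r,T}(s)^\top$; $\ \widehat{\sigma\sigma^\top}=V(1/N)^{-1}\frac1N\sum_{k=0}^{N-1}(r_{(k+1)/N}-r_{k/N})(r_{(k+1)/N}-r_{k/N})^\top$. $\hat B_t,\hat C_t$ are obtained by replacing $\gamma$ by $\hat\gamma_{r,T}$, and $\hat D_t=V(t)\,\widehat{\sigma\sigma^\top}-2\hat\gamma_{r,T}(0)+\hat\gamma_{r,T}(t)+\hat\gamma_{r,T}(-t)$. **Theorem 2.5.** Let $l_1(T),l_2(T),l_3(N)\to\infty$, $N(T)\to\infty$ as $T\to\infty$, $l_\Theta(T)=\min(l_1^2(T),l_2(T),l_3(N(T)))$, $l_\Theta(T)/T\to0$, and suppose that the limits $$c_1=\lim\frac{l_\Theta(T)}{l_1^2(T)},\qquad c_2=\lim\frac{l_\Theta(T)}{l_2(T)},\qquad c_3=\lim\frac{l_\Theta(T)}{l_3(N(T))}$$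 exist (so $c_i=1$ if the $i$-th rate equals the minimum, and $c_i=0$ if it is of larger order than the minimum). Suppose that, as $T\to\infty$, $$l_1(T)(\hat b_T-b)\xrightarrow{d}Y_1,\quad l_2(T)(\hat\gamma_{U,T}-\gamma)\xrightarrow{d}Y_2\ \text{in } C([0,t];\mathbb R^{d\times d})\text{ (uniform norm)},\quad l_3(N(T))(\widehat{\sigma\sigma^\top}-\sigma\sigma^\top)\xrightarrow{d}Y_3,$$ and that those of these convergences for which $c_i\ne0$ hold jointly. Then, as $T\to\infty$: 1. $l_\Theta(T)\,(\hat C_t-C_t,\ \hat B_t-B_t,\ \hat D_t-D_t)\xrightarrow{d}L_1(Y_1Y_1^\top,Y_2,Y_3)$, where $L_1$ is the linear map $$L_1(M,y,S)=\begin{pmatrix}c_2\int_0^t(t-s)(y(s)+y(s)^\top)ds-c_1t^2M\\[2pt] c_2\int_0^t(y(s)-y(s)^\top)ds\\[2pt] c_3V(t)S+c_2\big(y(t)+y(t)^\top-2y(0)\big)\end{pmatrix}.$$ 2. Suppose in addition that $C_t$ is positive definite and $D_t$ is positive semidefinite. Then there is a linear map $L_2$, determined by $(\Theta,B_t,C_t)$,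 such that $H=L_2(\delta C,\delta B,\delta D)$ is the unique solution of $$(B_t-C_t\Theta)^\top H+H(B_t-C_t\Theta)+\delta B^\top\Theta+\Theta\,\delta B-\Theta\,\delta C\,\Theta+\delta D=0,$$ and for all random matrices $\hat\Theta=\hat\Theta_T$ which, with probability tending to one, are symmetric positive definite solutions of $\hat B_t^\top\hat\Theta+\hat\Theta\hat B_t-\hat\Theta\hat C_t\hat\Theta+\hat D_t=0$, $$l_\Theta(T)(\hat\Theta-\Theta)\xrightarrow{d}L_2\big(L_1(Y_1Y_1^\top,Y_2,Y_3)\big).$$ -/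

import Mathlib

open MeasureTheory ProbabilityTheory Filter Topology
open scoped Matrix NNReal

namespace Vasicek

/-- Real `d × d` matrices. -/
abbrev Mat (d : ℕ) : Type := Matrix (Fin d) (Fin d) ℝ

/-- The Borel (equivalently, entrywise) sigma-algebra on matrices. -/
instance instMeasurableSpaceMat (d : ℕ) : MeasurableSpace (Mat d) :=
  inferInstanceAs (MeasurableSpace (Fin d → Fin d → ℝ))

instance instBorelSpaceMat (d : ℕ) : BorelSpace (Mat d) :=
  inferInstanceAs (BorelSpace (Fin d → Fin d → ℝ))

instance instSecondCountableMat (d : ℕ) : SecondCountableTopology (Mat d) :=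
  inferInstanceAs (SecondCountableTopology (Fin d → Fin d → ℝ))

/-- The space of continuous matrix-valued functions of the lag `s ∈ [0, t]`, with the topology of
uniform convergence (`[0, t]` is compact, so that this is the compact-open topology). -/
abbrev Path (d : ℕ) (t : ℝ) : Type := C(Set.Icc (0 : ℝ) t, Mat d)

/-- The Borel sigma-algebra of the topology of uniform convergence. -/
instance instMeasurableSpacePath (d : ℕ) (t : ℝ) : MeasurableSpace (Path d t) := borel _

instance instBorelSpacePath (d : ℕ) (t : ℝ) : BorelSpace (Path d t) := ⟨rfl⟩

noncomputable section

variable {Ω : Type*} [MeasurableSpace Ω] {d : ℕ}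

/-! ### The model -/

/-- A centred noise process (indexed by `ℝ`, since the stationary solution below integrates over the
whole past) with `X 0 = 0`, finite fourth moments, uncorrelated components and stationary
increments: the finite dimensional laws of the increment process `(X (τ + h) - X h)_τ` do not
depend on `h`. -/
structure IsNoise (P : Measure Ω) (X : ℝ → Ω → Fin d → ℝ) : Prop where
  measurable : Measurable (Function.uncurry X)
  zero : ∀ᵐ ω ∂P, X 0 ω = 0
  memLp : ∀ t, MemLp (X t) 4 P
  centered : ∀ t i, ∫ ω, X t ω i ∂P = 0
  uncorrelated : ∀ t i j, i ≠ j → ∫ ω, X t ω i * X t ω j ∂P = 0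
  stationary_increments : ∀ (n : ℕ) (τ : Fin n → ℝ) (h : ℝ),
    IdentDistrib (fun ω k => X (τ k + h) ω - X h ω) (fun ω k => X (τ k) ω - X 0 ω) P P

/-- The covariance matrix of a random vector. -/
def covMat (P : Measure Ω) (Z : Ω → Fin d → ℝ) : Mat d :=
  Matrix.of fun i j => covariance (fun ω => Z ω i) (fun ω => Z ω j) P

/-- `r` is a (jointly measurable) solution on `[0, ∞)` of `dr = Θ (b - r) dt + σ dX` with a
square-integrable initial value. Values of `r` at negative times are irrelevant. -/
structure IsVasicek (P : Measure Ω) (X : ℝ → Ω → Fin d → ℝ) (Θ σ : Mat d) (b : Fin d → ℝ)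
    (r : ℝ → Ω → Fin d → ℝ) : Prop where
  measurable : Measurable (Function.uncurry r)
  memLp_init : MemLp (r 0) 2 P
  equation : ∀ᵐ ω ∂P, ∀ τ : ℝ, 0 ≤ τ →
    IntervalIntegrable (fun s => r s ω) volume 0 τ ∧
    r τ ω = r 0 ω + (∫ s in (0 : ℝ)..τ, Θ *ᵥ (b - r s ω)) + σ *ᵥ X τ ω

/-- The stationary solution `U_τ = e^{-Θτ} ∫_{-∞}^τ e^{Θs} σ dX_s` of `dU = -Θ U dt + σ dX`, the
integral being defined through integration by parts:
`U_τ = σ X_τ - Θ ∫_{-∞}^τ e^{-Θ(τ-s)} σ X_s ds`. -/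
def stationarySol (X : ℝ → Ω → Fin d → ℝ) (Θ σ : Mat d) (τ : ℝ) (ω : Ω) : Fin d → ℝ :=
  σ *ᵥ X τ ω -
    Θ *ᵥ ∫ s in Set.Iic τ, NormedSpace.exp ((-(τ - s)) • Θ) *ᵥ (σ *ᵥ X s ω)

/-- The autocovariance `γ(τ) = E[U_τ U_0ᵀ]` of the stationary solution. -/
def autocov (P : Measure Ω) (X : ℝ → Ω → Fin d → ℝ) (Θ σ : Mat d) (τ : ℝ) : Mat d :=
  Matrix.of fun i j => ∫ ω, stationarySol X Θ σ τ ω i * stationarySol X Θ σ 0 ω j ∂P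

/-! ### Riccati coefficients -/

/-- Extension of a matrix function of the lag `s ≥ 0` to negative lags by `g(-s) = g(s)ᵀ`. -/
def lagExtend (g : ℝ → Mat d) (u : ℝ) : Mat d :=
  if 0 ≤ u then g u else (g (-u))ᵀ

/-- `∫_0^t (g(s) - g(s)ᵀ) ds`. -/
def riccatiB (g : ℝ → Mat d) (t : ℝ) : Mat d :=
  Matrix.of fun i j => ∫ s in (0 : ℝ)..t, (g s i j - g s j i)

/-- `∫_0^t ∫_0^t g(u - s) du ds`. -/
def riccatiC (g : ℝ → Mat d) (t : ℝ) : Mat d :=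
  Matrix.of fun i j => ∫ s in (0 : ℝ)..t, ∫ u in (0 : ℝ)..t, lagExtend g (u - s) i j

/-- The true coefficient `B_t`. -/
def trueB (P : Measure Ω) (X : ℝ → Ω → Fin d → ℝ) (Θ σ : Mat d) (t : ℝ) : Mat d :=
  riccatiB (autocov P X Θ σ) t

/-- The true coefficient `C_t`. -/
def trueC (P : Measure Ω) (X : ℝ → Ω → Fin d → ℝ) (Θ σ : Mat d) (t : ℝ) : Mat d :=
  riccatiC (autocov P X Θ σ) t

/-- The true coefficient `D_t = σ V(t) σᵀ - Cov(U_t - U_0)`, where `V(t) = Cov(X_t)`. -/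
def trueD (P : Measure Ω) (X : ℝ → Ω → Fin d → ℝ) (Θ σ : Mat d) (t : ℝ) : Mat d :=
  σ * covMat P (X t) * σᵀ -
    covMat P (fun ω => stationarySol X Θ σ t ω - stationarySol X Θ σ 0 ω)

/-- The continuous-time algebraic Riccati equation `Bᵀ Θ + Θ B - Θ C Θ + D = 0`. -/
def IsCARE (C B D Θ : Mat d) : Prop :=
  Bᵀ * Θ + Θ * B - Θ * C * Θ + D = 0

/-- The equation in `H` obtained by linearizing `Bᵀ Θ + Θ B - Θ C Θ + D = 0` at `(C, B, D, Θ)` in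
the direction `(δC, δB, δD, H)`. -/
def IsLinearizedCARE (C B Θ δC δB δD H : Mat d) : Prop :=
  (B - C * Θ)ᵀ * H + H * (B - C * Θ) + (δBᵀ * Θ + Θ * δB - Θ * δC * Θ + δD) = 0

/-! ### Estimators -/

/-- The estimator `(1/T) ∫_0^T r_s ds` of the mean level `b`. -/
def meanEst (r : ℝ → Ω → Fin d → ℝ) (T : ℝ≥0) (ω : Ω) : Fin d → ℝ :=
  fun i => (1 / (T : ℝ)) * ∫ s in (0 : ℝ)..T, r s ω i

/-- The covariance estimator `(1/T) ∫_0^T U_{s+v} U_vᵀ dv` based on the centred process `U`. -/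
def covEstU (U : ℝ → Ω → Fin d → ℝ) (T : ℝ≥0) (ω : Ω) (s : ℝ) : Mat d :=
  Matrix.of fun i j => (1 / (T : ℝ)) * ∫ v in (0 : ℝ)..T, U (s + v) ω i * U v ω j

/-- The covariance estimator
`(1/T) ∫_0^T r_{s+v} r_vᵀ dv - (1/T²) (∫_0^T r_v dv) (∫_0^T r_v dv)ᵀ` based on `r`. -/
def covEst (r : ℝ → Ω → Fin d → ℝ) (T : ℝ≥0) (ω : Ω) (s : ℝ) : Mat d :=
  Matrix.of fun i j => (1 / (T : ℝ)) * (∫ v in (0 : ℝ)..T, r (s + v) ω i * r v ω j) -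
    (1 / (T : ℝ) ^ 2) * ((∫ v in (0 : ℝ)..T, r v ω i) * ∫ v in (0 : ℝ)..T, r v ω j)

/-- The estimator `V(1/N)⁻¹ (1/N) ∑_{k < N} (r_{(k+1)/N} - r_{k/N}) (r_{(k+1)/N} - r_{k/N})ᵀ` of
`σ σᵀ`. -/
def sigmaSqEst (P : Measure Ω) (X r : ℝ → Ω → Fin d → ℝ) (N : ℕ) (ω : Ω) : Mat d :=
  (covMat P (X (1 / (N : ℝ))))⁻¹ * ((1 / (N : ℝ)) • ∑ k ∈ Finset.range N,
    Matrix.vecMulVec (r (((k : ℝ) + 1) / N) ω - r ((k : ℝ) / N) ω)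
      (r (((k : ℝ) + 1) / N) ω - r ((k : ℝ) / N) ω))

/-- The estimator of `B_t`. -/
def estB (r : ℝ → Ω → Fin d → ℝ) (t : ℝ) (T : ℝ≥0) (ω : Ω) : Mat d :=
  riccatiB (covEst r T ω) t

/-- The estimator of `C_t`. -/
def estC (r : ℝ → Ω → Fin d → ℝ) (t : ℝ) (T : ℝ≥0) (ω : Ω) : Mat d :=
  riccatiC (covEst r T ω) t

/-- The estimator of `D_t`: `V(t)` times the estimator of `σ σᵀ` (for `N` observations), minus
`2 γ̂(0) - γ̂(t) - γ̂(-t)` with `γ̂(-t) = γ̂(t)ᵀ`. For the true diagonal matrices,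
`V(t) σ σᵀ = σ V(t) σᵀ`. -/
def estD (P : Measure Ω) (X r : ℝ → Ω → Fin d → ℝ) (t : ℝ) (T : ℝ≥0) (N : ℕ) (ω : Ω) : Mat d :=
  covMat P (X t) * sigmaSqEst P X r N ω -
    ((2 : ℝ) • covEst r T ω 0 - covEst r T ω t - (covEst r T ω t)ᵀ)

/-! ### The limit -/

/-- The linear map
`(M, y, S) ↦ (c₂ ∫_0^t (t-s)(y(s) + y(s)ᵀ) ds - c₁ t² M, c₂ ∫_0^t (y(s) - y(s)ᵀ) ds,
  c₃ V S + c₂ (y(t) + y(t)ᵀ - 2 y(0)))`.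
The weights `c₁`, `c₂`, `c₃` encode the relation between the three rates: a weight is `1` if the
rate is the slowest one, and `0` if it is of larger order than the slowest one. -/
def limitMap (t : ℝ) (ht : 0 ≤ t) (V : Mat d) (c₁ c₂ c₃ : ℝ) :
    (Mat d × Path d t × Mat d) →ₗ[ℝ] (Mat d × Mat d × Mat d) where
  toFun p :=
    ((c₂ • Matrix.of fun i j => ∫ s in (0 : ℝ)..t,
        (t - s) * (p.2.1 (Set.projIcc 0 t ht s) i j + p.2.1 (Set.projIcc 0 t ht s) j i)) -
        (c₁ * t ^ 2) • p.1,
      c₂ • Matrix.of fun i j => ∫ s in (0 : ℝ)..t,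
        (p.2.1 (Set.projIcc 0 t ht s) i j - p.2.1 (Set.projIcc 0 t ht s) j i),
      c₃ • (V * p.2.2) + c₂ • (p.2.1 ⟨t, ht, le_rfl⟩ + (p.2.1 ⟨t, ht, le_rfl⟩)ᵀ -
        (2 : ℝ) • p.2.1 ⟨0, le_rfl, ht⟩))
  map_add' p q := by
    have hc : ∀ (y : Path d t) (i j : Fin d),
        Continuous fun s : ℝ => y (Set.projIcc 0 t ht s) i j := fun y i j =>
      (y.continuous.comp continuous_projIcc).matrix_elem i j
    refine Prod.ext ?_ (Prod.ext ?_ ?_)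
    · ext i j
      have hi : ∀ y : Path d t, IntervalIntegrable (fun s : ℝ => (t - s) *
          (y (Set.projIcc 0 t ht s) i j + y (Set.projIcc 0 t ht s) j i)) volume 0 t := fun y =>
        ((continuous_const.sub continuous_id).mul ((hc y i j).add (hc y j i))).intervalIntegrable
          0 t
      have h := intervalIntegral.integral_add (hi p.2.1) (hi q.2.1)
      have h' : (∫ s in (0 : ℝ)..t, (t - s) * ((p + q).2.1 (Set.projIcc 0 t ht s) i j +
          (p + q).2.1 (Set.projIcc 0 t ht s) j i)) = _ := Eq.trans
        (intervalIntegral.integral_congr fun s _ => by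
          simp only [Prod.snd_add, Prod.fst_add, ContinuousMap.add_apply, Matrix.add_apply]
          ring) h
      simp only [Matrix.sub_apply, Matrix.smul_apply, Matrix.of_apply, Prod.fst_add,
        Matrix.add_apply, smul_eq_mul, h']
      ring
    · ext i j
      have hi : ∀ y : Path d t, IntervalIntegrable (fun s : ℝ =>
          y (Set.projIcc 0 t ht s) i j - y (Set.projIcc 0 t ht s) j i) volume 0 t := fun y =>
        ((hc y i j).sub (hc y j i)).intervalIntegrable 0 t
      have h := intervalIntegral.integral_add (hi p.2.1) (hi q.2.1)
      have h' : (∫ s in (0 : ℝ)..t, ((p + q).2.1 (Set.projIcc 0 t ht s) i j -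
          (p + q).2.1 (Set.projIcc 0 t ht s) j i)) = _ := Eq.trans
        (intervalIntegral.integral_congr fun s _ => by
          simp only [Prod.snd_add, Prod.fst_add, ContinuousMap.add_apply, Matrix.add_apply]
          ring) h
      simp only [Matrix.smul_apply, Matrix.of_apply, Prod.fst_add, Prod.snd_add,
        Matrix.add_apply, smul_eq_mul] at h' ⊢
      rw [h']
      ring
    · ext i j
      simp [Matrix.mul_add]
      ring
  map_smul' a p := by
    refine Prod.ext ?_ (Prod.ext ?_ ?_)
    · ext i j
      have h' : (∫ s in (0 : ℝ)..t, (t - s) * ((a • p).2.1 (Set.projIcc 0 t ht s) i j +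
          (a • p).2.1 (Set.projIcc 0 t ht s) j i)) = a * ∫ s in (0 : ℝ)..t,
          (t - s) * (p.2.1 (Set.projIcc 0 t ht s) i j + p.2.1 (Set.projIcc 0 t ht s) j i) := by
        rw [← intervalIntegral.integral_const_mul]
        refine intervalIntegral.integral_congr fun s _ => ?_
        simp
        ring
      simp only [Matrix.sub_apply, Matrix.smul_apply, Matrix.of_apply, Prod.smul_fst,
        smul_eq_mul, RingHom.id_apply, h']
      ring
    · ext i j
      have h' : (∫ s in (0 : ℝ)..t, ((a • p).2.1 (Set.projIcc 0 t ht s) i j -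
          (a • p).2.1 (Set.projIcc 0 t ht s) j i)) = a * ∫ s in (0 : ℝ)..t,
          (p.2.1 (Set.projIcc 0 t ht s) i j - p.2.1 (Set.projIcc 0 t ht s) j i) := by
        rw [← intervalIntegral.integral_const_mul]
        refine intervalIntegral.integral_congr fun s _ => ?_
        simp
        ring
      simp only [Matrix.smul_apply, Matrix.of_apply, Prod.smul_fst, Prod.smul_snd,
        smul_eq_mul, RingHom.id_apply] at h' ⊢
      rw [h']
      ring
    · ext i j
      simp
      ring

end

end Vasicek

/-! Subtracting the integral equations of `r` and of the stationary solution `u` cancels the noise.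
Hence `r = b + u + z` pathwise, where `z` solves a linear homogeneous equation and decays
exponentially (`IsVasicek.exists_decay`). In the empirical covariance the terms containing `b`
combine into a product of errors of the mean: uniformly over lags in `[0, t]`, the covariance
estimator of `r` is that of `u` minus `(b̂ - b)(b̂ - b)ᵀ`, up to a remainder of order `1 / T` in
probability (`IsVasicek.exists_remainder_bound`). This is why the rate of the mean enters squared
and why `l_Θ / T → 0` is required.

The errors of `C`, `B`, `D` are linear in the errors of the covariance and of `σ σᵀ`. The outer
product is symmetric and does not depend on the lag, so it drops out of `B` and `D` and contributes
the `t²` term to `C`. The rescaled errors of the coefficients are therefore close to `limitMap` of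
the rescaled input errors (`norm_smul_sub_limitMap_le`). The inputs are bounded in probability, so
replacing the ratios of the rates by their limits is harmless, and the first claim follows from
continuous mapping and Slutsky.

For the second claim, the second moments of `σ X_t = U_t - U_0 + Θ ∫ U` show that `Θ` solves the
Riccati equation (`isCARE_true`). With `A = B - C Θ` that equation reads `Aᵀ Θ + Θ A = -(D + Θ C
Θ)`. The right side is negative definite, so `H ↦ Aᵀ H + H A` is injective (`sylvester_injective`),
which defines `L₂`. Consistency of `Θ̂` is derived, not assumed. Since `B` and its estimator are
skew-symmetric, taking traces bounds all positive definite solutions for nearby coefficients. Their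
limit points are positive semidefinite solutions, and the skewness of `B` forces these to equal `Θ`
(`IsCARE.eq_of_posSemidef`). Compactness gives `IsCARE.eventually_mem`, an exact difference identity
gives the expansion `IsCARE.eventually_norm_sub_le`, and the delta method concludes.

The moments of `u` are obtained without any path regularity of `X`: the L² norm of a measurable
process with stationary increments is subadditive in time, so Steinhaus' theorem makes it grow at
most linearly. The discounted past is then integrable, and `u` is a moving average of increments,
hence stationary. -/

namespace Vasicek

/-! ### Absolutely continuous functions -/

/-- Product rule for a continuously differentiable function and an indefinite integral. -/
theorem integral_deriv_mul_primitive {φ : ℝ → ℝ} (hφ : ContDiff ℝ 1 φ) {g : ℝ → ℝ} (A : ℝ) {τ : ℝ}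
    (hg : IntervalIntegrable g volume 0 τ) :
    ∫ s in (0 : ℝ)..τ, (deriv φ s * (A + ∫ w in (0 : ℝ)..s, g w) + φ s * g s) =
      φ τ * (A + ∫ w in (0 : ℝ)..τ, g w) - φ 0 * A := by
  have h1 : AbsolutelyContinuousOnInterval φ 0 τ := hφ.contDiffOn.absolutelyContinuousOnInterval
  have h2 : AbsolutelyContinuousOnInterval (fun s => A + ∫ w in (0 : ℝ)..s, g w) 0 τ := by
    have h3 : AbsolutelyContinuousOnInterval (fun _ : ℝ => A) 0 τ :=
      (contDiff_const (n := 1)).contDiffOn.absolutelyContinuousOnInterval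
    exact h3.add (hg.absolutelyContinuousOnInterval_intervalIntegral (c := 0) (by simp))
  have h := h1.integral_deriv_mul_eq_sub h2
  simp only [intervalIntegral.integral_same, add_zero] at h
  rw [← h]
  refine intervalIntegral.integral_congr_ae ?_
  filter_upwards [hg.ae_hasDerivAt_integral] with x hx hx'
  have := (hx (Set.uIoc_subset_uIcc hx') 0 (by simp)).const_add A
  rw [this.deriv]

/-- The integrating factor in integrated form; `g` is merely integrable, so its primitive is
differentiable only almost everywhere. -/
theorem integral_exp_mul_primitive (c A : ℝ) {g : ℝ → ℝ} {τ : ℝ}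
    (hg : IntervalIntegrable g volume 0 τ) :
    ∫ s in (0 : ℝ)..τ, (c * (Real.exp (c * s) * (A + ∫ w in (0 : ℝ)..s, g w))
        + Real.exp (c * s) * g s) =
      Real.exp (c * τ) * (A + ∫ w in (0 : ℝ)..τ, g w) - A := by
  have h := integral_deriv_mul_primitive (φ := fun s => Real.exp (c * s)) (by fun_prop) A hg
  simp only [mul_zero, Real.exp_zero, one_mul] at h
  rw [← h]
  refine intervalIntegral.integral_congr fun s _ => ?_
  have : deriv (fun s => Real.exp (c * s)) s = Real.exp (c * s) * c := by
    have := ((hasDerivAt_id s).const_mul c).exp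
    simpa using this.deriv
  simp only [this]
  ring

/-- A solution of the integral equation `z τ = z 0 - c ∫_0^τ z` decays exponentially. -/
theorem eq_exp_of_integral_eq {z : ℝ → ℝ} {c : ℝ}
    (hz : ∀ τ, 0 ≤ τ → IntervalIntegrable z volume 0 τ ∧ z τ = z 0 - c * ∫ s in (0 : ℝ)..τ, z s)
    {τ : ℝ} (hτ : 0 ≤ τ) : z τ = Real.exp (-(c * τ)) * z 0 := by
  have h := integral_exp_mul_primitive c (z 0) (g := fun s => -(c * z s)) (τ := τ)
    (((hz τ hτ).1.const_mul c).neg)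
  simp only [intervalIntegral.integral_neg, intervalIntegral.integral_const_mul,
    ← sub_eq_add_neg] at h
  rw [← (hz τ hτ).2] at h
  -- By the equation the bracket is `z s`, so the two terms cancel and `e^{cτ} z τ` is constant.
  have h0 : ∫ s in (0 : ℝ)..τ, (c * (Real.exp (c * s) * (z 0 - c * ∫ w in (0 : ℝ)..s, z w))
        + Real.exp (c * s) * -(c * z s)) = 0 := by
    rw [intervalIntegral.integral_congr (g := fun _ => 0)]
    · simp
    intro s hs
    rw [Set.uIcc_of_le hτ] at hs
    simp only [← (hz s hs.1).2]
    ring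
  rw [h0] at h
  rw [Real.exp_neg]
  field_simp
  linarith

/-- The exponentially weighted integral of the past solves a linear differential equation. -/
theorem integral_past_sub {x : ℝ → ℝ} {c : ℝ}
    (hx : ∀ τ, IntegrableOn (fun s => Real.exp (c * s) * x s) (Set.Iic τ)) {τ : ℝ} (hτ : 0 ≤ τ) :
    let F : ℝ → ℝ := fun τ => ∫ s in Set.Iic τ, Real.exp (-(c * (τ - s))) * x s
    IntervalIntegrable F volume 0 τ ∧
    IntervalIntegrable x volume 0 τ ∧
    F τ - F 0 = ∫ s in (0 : ℝ)..τ, (x s - c * F s) := by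
  intro F
  set g : ℝ → ℝ := fun s => Real.exp (c * s) * x s with hgdef
  have hg : ∀ τ, 0 ≤ τ → IntervalIntegrable g volume 0 τ := fun τ hτ =>
    (intervalIntegrable_iff_integrableOn_Ioc_of_le hτ).2
      ((hx τ).mono_set Set.Ioc_subset_Iic_self)
  -- Pulling out `e^{-cτ}` and splitting at `0` exhibits `F` as a smooth factor times a primitive.
  have hF : ∀ τ, 0 ≤ τ → F τ = Real.exp (-c * τ) *
      ((∫ s in Set.Iic (0 : ℝ), g s) + ∫ s in (0 : ℝ)..τ, g s) := by
    intro τ hτ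
    have h1 := intervalIntegral.integral_Iic_sub_Iic (hx 0) (hx τ)
    rw [← h1, add_sub_cancel, ← integral_const_mul]
    refine integral_congr_ae (ae_of_all _ fun s => ?_)
    simp only [hgdef]
    rw [← mul_assoc, ← Real.exp_add]
    congr 2
    ring
  have hxint : IntervalIntegrable x volume 0 τ := by
    have := (hg τ hτ).continuousOn_mul (g := fun s => Real.exp (-c * s)) (by fun_prop)
    refine this.congr fun s _ => ?_
    simp only [hgdef]
    rw [← mul_assoc, ← Real.exp_add]
    simp
  have hFc : ContinuousOn F (Set.uIcc 0 τ) := by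
    have h2 : ContinuousOn (fun τ => Real.exp (-c * τ) *
      ((∫ s in Set.Iic (0 : ℝ), g s) + ∫ s in (0 : ℝ)..τ, g s)) (Set.uIcc 0 τ) := by
      refine ContinuousOn.mul (by fun_prop) (ContinuousOn.add (by fun_prop) ?_)
      exact intervalIntegral.continuousOn_primitive_interval
        (by rw [← intervalIntegrable_iff']; exact hg τ hτ)
    refine h2.congr fun s hs => ?_
    rw [Set.uIcc_of_le hτ] at hs
    exact hF s hs.1
  refine ⟨hFc.intervalIntegrable, hxint, ?_⟩
  have h := integral_exp_mul_primitive (-c) (∫ s in Set.Iic (0 : ℝ), g s) (hg τ hτ)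
  rw [hF τ hτ, hF 0 le_rfl]
  simp only [intervalIntegral.integral_same, mul_zero, Real.exp_zero, add_zero, one_mul]
  rw [← h]
  refine intervalIntegral.integral_congr fun s hs => ?_
  rw [Set.uIcc_of_le hτ] at hs
  simp only [hF s hs.1, hgdef]
  have : Real.exp (-c * s) * (Real.exp (c * s) * x s) = x s := by
    rw [← mul_assoc, ← Real.exp_add]; simp
  rw [this]
  ring

/-- Cauchy's formula for repeated integration. -/
theorem integral_integral_eq {f : ℝ → ℝ} {t : ℝ} (hf : IntervalIntegrable f volume 0 t) :
    ∫ s in (0 : ℝ)..t, ∫ w in (0 : ℝ)..s, f w = ∫ s in (0 : ℝ)..t, (t - s) * f s := by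
  have h := integral_deriv_mul_primitive (φ := fun s => t - s) (by fun_prop) 0 hf
  have hd : ∀ s : ℝ, deriv (fun s => t - s) s = -1 := fun s => by simp
  simp only [hd, zero_add, sub_self, zero_mul, mul_zero] at h
  have hc : ContinuousOn (fun s => ∫ w in (0 : ℝ)..s, f w) (Set.uIcc 0 t) :=
    intervalIntegral.continuousOn_primitive_interval (by rw [← intervalIntegrable_iff']; exact hf)
  rw [intervalIntegral.integral_add (hc.intervalIntegrable.const_mul _)
    (hf.continuousOn_mul (by fun_prop)), intervalIntegral.integral_const_mul] at h
  linarith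

/-! ### Fubini's theorem for second moments -/

section Fubini

variable {α β Ω : Type*} [MeasurableSpace α] [MeasurableSpace β] [MeasurableSpace Ω]
  {μ : Measure α} {ν : Measure β} {P : Measure Ω}

/-- Cauchy–Schwarz; the bounds on second moments are written as squares so that the bounds `a` and
`b` simply multiply. -/
theorem integral_norm_mul_le {f g : Ω → ℝ} (hf : MemLp f 2 P) (hg : MemLp g 2 P) {a b : ℝ}
    (ha : 0 ≤ a) (hb : 0 ≤ b) (hfa : ∫ ω, f ω ^ 2 ∂P ≤ a ^ 2) (hgb : ∫ ω, g ω ^ 2 ∂P ≤ b ^ 2) :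
    ∫ ω, ‖f ω * g ω‖ ∂P ≤ a * b := by
  have h := integral_mul_norm_le_Lp_mul_Lq (μ := P) (f := f) (g := g)
    Real.HolderConjugate.two_two (by simpa using hf) (by simpa using hg)
  simp only [norm_mul]
  refine h.trans ?_
  simp only [Real.rpow_two, Real.norm_eq_abs, sq_abs, ← Real.sqrt_eq_rpow]
  gcongr
  · exact Real.sqrt_le_iff.2 ⟨ha, hfa⟩
  · exact Real.sqrt_le_iff.2 ⟨hb, hgb⟩

variable [SFinite P]

/-- By Cauchy–Schwarz the expected absolute product is at most `φ v * ψ w`, which is integrable for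
the product measure. This licenses Fubini for products of two random integrals. -/
theorem integrable_triple {f : α → Ω → ℝ} {g : β → Ω → ℝ}
    (hf : Measurable (Function.uncurry f)) (hg : Measurable (Function.uncurry g))
    (hf2 : ∀ v, MemLp (f v) 2 P) (hg2 : ∀ w, MemLp (g w) 2 P)
    {φ : α → ℝ} {ψ : β → ℝ} (hφ : Integrable φ μ) (hψ : Integrable ψ ν)
    (hφ0 : ∀ v, 0 ≤ φ v) (hψ0 : ∀ w, 0 ≤ ψ w)
    (hfφ : ∀ v, ∫ ω, f v ω ^ 2 ∂P ≤ φ v ^ 2) (hgψ : ∀ w, ∫ ω, g w ω ^ 2 ∂P ≤ ψ w ^ 2) :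
    Integrable (fun q : (α × β) × Ω => f q.1.1 q.2 * g q.1.2 q.2) ((μ.prod ν).prod P) := by
  have hm : Measurable (fun q : (α × β) × Ω => f q.1.1 q.2 * g q.1.2 q.2) :=
    (hf.comp (measurable_fst.fst.prodMk measurable_snd)).mul
      (hg.comp (measurable_fst.snd.prodMk measurable_snd))
  rw [integrable_prod_iff hm.aestronglyMeasurable]
  refine ⟨ae_of_all _ fun p => (hf2 p.1).integrable_mul (hg2 p.2), ?_⟩
  refine (hφ.mul_prod hψ).mono' ?_ (ae_of_all _ fun p => ?_)
  · exact hm.norm.stronglyMeasurable.integral_prod_right'.aestronglyMeasurable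
  · rw [Real.norm_of_nonneg (integral_nonneg fun _ => norm_nonneg _)]
    exact integral_norm_mul_le (hf2 p.1) (hg2 p.2) (hφ0 _) (hψ0 _) (hfφ _) (hgψ _)

variable [SFinite μ]

theorem integral_mul_integral [SFinite ν] {f : α → Ω → ℝ} {g : β → Ω → ℝ}
    (hf : Measurable (Function.uncurry f)) (hg : Measurable (Function.uncurry g))
    (hf2 : ∀ v, MemLp (f v) 2 P) (hg2 : ∀ w, MemLp (g w) 2 P)
    {φ : α → ℝ} {ψ : β → ℝ} (hφ : Integrable φ μ) (hψ : Integrable ψ ν)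
    (hφ0 : ∀ v, 0 ≤ φ v) (hψ0 : ∀ w, 0 ≤ ψ w)
    (hfφ : ∀ v, ∫ ω, f v ω ^ 2 ∂P ≤ φ v ^ 2) (hgψ : ∀ w, ∫ ω, g w ω ^ 2 ∂P ≤ ψ w ^ 2) :
    Integrable (fun ω => (∫ v, f v ω ∂μ) * ∫ w, g w ω ∂ν) P ∧
    ∫ ω, (∫ v, f v ω ∂μ) * (∫ w, g w ω ∂ν) ∂P = ∫ p, ∫ ω, f p.1 ω * g p.2 ω ∂P ∂(μ.prod ν) := by
  have h := integrable_triple hf hg hf2 hg2 hφ hψ hφ0 hψ0 hfφ hgψ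
  have h1 := h.integral_prod_right
  have h2 := integral_integral_swap (μ := μ.prod ν) (ν := P)
    (f := fun p ω => f p.1 ω * g p.2 ω) h
  have h3 : ∀ ω, ∫ p, f p.1 ω * g p.2 ω ∂(μ.prod ν) = (∫ v, f v ω ∂μ) * ∫ w, g w ω ∂ν :=
    fun ω => integral_prod_mul (fun v => f v ω) (fun w => g w ω)
  simp only [h3] at h1 h2
  exact ⟨h1, h2.symm⟩

/-- The factor `g` counts as an integral over a one-point space with Dirac mass, which reduces the
claim to `integral_mul_integral`. -/
theorem integral_mul_integral_right {f : α → Ω → ℝ} {g : Ω → ℝ}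
    (hf : Measurable (Function.uncurry f)) (hg : Measurable g)
    (hf2 : ∀ v, MemLp (f v) 2 P) (hg2 : MemLp g 2 P)
    {φ : α → ℝ} (hφ : Integrable φ μ) (hφ0 : ∀ v, 0 ≤ φ v)
    (hfφ : ∀ v, ∫ ω, f v ω ^ 2 ∂P ≤ φ v ^ 2) :
    Integrable (fun ω => (∫ v, f v ω ∂μ) * g ω) P ∧
    ∫ ω, (∫ v, f v ω ∂μ) * g ω ∂P = ∫ v, ∫ ω, f v ω * g ω ∂P ∂μ := by
  have h := integral_mul_integral (ν := Measure.dirac ()) (β := Unit) (g := fun _ => g)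
    (ψ := fun _ => Real.sqrt (∫ ω, g ω ^ 2 ∂P)) hf (hg.comp measurable_snd) hf2 (fun _ => hg2) hφ
    (by simp) hφ0 (fun _ => Real.sqrt_nonneg _) hfφ
    (fun _ => (Real.sq_sqrt (integral_nonneg fun _ => sq_nonneg _)).ge)
  simp only [integral_dirac] at h
  refine ⟨h.1, h.2.trans ?_⟩
  have hu : μ.prod (Measure.dirac ()) = μ.map (fun v => (v, ())) := by
    rw [Measure.prod_dirac]
  have hm : Measurable (fun q : α × Ω => f q.1 q.2 * g q.2) := hf.mul (hg.comp measurable_snd)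
  rw [hu, integral_map (by fun_prop)]
  exact (hm.stronglyMeasurable.integral_prod_right'.comp_measurable
    (measurable_fst (β := Unit))).aestronglyMeasurable

/-- Minkowski's integral inequality for second moments: the square is a double integral, and the
moment at `(v, w)` is at most `φ v * φ w`. -/
theorem memLp_integral {f : α → Ω → ℝ} (hf : Measurable (Function.uncurry f))
    (hf2 : ∀ v, MemLp (f v) 2 P) {φ : α → ℝ} (hφ : Integrable φ μ) (hφ0 : ∀ v, 0 ≤ φ v)
    (hfφ : ∀ v, ∫ ω, f v ω ^ 2 ∂P ≤ φ v ^ 2) :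
    MemLp (fun ω => ∫ v, f v ω ∂μ) 2 P ∧ ∫ ω, (∫ v, f v ω ∂μ) ^ 2 ∂P ≤ (∫ v, φ v ∂μ) ^ 2 := by
  have h := integral_mul_integral hf hf hf2 hf2 hφ hφ hφ0 hφ0 hfφ hfφ
  have hm : AEStronglyMeasurable (fun ω => ∫ v, f v ω ∂μ) P :=
    (hf.comp measurable_swap).stronglyMeasurable.integral_prod_right'.aestronglyMeasurable
  simp only [← sq] at h
  refine ⟨(memLp_two_iff_integrable_sq hm).2 h.1, ?_⟩
  rw [h.2, sq, ← integral_prod_mul]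
  refine (Real.le_norm_self _).trans (norm_integral_le_of_norm_le (hφ.mul_prod hφ)
    (ae_of_all _ fun p => (norm_integral_le_integral_norm _).trans ?_))
  exact integral_norm_mul_le (hf2 p.1) (hf2 p.2) (hφ0 _) (hφ0 _) (hfφ _) (hfφ _)

/-- Cauchy–Schwarz against the constant `1` bounds the first absolute moment by `φ`, so the integral
of the absolute value along the path has finite mean. -/
theorem ae_integrable_of_memLp [IsProbabilityMeasure P] {f : α → Ω → ℝ}
    (hf : Measurable (Function.uncurry f))
    (hf2 : ∀ v, MemLp (f v) 2 P) {φ : α → ℝ} (hφ : Integrable φ μ) (hφ0 : ∀ v, 0 ≤ φ v)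
    (hfφ : ∀ v, ∫ ω, f v ω ^ 2 ∂P ≤ φ v ^ 2) :
    ∀ᵐ ω ∂P, Integrable (fun v => f v ω) μ := by
  have : Integrable (Function.uncurry f) (μ.prod P) := by
    rw [integrable_prod_iff hf.aestronglyMeasurable]
    refine ⟨ae_of_all _ fun v => (hf2 v).integrable one_le_two, ?_⟩
    refine hφ.mono' ?_ (ae_of_all _ fun v => ?_)
    · exact hf.norm.stronglyMeasurable.integral_prod_right'.aestronglyMeasurable
    · rw [Real.norm_of_nonneg (integral_nonneg fun _ => norm_nonneg _)]
      have := integral_norm_mul_le (hf2 v) (memLp_const (1 : ℝ)) (hφ0 v) zero_le_one (hfφ v)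
        (by simp)
      simpa using this
  exact this.prod_left_ae

end Fubini

/-! ### Measurable subadditive functions -/

/-- Some sublevel set has positive measure. By Steinhaus its difference set contains a neighbourhood
of `0`, where evenness and subadditivity bound `m`; subadditivity then propagates the bound
linearly. -/
theorem exists_linear_bound {m : ℝ → ℝ} (hm : Measurable m)
    (hneg : ∀ v, m (-v) = m v) (hadd : ∀ u v, m (u + v) ≤ m u + m v) :
    ∃ M, 0 ≤ M ∧ ∀ v, m v ≤ M * (1 + |v|) := by
  obtain ⟨n, hn⟩ : ∃ n : ℕ, volume {v | m v ≤ n} ≠ 0 := by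
    by_contra! h
    have : volume (⋃ n : ℕ, {v | m v ≤ n}) = 0 := measure_iUnion_null h
    have hu : (⋃ n : ℕ, {v | m v ≤ n}) = Set.univ := by
      ext v
      simpa using exists_nat_ge (m v)
    rw [hu] at this
    simp at this
  have hS := MeasureTheory.Measure.sub_mem_nhds_zero_of_addHaar_pos volume {v | m v ≤ n}
    (measurableSet_le hm measurable_const) (pos_iff_ne_zero.2 hn)
  obtain ⟨δ, hδ, hball⟩ := Metric.mem_nhds_iff.1 hS
  have hsmall : ∀ v, |v| < δ → m v ≤ 2 * n := by
    intro v hv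
    obtain ⟨a, ha, b, hb, hab⟩ := hball (by simpa using hv : v ∈ Metric.ball (0 : ℝ) δ)
    simp only [Set.mem_ofPred_eq] at ha hb
    have := hadd a (-b)
    rw [hneg, ← sub_eq_add_neg] at this
    simp only at hab
    rw [← hab]
    linarith
  have hmul : ∀ (k : ℕ) v, m ((k + 1 : ℕ) * v) ≤ (k + 1 : ℕ) * m v := by
    intro k v
    induction k with
    | zero => simp
    | succ k ih =>
      have := hadd ((k + 1 : ℕ) * v) v
      push_cast at *
      calc m ((k + 1 + 1) * v) = m ((k + 1) * v + v) := by ring_nf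
        _ ≤ _ := this
        _ ≤ (k + 1) * m v + m v := by linarith
        _ = _ := by ring
  refine ⟨2 * n * (1 / δ + 1), by positivity, fun v => ?_⟩
  -- `v` is cut into `k + 1` equal pieces, each shorter than `δ`.
  set k := ⌊|v| / δ⌋₊ with hk
  have hk1 : |v| / δ < k + 1 := Nat.lt_floor_add_one _
  have hk2 : (k : ℝ) ≤ |v| / δ := Nat.floor_le (by positivity)
  have h1 : |v / (k + 1 : ℕ)| < δ := by
    rw [abs_div, Nat.abs_cast, div_lt_iff₀ (by positivity)]
    rw [div_lt_iff₀ hδ] at hk1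
    push_cast
    linarith
  have h2 := hmul k (v / (k + 1 : ℕ))
  rw [mul_div_cancel₀ _ (by positivity)] at h2
  calc m v ≤ (k + 1 : ℕ) * (2 * n) := h2.trans (by gcongr; exact hsmall _ h1)
    _ ≤ (|v| / δ + 1) * (2 * n) := by push_cast; gcongr
    _ ≤ 2 * n * (1 / δ + 1) * (1 + |v|) := by
      have : |v| / δ + 1 ≤ (1 / δ + 1) * (1 + |v|) := by
        have h3 : 0 ≤ |v| := abs_nonneg v
        have h4 : (0 : ℝ) < 1 / δ := by positivity
        have h5 : |v| / δ = 1 / δ * |v| := by ring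
        nlinarith
      calc _ ≤ ((1 / δ + 1) * (1 + |v|)) * (2 * n) := by gcongr
        _ = _ := by ring

theorem exists_exp_bound {m : ℝ → ℝ} (hm : Measurable m)
    (hneg : ∀ v, m (-v) = m v) (hadd : ∀ u v, m (u + v) ≤ m u + m v) {ε : ℝ} (hε : 0 < ε) :
    ∃ M, 0 ≤ M ∧ ∀ v, m v ≤ M * Real.exp (ε * |v|) := by
  obtain ⟨M, hM, h⟩ := exists_linear_bound hm hneg hadd
  refine ⟨M * (1 / ε + 1), by positivity, fun v => (h v).trans ?_⟩
  rw [mul_assoc]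
  gcongr
  have h1 := Real.add_one_le_exp (ε * |v|)
  have h2 : 0 ≤ |v| := abs_nonneg v
  have h3 : (0 : ℝ) < 1 / ε := by positivity
  have h4 : 1 / ε * ε = 1 := by field_simp
  have h5 : 1 ≤ Real.exp (ε * |v|) := by have := mul_nonneg hε.le h2; linarith
  nlinarith [mul_le_mul_of_nonneg_left h1 h3.le]

/-! ### Second-order processes with stationary increments -/

section Increments

variable {Ω ι : Type*} [MeasurableSpace Ω]

/-- A family of centred square-integrable processes whose increments are jointly weakly
stationary. -/
structure HasStationaryIncrements (P : Measure Ω) (x : ι → ℝ → Ω → ℝ) : Prop where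
  measurable : ∀ k, Measurable (Function.uncurry (x k))
  memLp : ∀ k τ, MemLp (x k τ) 2 P
  centered : ∀ k τ, ∫ ω, x k τ ω ∂P = 0
  zero : ∀ k, ∀ᵐ ω ∂P, x k 0 ω = 0
  integral_mul : ∀ k l a b a' b' h,
    ∫ ω, (x k (a + h) ω - x k (b + h) ω) * (x l (a' + h) ω - x l (b' + h) ω) ∂P =
      ∫ ω, (x k a ω - x k b ω) * (x l a' ω - x l b' ω) ∂P

theorem IsNoise.hasStationaryIncrements {P : Measure Ω} [IsProbabilityMeasure P] {d : ℕ}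
    {X : ℝ → Ω → Fin d → ℝ} (hX : IsNoise P X) (A : Mat d) :
    HasStationaryIncrements P (fun k τ ω => (A *ᵥ X τ ω) k) where
  measurable k := by
    have h : Measurable (fun y : Fin d → ℝ => (A *ᵥ y) k) :=
      Continuous.measurable (by unfold Matrix.mulVec dotProduct; fun_prop)
    exact h.comp hX.measurable
  memLp k τ := by
    simp only [Matrix.mulVec, dotProduct]
    refine memLp_finsetSum _ fun j _ => MemLp.const_mul ?_ _
    exact (memLp_pi_iff.1 (hX.memLp τ) j).mono_exponent (by norm_num)
  centered k τ := by
    simp only [Matrix.mulVec, dotProduct]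
    rw [integral_finsetSum]
    · simp [integral_const_mul, hX.centered]
    · intro j _
      exact ((memLp_pi_iff.1 (hX.memLp τ) j).integrable (by norm_num)).const_mul _
  zero k := by
    filter_upwards [hX.zero] with ω hω
    simp [hω]
  integral_mul k l a b a' b' h := by
    -- Four times suffice: the product of two increments is a continuous function of the
    -- displacements at `a`, `b`, `a'`, `b'` from a common base time.
    have hid := hX.stationary_increments 4 ![a, b, a', b'] h
    have hm : Measurable (fun y : Fin 4 → Fin d → ℝ =>
        ((A *ᵥ y 0) k - (A *ᵥ y 1) k) * ((A *ᵥ y 2) l - (A *ᵥ y 3) l)) :=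
      Continuous.measurable (by unfold Matrix.mulVec dotProduct; fun_prop)
    have := (hid.comp hm).integral_eq
    simpa [Function.comp_def, Matrix.mulVec_sub] using this

variable {P : Measure Ω} {x : ι → ℝ → Ω → ℝ}

theorem HasStationaryIncrements.integral_sq_sub (hx : HasStationaryIncrements P x) (k : ι)
    (a b : ℝ) : ∫ ω, (x k a ω - x k b ω) ^ 2 ∂P = ∫ ω, x k (a - b) ω ^ 2 ∂P := by
  have h := hx.integral_mul k k (a - b) 0 (a - b) 0 b
  simp only [sub_add_cancel, zero_add, ← sq] at h
  rw [h]
  refine integral_congr_ae ?_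
  filter_upwards [hx.zero k] with ω hω
  rw [hω, sub_zero]

/-- The L² norm of `x k v` is measurable in `v`, even by stationarity, and subadditive by
stationarity and Minkowski. No continuity in time is assumed, so the growth bound has to come from
`exists_exp_bound`. -/
theorem HasStationaryIncrements.exists_growth [IsProbabilityMeasure P]
    (hx : HasStationaryIncrements P x) (k : ι)
    {ε : ℝ} (hε : 0 < ε) : ∃ M, 0 ≤ M ∧
      ∀ a b, ∫ ω, (x k a ω - x k b ω) ^ 2 ∂P ≤ (M * Real.exp (ε * |a - b|)) ^ 2 := by
  set q : ℝ → ℝ := fun v => ∫ ω, x k v ω ^ 2 ∂P with hq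
  have hq0 : ∀ v, 0 ≤ q v := fun v => integral_nonneg fun _ => sq_nonneg _
  have hqm : Measurable q :=
    ((hx.measurable k).pow_const 2).stronglyMeasurable.integral_prod_right'.measurable
  obtain ⟨M, hM, h⟩ := exists_exp_bound (m := fun v => Real.sqrt (q v)) hqm.sqrt
    (fun v => by
      have h1 := hx.integral_sq_sub k 0 v
      have h2 := hx.integral_sq_sub k v 0
      have h3 : ∫ ω, (x k 0 ω - x k v ω) ^ 2 ∂P = ∫ ω, (x k v ω - x k 0 ω) ^ 2 ∂P :=
        integral_congr_ae (ae_of_all _ fun ω => by ring)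
      rw [zero_sub] at h1
      rw [sub_zero] at h2
      simp only [hq, ← h1, h3, h2])
    (fun u v => by
      have h1 := hx.integral_sq_sub k (u + v) v
      rw [add_sub_cancel_right] at h1
      have h2 := integral_norm_mul_le ((hx.memLp k (u + v)).sub (hx.memLp k v)) (hx.memLp k v)
        (Real.sqrt_nonneg (q u)) (Real.sqrt_nonneg (q v))
        (by simp only [Pi.sub_apply, h1]; rw [Real.sq_sqrt (hq0 u)])
        (by rw [Real.sq_sqrt (hq0 v)])
      refine Real.sqrt_le_iff.2 ⟨by positivity, ?_⟩
      have i1 := ((hx.memLp k (u + v)).sub (hx.memLp k v)).integrable_sq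
      have i2 := (hx.memLp k v).integrable_sq
      have i3 := ((hx.memLp k (u + v)).sub (hx.memLp k v)).integrable_mul (hx.memLp k v)
      have h3 : q (u + v) = (∫ ω, (x k (u + v) ω - x k v ω) ^ 2 ∂P) + ∫ ω, x k v ω ^ 2 ∂P
          + 2 * ∫ ω, (x k (u + v) ω - x k v ω) * x k v ω ∂P := by
        rw [← integral_const_mul]
        rw [← integral_add, ← integral_add]
        · refine integral_congr_ae (ae_of_all _ fun ω => ?_)
          ring_nf
        · exact i1.add i2
        · exact i3.const_mul 2
        · exact i1
        · exact i2
      have h4 : ∫ ω, (x k (u + v) ω - x k v ω) * x k v ω ∂P ≤ Real.sqrt (q u) * Real.sqrt (q v) :=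
        (Real.le_norm_self _).trans ((norm_integral_le_integral_norm _).trans h2)
      rw [h3, h1, add_sq, Real.sq_sqrt (hq0 u), Real.sq_sqrt (hq0 v)]
      change q u + q v + _ ≤ _
      linarith) hε
  refine ⟨M, hM, fun a b => ?_⟩
  rw [hx.integral_sq_sub]
  have := pow_le_pow_left₀ (Real.sqrt_nonneg _) (h (a - b)) 2
  rwa [Real.sq_sqrt (hq0 _)] at this

end Increments

/-! ### Scalar Ornstein-Uhlenbeck processes -/

section Scalar

variable {Ω ι : Type*}

/-- The exponentially weighted integral of the past of a path. -/
noncomputable def pastIntegral (c : ℝ) (x : ℝ → ℝ) (τ : ℝ) : ℝ :=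
  ∫ s in Set.Iic τ, Real.exp (-(c * (τ - s))) * x s

/-- The stationary solution of `du = -c u dt + dx`. -/
noncomputable def stationaryOU (c : ℝ) (x : ℝ → Ω → ℝ) (τ : ℝ) (ω : Ω) : ℝ :=
  x τ ω - c * pastIntegral c (fun s => x s ω) τ

theorem measurable_stationaryOU [MeasurableSpace Ω] (c : ℝ) {x : ℝ → Ω → ℝ}
    (hx : Measurable (Function.uncurry x)) :
    Measurable (Function.uncurry (stationaryOU c x)) := by
  have h : Measurable (fun p : ℝ × Ω => pastIntegral c (fun s => x s p.2) p.1) := by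
    -- Moving the endpoint `τ` into an indicator fixes the domain of integration, so that joint
    -- measurability passes to the integral.
    have h1 : ∀ p : ℝ × Ω, pastIntegral c (fun s => x s p.2) p.1 =
        ∫ s, Set.indicator {q : (ℝ × Ω) × ℝ | q.2 ≤ q.1.1}
          (fun q => Real.exp (-(c * (q.1.1 - q.2))) * x q.2 q.1.2) (p, s) := by
      intro p
      rw [pastIntegral, ← integral_indicator measurableSet_Iic]
      refine integral_congr_ae (ae_of_all _ fun s => ?_)
      simp only [Set.indicator_apply, Set.mem_Iic, Set.mem_ofPred_eq]
    simp only [h1]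
    refine (StronglyMeasurable.integral_prod_right' ?_).measurable
    refine (Measurable.indicator ?_ ?_).stronglyMeasurable
    · exact (by fun_prop : Measurable fun q : (ℝ × Ω) × ℝ =>
        Real.exp (-(c * (q.1.1 - q.2)))).mul (hx.comp (by fun_prop :
          Measurable fun q : (ℝ × Ω) × ℝ => (q.2, q.1.2)))
    · exact measurableSet_le measurable_snd (by fun_prop)
  exact hx.sub (h.const_mul c)

/-- The kernel of the moving average representation of the stationary solution. -/
theorem integral_exp_kernel {c : ℝ} (hc : 0 < c) :
    ∫ v in Set.Ioi (0 : ℝ), c * Real.exp (-(c * v)) = 1 := by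
  have h := integral_exp_mul_Ioi (neg_lt_zero.2 hc) 0
  rw [integral_const_mul]
  simp only [neg_mul, mul_zero, Real.exp_zero] at h
  rw [h]
  field_simp

/-- Paths whose exponentially discounted past is integrable. -/
def IsTempered (c : ℝ) (x : ℝ → ℝ) : Prop :=
  ∀ τ, IntegrableOn (fun s => Real.exp (c * s) * x s) (Set.Iic τ)

theorem IsTempered.integrableOn {c : ℝ} {x : ℝ → ℝ} (hx : IsTempered c x) (τ : ℝ) :
    IntegrableOn (fun s => Real.exp (-(c * (τ - s))) * x s) (Set.Iic τ) := by
  refine ((hx τ).const_mul (Real.exp (-(c * τ)))).congr (ae_of_all _ fun s => ?_)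
  simp only
  rw [← mul_assoc, ← Real.exp_add]
  congr 2
  ring

/-- The kernel `c e^{-cv}` has mass one, so `x τ` can be put under the integral. Only increments of
the path remain, and this is the source of stationarity. -/
theorem stationaryOU_eq_integral {c : ℝ} (hc : 0 < c) {x : ℝ → Ω → ℝ} {ω : Ω}
    (hx : IsTempered c (fun s => x s ω)) (τ : ℝ) :
    stationaryOU c x τ ω =
      ∫ v in Set.Ioi (0 : ℝ), c * Real.exp (-(c * v)) * (x τ ω - x (τ - v) ω) := by
  have hmp := Measure.measurePreserving_sub_left (volume : Measure ℝ) τ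
  have hemb : MeasurableEmbedding (fun v : ℝ => τ - v) :=
    (Homeomorph.subLeft τ).measurableEmbedding
  have hpre : (fun v : ℝ => τ - v) ⁻¹' Set.Iic τ = Set.Ici 0 := by
    ext v; simp
  have h1 : pastIntegral c (fun s => x s ω) τ =
      ∫ v in Set.Ioi (0 : ℝ), Real.exp (-(c * v)) * x (τ - v) ω := by
    rw [← integral_Ici_eq_integral_Ioi, pastIntegral,
      ← hmp.setIntegral_preimage_emb hemb (fun s => Real.exp (-(c * (τ - s))) * x s ω), hpre]
    simp
  have hi : IntegrableOn (fun v => Real.exp (-(c * v)) * x (τ - v) ω) (Set.Ioi 0) := by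
    have := (hmp.integrableOn_comp_preimage hemb).2 (hx.integrableOn τ)
    rw [hpre] at this
    refine (this.mono_set Set.Ioi_subset_Ici_self).congr (ae_of_all _ fun v => ?_)
    simp
  have hi' : IntegrableOn (fun v => c * Real.exp (-(c * v))) (Set.Ioi 0) := by
    have := (integrableOn_exp_mul_Ioi (neg_lt_zero.2 hc) 0).const_mul c
    simp only [neg_mul] at this
    exact this
  rw [stationaryOU, h1]
  calc x τ ω - c * ∫ v in Set.Ioi (0 : ℝ), Real.exp (-(c * v)) * x (τ - v) ω
      = (∫ v in Set.Ioi (0 : ℝ), c * Real.exp (-(c * v))) * x τ ω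
        - c * ∫ v in Set.Ioi (0 : ℝ), Real.exp (-(c * v)) * x (τ - v) ω := by
        rw [integral_exp_kernel hc, one_mul]
    _ = _ := by
        rw [← integral_mul_const, ← integral_const_mul, ← integral_sub (hi'.mul_const _)
          (hi.const_mul c)]
        refine integral_congr_ae (ae_of_all _ fun v => ?_)
        simp only
        ring

theorem stationaryOU_sub {c : ℝ} {x : ℝ → Ω → ℝ} {ω : Ω}
    (hx : IsTempered c (fun s => x s ω)) {τ : ℝ} (hτ : 0 ≤ τ) :
    IntervalIntegrable (fun s => stationaryOU c x s ω) volume 0 τ ∧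
    stationaryOU c x τ ω - stationaryOU c x 0 ω =
      x τ ω - x 0 ω - c * ∫ s in (0 : ℝ)..τ, stationaryOU c x s ω := by
  obtain ⟨h1, h2, h3⟩ := integral_past_sub hx hτ
  refine ⟨h2.sub (h1.const_mul c), ?_⟩
  change _ = x τ ω - x 0 ω - c * ∫ s in (0 : ℝ)..τ, (x s ω - c * pastIntegral c (fun s => x s ω) s)
  rw [show (∫ s in (0 : ℝ)..τ, (x s ω - c * pastIntegral c (fun s => x s ω) s)) =
    pastIntegral c (fun s => x s ω) τ - pastIntegral c (fun s => x s ω) 0 from h3.symm]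
  simp only [stationaryOU]
  ring

variable [MeasurableSpace Ω] {P : Measure Ω} [IsProbabilityMeasure P] {x : ι → ℝ → Ω → ℝ}

/-- The root mean square of `x k s` grows at most like `e^{c|s|/2}`, which the weight `e^{cs}` beats
at `-∞`. Integer endpoints yield one null set for all `τ`. -/
theorem HasStationaryIncrements.ae_isTempered (hx : HasStationaryIncrements P x) (k : ι) {c : ℝ}
    (hc : 0 < c) : ∀ᵐ ω ∂P, IsTempered c (fun s => x k s ω) := by
  obtain ⟨M, hM, hgr⟩ := hx.exists_growth k (half_pos hc)
  have hb : ∀ s, ∫ ω, x k s ω ^ 2 ∂P ≤ (M * Real.exp (c / 2 * |s|)) ^ 2 := by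
    intro s
    have := hgr s 0
    rw [hx.integral_sq_sub, sub_zero] at this
    exact this
  have key : ∀ n : ℕ, ∀ᵐ ω ∂P,
      IntegrableOn (fun s => Real.exp (c * s) * x k s ω) (Set.Iic (n : ℝ)) := by
    intro n
    have hφ : IntegrableOn (fun s => Real.exp (c * s) * (M * Real.exp (c / 2 * |s|)))
        (Set.Iic (n : ℝ)) := by
      refine ((integrableOn_exp_mul_Iic (half_pos hc) n).const_mul
        (M * Real.exp (c * n))).mono' (by fun_prop) ?_
      filter_upwards [ae_restrict_mem measurableSet_Iic] with s hs
      rw [Real.norm_of_nonneg (by positivity)]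
      -- Hence the exponent `c s + (c/2)|s|` is at most `c n + (c/2) s` on the half-line up to `n`.
      have h1 : |s| ≤ 2 * n - s := by
        have hs' : s ≤ n := hs
        have : (0 : ℝ) ≤ n := Nat.cast_nonneg n
        rw [abs_le]
        constructor <;> linarith
      calc _ = M * Real.exp (c * s + c / 2 * |s|) := by rw [Real.exp_add]; ring
        _ ≤ M * Real.exp (c * n + c / 2 * s) := by
          refine mul_le_mul_of_nonneg_left (Real.exp_le_exp.2 ?_) hM
          linarith [mul_le_mul_of_nonneg_left h1 (half_pos hc).le]
        _ = _ := by rw [Real.exp_add]; ring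
    refine ae_integrable_of_memLp (f := fun s ω => Real.exp (c * s) * x k s ω)
      ((by fun_prop : Measurable fun q : ℝ × Ω => Real.exp (c * q.1)).mul (hx.measurable k))
      (fun s => (hx.memLp k s).const_mul _) hφ (fun s => by positivity) (fun s => ?_)
    simp only [mul_pow]
    rw [integral_const_mul, ← mul_pow M]
    gcongr
    exact hb s
  filter_upwards [ae_all_iff.2 key] with ω hω τ
  obtain ⟨n, hn⟩ := exists_nat_ge τ
  exact (hω n).mono_set (Set.Iic_subset_Iic.2 hn)

/-- The family of stationary solutions driven by a family of processes with stationary increments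
is weakly stationary. -/
theorem HasStationaryIncrements.stationaryOU_moments (hx : HasStationaryIncrements P x)
    {c : ι → ℝ} (hc : ∀ k, 0 < c k) :
    (∀ k, ∃ M, ∀ τ, MemLp (stationaryOU (c k) (x k) τ) 2 P ∧
      ∫ ω, stationaryOU (c k) (x k) τ ω ^ 2 ∂P ≤ M) ∧
    (∀ k τ, ∫ ω, stationaryOU (c k) (x k) τ ω ∂P = 0) ∧
    ∀ k l a b h, ∫ ω, stationaryOU (c k) (x k) (a + h) ω * stationaryOU (c l) (x l) (b + h) ω ∂P =
      ∫ ω, stationaryOU (c k) (x k) a ω * stationaryOU (c l) (x l) b ω ∂P := by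
  choose M hM hgr using fun k => hx.exists_growth k (half_pos (hc k))
  -- `f k τ v` is the integrand of the moving average. Its root mean square grows at half the rate
  -- at which the kernel decays, so the dominating function `φ k` is integrable.
  set f : ι → ℝ → ℝ → Ω → ℝ := fun k τ v ω =>
    c k * Real.exp (-(c k * v)) * (x k τ ω - x k (τ - v) ω) with hf
  have hfm : ∀ k τ, Measurable (Function.uncurry (f k τ)) := by
    intro k τ
    refine Measurable.mul (by fun_prop) (Measurable.sub ?_ ?_)
    · exact (hx.measurable k).comp (by fun_prop : Measurable fun q : ℝ × Ω => (τ, q.2))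
    · exact (hx.measurable k).comp (by fun_prop : Measurable fun q : ℝ × Ω => (τ - q.1, q.2))
  have hf2 : ∀ k τ v, MemLp (f k τ v) 2 P := fun k τ v =>
    ((hx.memLp k τ).sub (hx.memLp k (τ - v))).const_mul _
  set φ : ι → ℝ → ℝ := fun k v =>
    c k * Real.exp (-(c k * v)) * (M k * Real.exp (c k / 2 * |v|)) with hφdef
  have hφ0 : ∀ k v, 0 ≤ φ k v := fun k v => by
    have := hc k
    have := hM k
    positivity
  have hfφ : ∀ k τ v, ∫ ω, f k τ v ω ^ 2 ∂P ≤ φ k v ^ 2 := by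
    intro k τ v
    simp only [hf, hφdef]
    simp only [mul_pow _ (_ - _), mul_pow _ (M k * _)]
    rw [integral_const_mul]
    gcongr
    have := hgr k τ (τ - v)
    rwa [sub_sub_cancel] at this
  have hφ : ∀ k, Integrable (φ k) (volume.restrict (Set.Ioi 0)) := by
    intro k
    have h1 : -(c k / 2) < 0 := neg_lt_zero.2 (half_pos (hc k))
    refine ((integrableOn_exp_mul_Ioi h1 0).const_mul (c k * M k)).congr ?_
    filter_upwards [ae_restrict_mem measurableSet_Ioi] with v hv
    simp only [hφdef]
    rw [abs_of_pos hv]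
    calc _ = c k * M k * Real.exp (-(c k * v) + c k / 2 * v) := by ring_nf
      _ = _ := by rw [Real.exp_add]; ring
  have hU : ∀ k τ, stationaryOU (c k) (x k) τ =ᵐ[P]
      fun ω => ∫ v, f k τ v ω ∂(volume.restrict (Set.Ioi 0)) := by
    intro k τ
    filter_upwards [hx.ae_isTempered k (hc k)] with ω hω
    exact stationaryOU_eq_integral (hc k) hω τ
  refine ⟨fun k => ⟨(∫ v, φ k v ∂(volume.restrict (Set.Ioi 0))) ^ 2, fun τ => ?_⟩,
    fun k τ => ?_, fun k l a b h => ?_⟩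
  · have := memLp_integral (hfm k τ) (hf2 k τ) (hφ k) (hφ0 k) (hfφ k τ)
    refine ⟨this.1.ae_eq (hU k τ).symm, le_trans (le_of_eq ?_) this.2⟩
    refine integral_congr_ae ?_
    filter_upwards [hU k τ] with ω hω
    rw [hω]
  · have := (integral_mul_integral_right (g := fun _ => (1 : ℝ)) (hfm k τ) measurable_const
      (hf2 k τ) (memLp_const 1) (hφ k) (hφ0 k) (hfφ k τ)).2
    simp only [mul_one] at this
    rw [integral_congr_ae (hU k τ), this, integral_eq_zero_of_ae]
    refine ae_of_all _ fun v => ?_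
    simp only [hf, Pi.zero_apply]
    rw [integral_const_mul, integral_sub ((hx.memLp k _).integrable one_le_two)
      ((hx.memLp k _).integrable one_le_two), hx.centered, hx.centered]
    simp
  · have key : ∀ a b, ∫ ω, stationaryOU (c k) (x k) a ω * stationaryOU (c l) (x l) b ω ∂P =
        ∫ p, ∫ ω, f k a p.1 ω * f l b p.2 ω ∂P
          ∂((volume.restrict (Set.Ioi 0)).prod (volume.restrict (Set.Ioi 0))) := by
      intro a b
      rw [← (integral_mul_integral (hfm k a) (hfm l b) (hf2 k a) (hf2 l b) (hφ k) (hφ l) (hφ0 k)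
        (hφ0 l) (hfφ k a) (hfφ l b)).2]
      refine integral_congr_ae ?_
      filter_upwards [hU k a, hU l b] with ω h1 h2
      rw [h1, h2]
    rw [key, key]
    refine integral_congr_ae (ae_of_all _ fun p => ?_)
    -- Under the Fubini integral only cross moments of increments are left, and these are invariant
    -- under a common shift.
    have h1 := hx.integral_mul k l a (a - p.1) b (b - p.2) h
    have e : ∀ a b ω, f k a p.1 ω * f l b p.2 ω =
        (c k * Real.exp (-(c k * p.1)) * (c l * Real.exp (-(c l * p.2)))) *
        ((x k a ω - x k (a - p.1) ω) * (x l b ω - x l (b - p.2) ω)) := fun a b ω => by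
      simp only [hf]; ring
    simp only [e, integral_const_mul]
    rw [← h1]
    simp only [add_sub_right_comm]

end Scalar

/-! ### The stationary solution in eigencoordinates -/

theorem intervalIntegrable_sum {ι : Type*} (s : Finset ι) {f : ι → ℝ → ℝ} {a b : ℝ}
    (h : ∀ i ∈ s, IntervalIntegrable (f i) volume a b) :
    IntervalIntegrable (fun x => ∑ i ∈ s, f i x) volume a b := by
  have := IntervalIntegrable.sum s h
  rwa [Finset.sum_fn] at this

section Spectral

variable {d : ℕ}

theorem exists_orthogonal_diagonalization {Θ : Mat d} (hΘ : Θ.IsHermitian) :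
    ∃ (Q : Mat d) (c : Fin d → ℝ), (∀ k, c k = hΘ.eigenvalues k) ∧ Q * Qᵀ = 1 ∧ Qᵀ * Q = 1 ∧
      Θ = Q * Matrix.diagonal c * Qᵀ := by
  refine ⟨hΘ.eigenvectorUnitary, hΘ.eigenvalues, fun _ => rfl, ?_, ?_, ?_⟩
  · have := Unitary.coe_mul_star_self hΘ.eigenvectorUnitary
    rwa [Unitary.coe_star, Matrix.star_eq_conjTranspose,
      Matrix.conjTranspose_eq_transpose_of_trivial] at this
  · have := Unitary.coe_star_mul_self hΘ.eigenvectorUnitary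
    rwa [Matrix.star_eq_conjTranspose,
      Matrix.conjTranspose_eq_transpose_of_trivial] at this
  · have := hΘ.spectral_theorem
    rw [Unitary.conjStarAlgAut_apply, Matrix.star_eq_conjTranspose,
      Matrix.conjTranspose_eq_transpose_of_trivial] at this
    exact this

theorem exp_smul_orthogonal {Q : Mat d} (h1 : Q * Qᵀ = 1) (c : Fin d → ℝ) (v : ℝ) :
    NormedSpace.exp (v • (Q * Matrix.diagonal c * Qᵀ)) =
      Q * Matrix.diagonal (fun k => Real.exp (v * c k)) * Qᵀ := by
  have hinv : Q⁻¹ = Qᵀ := Matrix.inv_eq_right_inv h1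
  have hu : IsUnit Q := by
    rw [Matrix.isUnit_iff_isUnit_det]
    exact Matrix.isUnit_det_of_right_inverse h1
  have h : v • (Q * Matrix.diagonal c * Qᵀ) = Q * Matrix.diagonal (fun k => v * c k) * Q⁻¹ := by
    rw [hinv, ← Matrix.smul_mul, ← Matrix.mul_smul, ← Matrix.diagonal_smul]
    rfl
  rw [h, Matrix.exp_conj _ _ hu, Matrix.exp_diagonal, hinv]
  congr 3
  ext k
  rw [Pi.coe_exp, Real.exp_eq_exp_ℝ]

theorem mulVec_mulVec_orthogonal {Q : Mat d} (h2 : Qᵀ * Q = 1) (c p : Fin d → ℝ) :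
    (Q * Matrix.diagonal c * Qᵀ) *ᵥ (Q *ᵥ p) = Q *ᵥ (Matrix.diagonal c *ᵥ p) := by
  rw [Matrix.mulVec_mulVec, Matrix.mul_assoc, h2, Matrix.mul_one, Matrix.mulVec_mulVec]

theorem exists_uniform_lower_bound {c : Fin d → ℝ} (hc : ∀ k, 0 < c k) :
    ∃ c₀, 0 < c₀ ∧ ∀ k, c₀ ≤ c k := by
  rcases isEmpty_or_nonempty (Fin d) with h | h
  -- In dimension zero any positive number serves.
  · exact ⟨1, one_pos, fun k => (h.false k).elim⟩
  · obtain ⟨k, hk⟩ := Finite.exists_min c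
    exact ⟨c k, hc k, hk⟩

end Spectral

/-! ### The vector equation: its stationary solution and the convergence of every solution to it. -/

section Solution

variable {Ω : Type*} {d : ℕ}

/-- In the eigenbasis of `Θ` the matrix exponential is diagonal and the coordinates decouple.
Temperedness allows the vector integral to be taken coordinate by coordinate. -/
theorem stationarySol_eq {X : ℝ → Ω → Fin d → ℝ} {Q σ : Mat d} {c : Fin d → ℝ}
    (h1 : Q * Qᵀ = 1) (h2 : Qᵀ * Q = 1) {ω : Ω}
    (h : ∀ k, IsTempered (c k) (fun s => ((Qᵀ * σ) *ᵥ X s ω) k)) (τ : ℝ) :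
    stationarySol X (Q * Matrix.diagonal c * Qᵀ) σ τ ω =
      Q *ᵥ fun k => stationaryOU (c k) (fun s ω => ((Qᵀ * σ) *ᵥ X s ω) k) τ ω := by
  have hσ : ∀ s, Qᵀ *ᵥ (σ *ᵥ X s ω) = (Qᵀ * σ) *ᵥ X s ω := fun s => by
    rw [Matrix.mulVec_mulVec]
  have hint : ∀ s, NormedSpace.exp ((-(τ - s)) • (Q * Matrix.diagonal c * Qᵀ)) *ᵥ (σ *ᵥ X s ω) =
      Matrix.mulVecLin Q
        (fun k => Real.exp (-(c k * (τ - s))) * ((Qᵀ * σ) *ᵥ X s ω) k) := by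
    intro s
    rw [exp_smul_orthogonal h1, Matrix.mulVecLin_apply, ← Matrix.mulVec_mulVec, hσ,
      ← Matrix.mulVec_mulVec]
    congr 1
    ext k
    rw [Matrix.mulVec_diagonal]
    congr 2
    ring
  have hI : ∫ s in Set.Iic τ,
      NormedSpace.exp ((-(τ - s)) • (Q * Matrix.diagonal c * Qᵀ)) *ᵥ (σ *ᵥ X s ω) =
      Q *ᵥ fun k => pastIntegral (c k) (fun s => ((Qᵀ * σ) *ᵥ X s ω) k) τ := by
    simp only [hint]
    have h3 := ContinuousLinearMap.integral_comp_comm (𝕜 := ℝ)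
      (μ := volume.restrict (Set.Iic τ)) (LinearMap.toContinuousLinearMap (Matrix.mulVecLin Q))
      (φ := fun s k => Real.exp (-(c k * (τ - s))) * ((Qᵀ * σ) *ᵥ X s ω) k)
      (Integrable.of_eval fun k => (h k).integrableOn τ)
    simp only [LinearMap.coe_toContinuousLinearMap'] at h3
    rw [h3, Matrix.mulVecLin_apply]
    congr 1
    ext k
    rw [eval_integral fun k => (h k).integrableOn τ]
    rfl
  have hX : σ *ᵥ X τ ω = Q *ᵥ ((Qᵀ * σ) *ᵥ X τ ω) := by
    rw [Matrix.mulVec_mulVec, ← Matrix.mul_assoc, h1, Matrix.one_mul]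
  rw [stationarySol, hI, hX, mulVec_mulVec_orthogonal h2, ← Matrix.mulVec_sub]
  congr 1
  ext k
  rw [Pi.sub_apply, Matrix.mulVec_diagonal]
  rfl

variable [MeasurableSpace Ω]

/-- A jointly measurable, weakly stationary, centred solution `u` of `du = -Θ u dt + dY` with
autocovariance `γ`. -/
structure IsStationarySolution (P : Measure Ω) (Y : ℝ → Ω → Fin d → ℝ) (Θ : Mat d)
    (γ : ℝ → Mat d) (u : ℝ → Ω → Fin d → ℝ) : Prop where
  measurable : Measurable (Function.uncurry u)
  memLp : ∀ τ i, MemLp (fun ω => u τ ω i) 2 P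
  bound : ∃ M, 0 ≤ M ∧ ∀ τ i, ∫ ω, u τ ω i ^ 2 ∂P ≤ M ^ 2
  centered : ∀ τ i, ∫ ω, u τ ω i ∂P = 0
  integral_mul : ∀ a b i j, ∫ ω, u a ω i * u b ω j ∂P = γ (a - b) i j
  equation : ∀ᵐ ω ∂P, ∀ τ, 0 ≤ τ → ∀ i, IntervalIntegrable (fun s => u s ω i) volume 0 τ ∧
    u τ ω i = u 0 ω i + Y τ ω i - ∑ j, Θ i j * ∫ s in (0 : ℝ)..τ, u s ω j

/-- `u` is defined for every `ω` by the formula in eigencoordinates, which makes its joint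
measurability visible. It agrees with `stationarySol` almost surely at all times simultaneously, so
time integrals along paths may be exchanged. -/
theorem exists_isStationarySolution {P : Measure Ω} [IsProbabilityMeasure P]
    {X : ℝ → Ω → Fin d → ℝ} (hX : IsNoise P X) {Θ : Mat d} (hΘ : Θ.PosDef) (σ : Mat d) :
    ∃ u : ℝ → Ω → Fin d → ℝ,
      IsStationarySolution P (fun τ ω => σ *ᵥ X τ ω) Θ (autocov P X Θ σ) u ∧
      ∀ᵐ ω ∂P, ∀ τ, stationarySol X Θ σ τ ω = u τ ω := by
  obtain ⟨Q, c, hcev, h1, h2, hQ⟩ := exists_orthogonal_diagonalization hΘ.1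
  have hc : ∀ k, 0 < c k := fun k => by rw [hcev]; exact hΘ.eigenvalues_pos k
  have hx := hX.hasStationaryIncrements (Qᵀ * σ)
  set x : Fin d → ℝ → Ω → ℝ := fun k τ ω => ((Qᵀ * σ) *ᵥ X τ ω) k with hxdef
  set y : Fin d → ℝ → Ω → ℝ := fun k => stationaryOU (c k) (x k) with hydef
  obtain ⟨hm1, hm2, hm3⟩ := hx.stationaryOU_moments hc
  have hym : ∀ k, Measurable (Function.uncurry (y k)) := fun k =>
    measurable_stationaryOU _ (hx.measurable k)
  have hy2 : ∀ k τ, MemLp (y k τ) 2 P := fun k τ => ((hm1 k).choose_spec τ).1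
  have htemp : ∀ᵐ ω ∂P, ∀ k, IsTempered (c k) (fun s => x k s ω) :=
    ae_all_iff.2 fun k => hx.ae_isTempered k (hc k)
  have hsol : ∀ᵐ ω ∂P, ∀ τ, stationarySol X Θ σ τ ω = Q *ᵥ fun k => y k τ ω := by
    filter_upwards [htemp] with ω hω τ
    rw [hQ]
    exact stationarySol_eq h1 h2 hω τ
  have happ : ∀ τ ω i, (Q *ᵥ fun k => y k τ ω) i = ∑ k, Q i k * y k τ ω := fun τ ω i => rfl
  have hL2 : ∀ τ i, MemLp (fun ω => (Q *ᵥ fun k => y k τ ω) i) 2 P := fun τ i => by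
    simp only [happ]
    exact memLp_finsetSum _ fun k _ => (hy2 k τ).const_mul _
  have hcross : ∀ a b i j, ∫ ω, (Q *ᵥ fun k => y k a ω) i * (Q *ᵥ fun k => y k b ω) j ∂P =
      ∑ k, ∑ l, Q i k * Q j l * ∫ ω, y k a ω * y l b ω ∂P := by
    intro a b i j
    have hi : ∀ k l, Integrable (fun ω => Q i k * Q j l * (y k a ω * y l b ω)) P := fun k l =>
      ((hy2 k a).integrable_mul (hy2 l b)).const_mul _
    simp only [happ, ← integral_const_mul]
    simp_rw [← integral_finsetSum _ (fun l _ => hi _ l)]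
    rw [← integral_finsetSum _ (fun k _ => integrable_finsetSum _ fun l _ => hi k l)]
    refine integral_congr_ae (ae_of_all _ fun ω => ?_)
    simp only [Finset.sum_mul_sum]
    refine Finset.sum_congr rfl fun k _ => Finset.sum_congr rfl fun l _ => ?_
    ring
  have hauto : ∀ s i j, autocov P X Θ σ s i j =
      ∫ ω, (Q *ᵥ fun k => y k s ω) i * (Q *ᵥ fun k => y k 0 ω) j ∂P := by
    intro s i j
    refine integral_congr_ae ?_
    filter_upwards [hsol] with ω hω
    rw [hω, hω]
  have hshift : ∀ a b i j, ∫ ω, (Q *ᵥ fun k => y k a ω) i * (Q *ᵥ fun k => y k b ω) j ∂P =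
      autocov P X Θ σ (a - b) i j := by
    intro a b i j
    rw [hauto, hcross, hcross]
    refine Finset.sum_congr rfl fun k _ => Finset.sum_congr rfl fun l _ => ?_
    have := hm3 k l (a - b) 0 b
    rw [sub_add_cancel, zero_add] at this
    rw [this]
  refine ⟨fun τ ω => Q *ᵥ fun k => y k τ ω, ⟨?_, hL2, ?_, ?_, hshift, ?_⟩, hsol⟩
  · refine measurable_pi_lambda _ fun i => ?_
    change Measurable fun p : ℝ × Ω => ∑ k, Q i k * y k p.1 p.2
    exact Finset.measurable_fun_sum _ fun k _ => (hym k).const_mul _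
  -- By stationarity every second moment is a diagonal entry of the autocovariance at lag zero.
  · refine ⟨Real.sqrt (∑ i, |autocov P X Θ σ 0 i i|), Real.sqrt_nonneg _, fun τ i => ?_⟩
    rw [Real.sq_sqrt (Finset.sum_nonneg fun _ _ => abs_nonneg _)]
    have := hshift τ τ i i
    rw [sub_self] at this
    simp only [sq, this]
    exact (le_abs_self _).trans
      (Finset.single_le_sum (f := fun i => |autocov P X Θ σ 0 i i|)
        (fun _ _ => abs_nonneg _) (Finset.mem_univ i))
  · intro τ i
    simp only [happ]
    rw [integral_finsetSum _ fun k _ => ((hy2 k τ).integrable one_le_two).const_mul _]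
    simp only [integral_const_mul]
    exact Finset.sum_eq_zero fun k _ => by rw [hm2 k τ, mul_zero]
  · have hx0 : ∀ᵐ ω ∂P, ∀ k, x k 0 ω = 0 := ae_all_iff.2 hx.zero
    filter_upwards [htemp, hx0] with ω hω h0 τ hτ i
    have hode := fun k => stationaryOU_sub (x := x k) (hω k) hτ
    have hii : ∀ i, IntervalIntegrable (fun s => (Q *ᵥ fun k => y k s ω) i) volume 0 τ := by
      intro i
      simp only [happ]
      exact intervalIntegrable_sum _ fun k _ => (hode k).1.const_mul _
    refine ⟨hii i, ?_⟩
    have hI : ∀ j, ∫ s in (0 : ℝ)..τ, (Q *ᵥ fun k => y k s ω) j =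
        (Q *ᵥ fun k => ∫ s in (0 : ℝ)..τ, y k s ω) j := by
      intro j
      simp only [happ]
      rw [intervalIntegral.integral_finsetSum fun k _ => (hode k).1.const_mul _]
      simp only [intervalIntegral.integral_const_mul]
      rfl
    simp only [hI]
    change _ = _ + _ - (Θ *ᵥ (Q *ᵥ fun k => ∫ s in (0 : ℝ)..τ, y k s ω)) i
    have hX' : σ *ᵥ X τ ω = Q *ᵥ fun k => x k τ ω := by
      change _ = Q *ᵥ ((Qᵀ * σ) *ᵥ X τ ω)
      rw [Matrix.mulVec_mulVec, ← Matrix.mul_assoc, h1, Matrix.one_mul]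
    have hy : (fun k => y k τ ω) = (fun k => y k 0 ω) + (fun k => x k τ ω) -
        Matrix.diagonal c *ᵥ fun k => ∫ s in (0 : ℝ)..τ, y k s ω := by
      ext k
      have := (hode k).2
      rw [h0 k] at this
      simp only [Pi.add_apply, Pi.sub_apply, Matrix.mulVec_diagonal, hydef]
      linarith
    rw [hX', hy, hQ, mulVec_mulVec_orthogonal h2, Matrix.mulVec_sub, Matrix.mulVec_add]
    rfl

/-- The difference between a solution of the stochastic differential equation and the stationary
solution decays exponentially. -/
theorem IsVasicek.exists_decay {P : Measure Ω} {X r : ℝ → Ω → Fin d → ℝ} {Θ σ : Mat d}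
    {b : Fin d → ℝ} (hr : IsVasicek P X Θ σ b r) (hΘ : Θ.PosDef) {γ : ℝ → Mat d}
    {u : ℝ → Ω → Fin d → ℝ} (hu : IsStationarySolution P (fun τ ω => σ *ᵥ X τ ω) Θ γ u) :
    ∃ c₀, 0 < c₀ ∧ ∀ᵐ ω ∂P, ∃ κ, 0 ≤ κ ∧
      ∀ τ, 0 ≤ τ → ∀ i, |r τ ω i - b i - u τ ω i| ≤ κ * Real.exp (-(c₀ * τ)) := by
  obtain ⟨Q, c, hcev, h1, h2, hQ⟩ := exists_orthogonal_diagonalization hΘ.1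
  have hc : ∀ k, 0 < c k := fun k => by rw [hcev]; exact hΘ.eigenvalues_pos k
  obtain ⟨c₀, hc₀, hle⟩ := exists_uniform_lower_bound hc
  refine ⟨c₀, hc₀, ?_⟩
  filter_upwards [hr.equation, hu.equation] with ω hr hu
  set z : ℝ → Fin d → ℝ := fun τ i => r τ ω i - b i - u τ ω i with hz
  have hri : ∀ τ, 0 ≤ τ → ∀ i, IntervalIntegrable (fun s => r s ω i) volume 0 τ := by
    intro τ hτ i
    have := (hr τ hτ).1
    rw [intervalIntegrable_iff] at this ⊢
    exact this.eval i
  have hzi : ∀ τ, 0 ≤ τ → ∀ i, IntervalIntegrable (fun s => z s i) volume 0 τ := fun τ hτ i =>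
    ((hri τ hτ i).sub intervalIntegrable_const).sub (hu τ hτ i).1
  -- The noise `σ X τ` occurs in both equations and cancels, and so does the level `b`.
  have hzeq : ∀ τ, 0 ≤ τ → z τ = z 0 - Θ *ᵥ fun j => ∫ s in (0 : ℝ)..τ, z s j := by
    intro τ hτ
    ext i
    have e1 := congrFun (hr τ hτ).2 i
    have e2 := (hu τ hτ i).2
    have e3 : (∫ s in (0 : ℝ)..τ, Θ *ᵥ (b - r s ω)) i =
        ∑ j, Θ i j * ∫ s in (0 : ℝ)..τ, (b j - r s ω j) := by
      have hint : ∀ j, IntervalIntegrable (fun s => b j - r s ω j) volume 0 τ := fun j =>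
        intervalIntegrable_const.sub (hri τ hτ j)
      have hint2 : ∀ i, IntervalIntegrable (fun s => (Θ *ᵥ (b - r s ω)) i) volume 0 τ := fun i =>
        intervalIntegrable_sum (Finset.univ) fun j _ => (hint j).const_mul (Θ i j)
      rw [intervalIntegral.integral_of_le hτ, eval_integral fun i =>
        (intervalIntegrable_iff_integrableOn_Ioc_of_le hτ).1 (hint2 i),
        ← intervalIntegral.integral_of_le hτ]
      change ∫ s in (0 : ℝ)..τ, ∑ j, Θ i j * (b j - r s ω j) = _
      rw [intervalIntegral.integral_finsetSum fun j _ => (hint j).const_mul _]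
      simp only [intervalIntegral.integral_const_mul]
    simp only [Pi.add_apply, e3] at e1
    have e4 : ∀ j, ∫ s in (0 : ℝ)..τ, z s j =
        -(∫ s in (0 : ℝ)..τ, (b j - r s ω j)) - ∫ s in (0 : ℝ)..τ, u s ω j := by
      intro j
      rw [← intervalIntegral.integral_neg, ← intervalIntegral.integral_sub]
      · refine intervalIntegral.integral_congr fun s _ => ?_
        simp only [hz]
        ring
      · exact (intervalIntegrable_const.sub (hri τ hτ j)).neg
      · exact (hu τ hτ j).1
    simp only [Pi.sub_apply, Matrix.mulVec, dotProduct, e4, mul_sub, mul_neg,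
      Finset.sum_sub_distrib, Finset.sum_neg_distrib]
    simp only [hz]
    rw [e1, e2]
    simp only [Matrix.mulVec, dotProduct]
    ring
  have hdecay : ∀ τ, 0 ≤ τ → ∀ k, (Qᵀ *ᵥ z τ) k = Real.exp (-(c k * τ)) * (Qᵀ *ᵥ z 0) k := by
    intro τ hτ k
    refine eq_exp_of_integral_eq (z := fun τ => (Qᵀ *ᵥ z τ) k) (fun τ hτ => ⟨?_, ?_⟩) hτ
    · exact intervalIntegrable_sum (Finset.univ) fun j _ => (hzi τ hτ j).const_mul (Qᵀ k j)
    · have hI : ∫ s in (0 : ℝ)..τ, (Qᵀ *ᵥ z s) k = (Qᵀ *ᵥ fun j => ∫ s in (0 : ℝ)..τ, z s j) k := by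
        change ∫ s in (0 : ℝ)..τ, ∑ j, Qᵀ k j * z s j = _
        rw [intervalIntegral.integral_finsetSum fun j _ => (hzi τ hτ j).const_mul _]
        simp only [intervalIntegral.integral_const_mul]
        rfl
      rw [hI, hzeq τ hτ, hQ, Matrix.mulVec_sub, Matrix.mulVec_mulVec, ← Matrix.mul_assoc,
        ← Matrix.mul_assoc, h2, Matrix.one_mul, ← Matrix.mulVec_mulVec, Pi.sub_apply,
        Matrix.mulVec_diagonal]
  refine ⟨∑ i, ∑ k, |Q i k| * |(Qᵀ *ᵥ z 0) k|, Finset.sum_nonneg fun _ _ =>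
    Finset.sum_nonneg fun _ _ => by positivity, fun τ hτ i => ?_⟩
  have hzQ : z τ = Q *ᵥ (Qᵀ *ᵥ z τ) := by rw [Matrix.mulVec_mulVec, h1, Matrix.one_mulVec]
  change |z τ i| ≤ _
  rw [hzQ]
  change |∑ k, Q i k * (Qᵀ *ᵥ z τ) k| ≤ _
  refine (Finset.abs_sum_le_sum_abs _ _).trans ?_
  calc ∑ k, |Q i k * (Qᵀ *ᵥ z τ) k|
      ≤ ∑ k, |Q i k| * |(Qᵀ *ᵥ z 0) k| * Real.exp (-(c₀ * τ)) := by
        refine Finset.sum_le_sum fun k _ => ?_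
        rw [hdecay τ hτ k, abs_mul, abs_mul, Real.abs_exp, mul_comm (Real.exp _), ← mul_assoc]
        gcongr
        exact hle k
    _ = (∑ k, |Q i k| * |(Qᵀ *ᵥ z 0) k|) * Real.exp (-(c₀ * τ)) := by rw [Finset.sum_mul]
    _ ≤ _ := by
        refine mul_le_mul_of_nonneg_right ?_ (Real.exp_pos _).le
        exact Finset.single_le_sum (f := fun i => ∑ k, |Q i k| * |(Qᵀ *ᵥ z 0) k|)
          (fun _ _ => Finset.sum_nonneg fun _ _ => by positivity) (Finset.mem_univ i)

end Solution

/-! ### The true coefficients -/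

section Functionals

variable {d : ℕ}

theorem transpose_riccatiB (g : ℝ → Mat d) (t : ℝ) : (riccatiB g t)ᵀ = -riccatiB g t := by
  ext i j
  simp only [riccatiB, Matrix.transpose_apply, Matrix.of_apply, Matrix.neg_apply,
    ← intervalIntegral.integral_neg, neg_sub]

/-- The substitution `w = u - s` splits the inner integral at lag `0` into a primitive of `gᵀ` up to
`s` and one of `g` up to `t - s`; Cauchy's formula collapses both double integrals. Only lags in
`[0, t]` remain and the symmetry becomes visible. -/
theorem riccatiC_apply {g : ℝ → Mat d} {t : ℝ} (ht : 0 ≤ t)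
    (hg : ∀ i j, IntervalIntegrable (fun s => g s i j) volume 0 t) (i j : Fin d) :
    riccatiC g t i j = ∫ s in (0 : ℝ)..t, (t - s) * (g s i j + g s j i) := by
  have hsub : ∀ {s}, s ∈ Set.Icc 0 t → ∀ i j, IntervalIntegrable (fun s => g s i j) volume 0 s := by
    intro s hs i j
    exact (hg i j).mono_set (by
      rw [Set.uIcc_of_le hs.1, Set.uIcc_of_le ht]; exact Set.Icc_subset_Icc_right hs.2)
  have hpos : ∀ {s}, s ∈ Set.Icc 0 t → IntervalIntegrable (fun w => lagExtend g w i j) volume 0 s ∧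
      ∫ w in (0 : ℝ)..s, lagExtend g w i j = ∫ w in (0 : ℝ)..s, g w i j := by
    intro s hs
    have h : ∀ w ∈ Set.uIoc 0 s, g w i j = lagExtend g w i j := by
      intro w hw
      rw [Set.uIoc_of_le hs.1] at hw
      rw [lagExtend, if_pos hw.1.le]
    exact ⟨(hsub hs i j).congr h,
      (intervalIntegral.integral_congr_ae (ae_of_all _ h)).symm⟩
  have hneg : ∀ {s}, s ∈ Set.Icc 0 t →
      IntervalIntegrable (fun w => lagExtend g w i j) volume (-s) 0 ∧
      ∫ w in (-s)..0, lagExtend g w i j = ∫ w in (0 : ℝ)..s, g w j i := by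
    intro s hs
    have h : ∀ w ∈ Set.uIoc 0 s, g w j i = lagExtend g (-w) i j := by
      intro w hw
      rw [Set.uIoc_of_le hs.1] at hw
      rw [lagExtend, if_neg (by linarith [hw.1]), neg_neg]
      rfl
    have hi := (hsub hs j i).congr h
    constructor
    · have := hi.comp_sub_left 0
      simp only [zero_sub, neg_neg, sub_zero] at this
      exact this.symm
    · rw [intervalIntegral.integral_congr_ae (ae_of_all _ h),
        intervalIntegral.integral_comp_neg (fun w => lagExtend g w i j), neg_zero]
  have hinner : ∀ s ∈ Set.uIcc 0 t, ∫ u in (0 : ℝ)..t, lagExtend g (u - s) i j =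
      (∫ w in (0 : ℝ)..s, g w j i) + ∫ w in (0 : ℝ)..(t - s), g w i j := by
    intro s hs
    rw [Set.uIcc_of_le ht] at hs
    have hs' : t - s ∈ Set.Icc 0 t := ⟨by linarith [hs.2], by linarith [hs.1]⟩
    rw [intervalIntegral.integral_comp_sub_right (fun w => lagExtend g w i j), zero_sub,
      ← intervalIntegral.integral_add_adjacent_intervals (hneg hs).1 (hpos hs').1, (hneg hs).2,
      (hpos hs').2]
  have hcont : ∀ i j, ContinuousOn (fun s => ∫ w in (0 : ℝ)..s, g w i j) (Set.uIcc 0 t) :=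
    fun i j => intervalIntegral.continuousOn_primitive_interval
      (by rw [← intervalIntegrable_iff']; exact hg i j)
  have h1 : IntervalIntegrable (fun s => ∫ w in (0 : ℝ)..(t - s), g w i j) volume 0 t := by
    have := (hcont i j).intervalIntegrable.comp_sub_left t
    simpa using this.symm
  have h2 : ContinuousOn (fun s => t - s) (Set.uIcc 0 t) := by fun_prop
  rw [riccatiC, Matrix.of_apply, intervalIntegral.integral_congr hinner,
    intervalIntegral.integral_add (hcont j i).intervalIntegrable h1,
    intervalIntegral.integral_comp_sub_left (fun s => ∫ w in (0 : ℝ)..s, g w i j), sub_self,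
    sub_zero, integral_integral_eq (hg i j), integral_integral_eq (hg j i), add_comm,
    ← intervalIntegral.integral_add ((hg i j).continuousOn_mul h2)
      ((hg j i).continuousOn_mul h2)]
  simp only [mul_add]

theorem transpose_riccatiC {g : ℝ → Mat d} {t : ℝ} (ht : 0 ≤ t)
    (hg : ∀ i j, IntervalIntegrable (fun s => g s i j) volume 0 t) :
    (riccatiC g t)ᵀ = riccatiC g t := by
  ext i j
  rw [Matrix.transpose_apply, riccatiC_apply ht hg, riccatiC_apply ht hg]
  simp only [add_comm]

end Functionals

/-! ### Second moments of the noise and of the stationary solution. -/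

section TrueCoefficients

variable {Ω : Type*} [MeasurableSpace Ω] {d : ℕ} {P : Measure Ω}

theorem IsNoise.covMat_apply {X : ℝ → Ω → Fin d → ℝ} (hX : IsNoise P X) (t : ℝ) (i j : Fin d) :
    covMat P (X t) i j = ∫ ω, X t ω i * X t ω j ∂P := by
  simp [covMat, covariance, hX.centered]

/-- Uncorrelated components make the covariance diagonal, and diagonal matrices commute. This
matches the noise term of `trueD` with the product estimated in `estD`. -/
theorem IsNoise.covMat_mul_comm {X : ℝ → Ω → Fin d → ℝ} (hX : IsNoise P X) {σ : Mat d}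
    (hσ : σ.IsDiag) (t : ℝ) : σ * covMat P (X t) * σᵀ = covMat P (X t) * (σ * σᵀ) := by
  have hV : (covMat P (X t)).IsDiag := fun i j hij => by
    change covMat P (X t) i j = 0
    rw [hX.covMat_apply, hX.uncorrelated t i j hij]
  rw [← hV.diagonal_diag, ← hσ.diagonal_diag]
  simp [Matrix.diagonal_mul_diagonal, Matrix.diagonal_transpose, mul_left_comm, mul_assoc]

theorem IsNoise.sandwich_covMat_apply [IsProbabilityMeasure P] {X : ℝ → Ω → Fin d → ℝ}
    (hX : IsNoise P X) (σ : Mat d)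
    (t : ℝ) (i j : Fin d) :
    (σ * covMat P (X t) * σᵀ) i j = ∫ ω, (σ *ᵥ X t ω) i * (σ *ᵥ X t ω) j ∂P := by
  have hL : ∀ k, MemLp (fun ω => X t ω k) 2 P := fun k =>
    (memLp_pi_iff.1 (hX.memLp t) k).mono_exponent (by norm_num)
  have hi : ∀ k l, Integrable (fun ω => σ i k * σ j l * (X t ω k * X t ω l)) P := fun k l =>
    ((hL k).integrable_mul (hL l)).const_mul _
  have : ∀ ω, (σ *ᵥ X t ω) i * (σ *ᵥ X t ω) j =
      ∑ k, ∑ l, σ i k * σ j l * (X t ω k * X t ω l) := by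
    intro ω
    simp only [Matrix.mulVec, dotProduct, Finset.sum_mul_sum]
    refine Finset.sum_congr rfl fun k _ => Finset.sum_congr rfl fun l _ => ?_
    ring
  simp only [this]
  rw [integral_finsetSum _ fun k _ => integrable_finsetSum _ fun l _ => hi k l]
  simp_rw [integral_finsetSum _ fun l _ => hi _ l, integral_const_mul, ← hX.covMat_apply]
  simp only [Matrix.mul_apply, Matrix.transpose_apply, Finset.sum_mul]
  rw [Finset.sum_comm]
  refine Finset.sum_congr rfl fun k _ => Finset.sum_congr rfl fun l _ => ?_
  ring

variable {Y : ℝ → Ω → Fin d → ℝ} {Θ : Mat d} {γ : ℝ → Mat d} {u : ℝ → Ω → Fin d → ℝ}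

namespace IsStationarySolution

theorem transpose_neg (hu : IsStationarySolution P Y Θ γ u) (s : ℝ) : (γ (-s))ᵀ = γ s := by
  ext i j
  have h1 := hu.integral_mul s 0 i j
  have h2 := hu.integral_mul 0 s j i
  rw [sub_zero] at h1
  rw [zero_sub] at h2
  rw [Matrix.transpose_apply, ← h1, ← h2]
  simp only [mul_comm]

/-- Stationarity gives the true autocovariance the reflection rule that the estimator receives by
definition. -/
theorem lagExtend_eq (hu : IsStationarySolution P Y Θ γ u) (s : ℝ) : lagExtend γ s = γ s := by
  rw [lagExtend]
  split_ifs
  · rfl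
  · exact hu.transpose_neg s

theorem measurable_autocov [SFinite P] (hu : IsStationarySolution P Y Θ γ u) (i j : Fin d) :
    Measurable fun s => γ s i j := by
  have h : (fun s => γ s i j) = fun s => ∫ ω, u s ω i * u 0 ω j ∂P := by
    ext s
    rw [hu.integral_mul, sub_zero]
  rw [h]
  have h1 : Measurable fun q : ℝ × Ω => u q.1 q.2 i := (measurable_pi_apply i).comp hu.measurable
  have h2 : Measurable fun q : ℝ × Ω => u 0 q.2 j := (measurable_pi_apply j).comp
    (hu.measurable.comp (by fun_prop : Measurable fun q : ℝ × Ω => ((0 : ℝ), q.2)))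
  exact (h1.mul h2).stronglyMeasurable.integral_prod_right'.measurable

theorem exists_abs_autocov_le (hu : IsStationarySolution P Y Θ γ u) :
    ∃ K, ∀ s i j, |γ s i j| ≤ K := by
  obtain ⟨M, hM, hb⟩ := hu.bound
  refine ⟨M * M, fun s i j => ?_⟩
  have := hu.integral_mul s 0 i j
  rw [sub_zero] at this
  rw [← this]
  exact (norm_integral_le_integral_norm _).trans
    (integral_norm_mul_le (hu.memLp s i) (hu.memLp 0 j) hM hM (hb s i) (hb 0 j))

theorem intervalIntegrable_autocov [SFinite P]
    (hu : IsStationarySolution P Y Θ γ u) (i j : Fin d) (a b : ℝ) :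
    IntervalIntegrable (fun s => γ s i j) volume a b := by
  obtain ⟨K, hK⟩ := hu.exists_abs_autocov_le
  refine (intervalIntegrable_const (c := K)).mono_fun'
    (hu.measurable_autocov i j).aestronglyMeasurable (ae_of_all _ fun s => hK s i j)

/-- The integral of the stationary solution over `[0, t]`. -/
theorem integral_mul_increment [IsProbabilityMeasure P]
    (hu : IsStationarySolution P Y Θ γ u) {t : ℝ} (ht : 0 ≤ t)
    (i l : Fin d) :
    MemLp (fun ω => ∫ s in (0 : ℝ)..t, u s ω l) 2 P ∧
    ∫ ω, (∫ s in (0 : ℝ)..t, u s ω l) * (u t ω i - u 0 ω i) ∂P = riccatiB γ t i l := by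
  obtain ⟨M, hM, hb⟩ := hu.bound
  have hm : Measurable (Function.uncurry fun s ω => u s ω l) :=
    (measurable_pi_apply l).comp hu.measurable
  have hm' : ∀ τ i, Measurable fun ω => u τ ω i := fun τ i => (measurable_pi_apply i).comp
    (hu.measurable.comp (by fun_prop : Measurable fun ω : Ω => (τ, ω)))
  have hφ : Integrable (fun _ : ℝ => M) (volume.restrict (Set.Ioc 0 t)) := integrable_const M
  have h0 := memLp_integral hm (fun s => hu.memLp s l) hφ (fun _ => hM) (fun s => hb s l)
  have h1 := (integral_mul_integral_right hm ((hm' t i).sub (hm' 0 i)) (fun s => hu.memLp s l)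
    ((hu.memLp t i).sub (hu.memLp 0 i)) hφ (fun _ => hM) (fun s => hb s l)).2
  simp only [Pi.sub_apply] at h1
  simp only [intervalIntegral.integral_of_le ht]
  refine ⟨h0.1, h1.trans ?_⟩
  -- The lag `v - t` is turned into the transposed lag `t - v` by reflection; reversing time in the
  -- first term then produces the integrand of `riccatiB`.
  have h2 : ∀ v, ∫ ω, u v ω l * (u t ω i - u 0 ω i) ∂P = γ (t - v) i l - γ v l i := by
    intro v
    have e1 := hu.integral_mul v t l i
    have e2 := hu.integral_mul v 0 l i
    rw [sub_zero] at e2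
    have e3 : γ (v - t) l i = γ (t - v) i l := by
      have := congrFun (congrFun (hu.transpose_neg (t - v)) i) l
      rwa [Matrix.transpose_apply, neg_sub] at this
    simp only [mul_sub]
    rw [integral_sub, e1, e2, e3]
    · exact (hu.memLp v l).integrable_mul (hu.memLp t i)
    · exact (hu.memLp v l).integrable_mul (hu.memLp 0 i)
  simp only [h2]
  rw [← intervalIntegral.integral_of_le ht, riccatiB, Matrix.of_apply]
  have i1 := hu.intervalIntegrable_autocov i l 0 t
  have i2 := hu.intervalIntegrable_autocov l i 0 t
  have i3 : IntervalIntegrable (fun s => γ (t - s) i l) volume 0 t := by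
    have := i1.comp_sub_left t
    simpa using this.symm
  rw [intervalIntegral.integral_sub i3 i2, intervalIntegral.integral_sub i1 i2,
    intervalIntegral.integral_comp_sub_left (fun s => γ s i l), sub_self, sub_zero]

theorem integral_mul_self [IsProbabilityMeasure P]
    (hu : IsStationarySolution P Y Θ γ u) {t : ℝ} (ht : 0 ≤ t)
    (k l : Fin d) :
    ∫ ω, (∫ s in (0 : ℝ)..t, u s ω k) * (∫ s in (0 : ℝ)..t, u s ω l) ∂P = riccatiC γ t k l := by
  obtain ⟨M, hM, hb⟩ := hu.bound
  obtain ⟨K, hK⟩ := hu.exists_abs_autocov_le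
  have hm : ∀ l, Measurable (Function.uncurry fun s ω => u s ω l) := fun l =>
    (measurable_pi_apply l).comp hu.measurable
  have hφ : Integrable (fun _ : ℝ => M) (volume.restrict (Set.Ioc 0 t)) := integrable_const M
  have h1 := (integral_mul_integral (hm k) (hm l) (fun s => hu.memLp s k) (fun s => hu.memLp s l)
    hφ hφ (fun _ => hM) (fun _ => hM) (fun s => hb s k) (fun s => hb s l)).2
  simp only [intervalIntegral.integral_of_le ht]
  rw [h1, riccatiC, Matrix.of_apply]
  simp only [hu.integral_mul, hu.lagExtend_eq, intervalIntegral.integral_of_le ht]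
  have hint : Integrable (fun p : ℝ × ℝ => γ (p.1 - p.2) k l)
      ((volume.restrict (Set.Ioc 0 t)).prod (volume.restrict (Set.Ioc 0 t))) :=
    (integrable_const K).mono' ((hu.measurable_autocov k l).comp
      (by fun_prop : Measurable fun p : ℝ × ℝ => p.1 - p.2)).aestronglyMeasurable
      (ae_of_all _ fun p => hK _ k l)
  rw [integral_prod_symm _ hint]

theorem covMat_increment [IsProbabilityMeasure P] (hu : IsStationarySolution P Y Θ γ u) (t : ℝ) :
    covMat P (fun ω => u t ω - u 0 ω) = (2 : ℝ) • γ 0 - γ t - (γ t)ᵀ ∧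
    ∀ i j, covMat P (fun ω => u t ω - u 0 ω) i j =
      ∫ ω, (u t ω i - u 0 ω i) * (u t ω j - u 0 ω j) ∂P := by
  have hI : ∀ τ i, Integrable (fun ω => u τ ω i) P := fun τ i =>
    (hu.memLp τ i).integrable one_le_two
  have h0 : ∀ i, ∫ ω, (u t ω i - u 0 ω i) ∂P = 0 := fun i => by
    rw [integral_sub (hI t i) (hI 0 i), hu.centered, hu.centered, sub_zero]
  have h1 : ∀ i j, covMat P (fun ω => u t ω - u 0 ω) i j =
      ∫ ω, (u t ω i - u 0 ω i) * (u t ω j - u 0 ω j) ∂P := by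
    intro i j
    simp [covMat, covariance, h0]
  refine ⟨?_, h1⟩
  ext i j
  rw [h1]
  have hp : ∀ a b i j, Integrable (fun ω => u a ω i * u b ω j) P := fun a b i j =>
    (hu.memLp a i).integrable_mul (hu.memLp b j)
  have e : ∀ ω, (u t ω i - u 0 ω i) * (u t ω j - u 0 ω j) =
      (u t ω i * u t ω j + u 0 ω i * u 0 ω j) - (u t ω i * u 0 ω j + u 0 ω i * u t ω j) :=
    fun ω => by ring
  simp only [e]
  have hp2 : ∀ a b i j a' b' i' j', Integrable (fun ω => u a ω i * u b ω j + u a' ω i' * u b' ω j')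
      P := fun a b i j a' b' i' j' => (hp a b i j).add (hp a' b' i' j')
  rw [integral_sub (hp2 _ _ _ _ _ _ _ _) (hp2 _ _ _ _ _ _ _ _),
    integral_add (hp _ _ _ _) (hp _ _ _ _), integral_add (hp _ _ _ _) (hp _ _ _ _)]
  simp only [hu.integral_mul, sub_self, sub_zero, zero_sub]
  have := congrFun (congrFun (hu.transpose_neg (-t)) i) j
  rw [neg_neg, Matrix.transpose_apply] at this
  simp only [Matrix.sub_apply, Matrix.smul_apply, Matrix.transpose_apply, smul_eq_mul]
  rw [← this]
  ring

/-- The second moments of the noise increment in terms of the integrated autocovariance. -/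
theorem integral_noise_mul [IsProbabilityMeasure P]
    (hu : IsStationarySolution P Y Θ γ u) {t : ℝ} (ht : 0 ≤ t) :
    (Matrix.of fun i j => ∫ ω, Y t ω i * Y t ω j ∂P) - covMat P (fun ω => u t ω - u 0 ω) =
      riccatiB γ t * Θᵀ + Θ * (riccatiB γ t)ᵀ + Θ * riccatiC γ t * Θᵀ := by
  set D : Ω → Fin d → ℝ := fun ω i => u t ω i - u 0 ω i with hD
  set J : Ω → Fin d → ℝ := fun ω i => ∫ s in (0 : ℝ)..t, u s ω i with hJ
  have hD2 : ∀ i, MemLp (fun ω => D ω i) 2 P := fun i => (hu.memLp t i).sub (hu.memLp 0 i)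
  have hJ2 : ∀ i, MemLp (fun ω => J ω i) 2 P := fun i => (hu.integral_mul_increment ht i i).1
  -- The integral equation solved for the noise: `Y_t = (u_t - u_0) + Θ ∫_0^t u`. Expanding its
  -- outer product gives all the terms of the Riccati equation.
  have hY : ∀ i, (fun ω => Y t ω i) =ᵐ[P] fun ω => D ω i + ∑ k, Θ i k * J ω k := by
    intro i
    filter_upwards [hu.equation] with ω hω
    have := (hω t ht i).2
    simp only [hD, hJ]
    linarith
  ext i j
  have hB : ∀ i l, ∫ ω, J ω l * D ω i ∂P = riccatiB γ t i l := fun i l =>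
    (hu.integral_mul_increment ht i l).2
  have hC : ∀ k l, ∫ ω, J ω k * J ω l ∂P = riccatiC γ t k l := fun k l =>
    hu.integral_mul_self ht k l
  have e : ∀ᵐ ω ∂P, Y t ω i * Y t ω j = D ω i * D ω j + ∑ l, Θ j l * (J ω l * D ω i)
      + ∑ k, Θ i k * (J ω k * D ω j) + ∑ k, ∑ l, Θ i k * Θ j l * (J ω k * J ω l) := by
    filter_upwards [hY i, hY j] with ω h1 h2
    rw [h1, h2]
    have : (∑ k, Θ i k * J ω k) * (∑ l, Θ j l * J ω l) =
        ∑ k, ∑ l, Θ i k * Θ j l * (J ω k * J ω l) := by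
      rw [Finset.sum_mul_sum]
      refine Finset.sum_congr rfl fun k _ => Finset.sum_congr rfl fun l _ => ?_
      ring
    rw [← this]
    simp only [← mul_assoc, ← Finset.sum_mul]
    ring
  have i1 : Integrable (fun ω => D ω i * D ω j) P := (hD2 i).integrable_mul (hD2 j)
  have i2 : ∀ a i k, Integrable (fun ω => a * (J ω k * D ω i)) P := fun a i k =>
    ((hJ2 k).integrable_mul (hD2 i)).const_mul a
  have i3 : ∀ a k l, Integrable (fun ω => a * (J ω k * J ω l)) P := fun a k l =>
    ((hJ2 k).integrable_mul (hJ2 l)).const_mul a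
  have s2 : ∀ i j, Integrable (fun ω => ∑ l, Θ j l * (J ω l * D ω i)) P := fun i j =>
    integrable_finsetSum _ fun l _ => i2 _ _ _
  have s3 : ∀ k, Integrable (fun ω => ∑ l, Θ i k * Θ j l * (J ω k * J ω l)) P := fun k =>
    integrable_finsetSum _ fun l _ => i3 _ _ _
  have s4 : Integrable (fun ω => D ω i * D ω j + ∑ l, Θ j l * (J ω l * D ω i)) P :=
    i1.add (s2 i j)
  have s5 : Integrable (fun ω => D ω i * D ω j + ∑ l, Θ j l * (J ω l * D ω i)
      + ∑ k, Θ i k * (J ω k * D ω j)) P := s4.add (s2 j i)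
  rw [Matrix.sub_apply, Matrix.of_apply, (hu.covMat_increment t).2, integral_congr_ae e,
    integral_add s5 (integrable_finsetSum _ fun k _ => s3 k),
    integral_add s4 (s2 j i), integral_add i1 (s2 i j),
    integral_finsetSum _ fun k _ => s3 k, integral_finsetSum _ fun l _ => i2 _ _ _,
    integral_finsetSum _ fun l _ => i2 _ _ _]
  simp_rw [integral_finsetSum _ fun l _ => i3 _ _ l, integral_const_mul, hB, hC]
  simp only [Matrix.add_apply, Matrix.mul_apply, Matrix.transpose_apply, Finset.sum_mul]
  rw [Finset.sum_comm (f := fun x k => Θ i k * riccatiC γ t k x * Θ j x)]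
  have hc : ∀ x, Θ j x * riccatiB γ t i x = riccatiB γ t i x * Θ j x := fun x => mul_comm _ _
  have hd : ∀ x y, Θ i x * Θ j y * riccatiC γ t x y = Θ i x * riccatiC γ t x y * Θ j y :=
    fun x y => by ring
  simp only [hc, hd, hD]
  ring

end IsStationarySolution

end TrueCoefficients

/-! ### The Riccati equation satisfied by the mean-reversion matrix. -/

section CARE

variable {Ω : Type*} [MeasurableSpace Ω] {d : ℕ} {P : Measure Ω}
  {X : ℝ → Ω → Fin d → ℝ} {Θ σ : Mat d} {u : ℝ → Ω → Fin d → ℝ}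

theorem trueD_eq (hU : ∀ᵐ ω ∂P, ∀ τ, stationarySol X Θ σ τ ω = u τ ω) (t : ℝ) :
    trueD P X Θ σ t = σ * covMat P (X t) * σᵀ - covMat P (fun ω => u t ω - u 0 ω) := by
  rw [trueD]
  congr 1
  ext i j
  have h : ∀ i, (fun ω => (stationarySol X Θ σ t ω - stationarySol X Θ σ 0 ω) i) =ᵐ[P]
      fun ω => (u t ω - u 0 ω) i := fun i => by
    filter_upwards [hU] with ω hω
    simp only [hω]
  simp only [covMat, Matrix.of_apply, covariance, integral_congr_ae (h _)]
  refine integral_congr_ae ?_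
  filter_upwards [h i, h j] with ω h1 h2
  rw [h1, h2]

/-- The mean-reversion matrix solves the Riccati equation with the true coefficients. -/
theorem isCARE_true [IsProbabilityMeasure P] (hX : IsNoise P X) (hΘ : Θ.IsHermitian)
    (hu : IsStationarySolution P (fun τ ω => σ *ᵥ X τ ω) Θ (autocov P X Θ σ) u)
    (hU : ∀ᵐ ω ∂P, ∀ τ, stationarySol X Θ σ τ ω = u τ ω) {t : ℝ} (ht : 0 ≤ t) :
    IsCARE (trueC P X Θ σ t) (trueB P X Θ σ t) (trueD P X Θ σ t) Θ := by
  have hT : Θᵀ = Θ := by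
    have := hΘ
    rwa [Matrix.IsHermitian, Matrix.conjTranspose_eq_transpose_of_trivial] at this
  have h := hu.integral_noise_mul ht
  have h1 : (Matrix.of fun i j => ∫ ω, (σ *ᵥ X t ω) i * (σ *ᵥ X t ω) j ∂P) =
      σ * covMat P (X t) * σᵀ := by
    ext i j
    rw [hX.sandwich_covMat_apply, Matrix.of_apply]
  -- With `Bᵀ = -B`, the moment identity `D = B Θ + Θ Bᵀ + Θ C Θ` is the Riccati equation.
  rw [h1, ← trueD_eq hU, hT, transpose_riccatiB] at h
  rw [IsCARE, h, trueB, trueC, transpose_riccatiB]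
  noncomm_ring

end CARE

/-! ### Comparison of the covariance estimators -/

section Pathwise

theorem intervalIntegrable_of_integrableOn_Ioi {h : ℝ → ℝ} (hh : IntegrableOn h (Set.Ioi 0))
    {a b : ℝ} (ha : 0 ≤ a) (hab : a ≤ b) : IntervalIntegrable h volume a b :=
  (intervalIntegrable_iff_integrableOn_Ioc_of_le hab).2
    (hh.mono_set fun _ hx => ha.trans_lt hx.1)

theorem intervalIntegral_le_integral_Ioi {h : ℝ → ℝ} (hh : IntegrableOn h (Set.Ioi 0))
    (h0 : ∀ x, 0 ≤ h x) {a b : ℝ} (ha : 0 ≤ a) (hab : a ≤ b) :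
    ∫ x in a..b, h x ≤ ∫ x in Set.Ioi 0, h x := by
  rw [intervalIntegral.integral_of_le hab]
  exact setIntegral_mono_set hh (ae_of_all _ h0)
    (LE.le.eventuallyLE fun _ hx => ha.trans_lt hx.1)

/-- Pathwise comparison of the empirical autocovariances of `r = b + u + z` and of `u` when `z`
decays exponentially. -/
theorem exists_covariance_bound {u r : ℝ → ℝ} {b : ℝ} {u' r' : ℝ → ℝ} {b' : ℝ} {c κ t : ℝ}
    (ht : 0 ≤ t) (hc : 0 < c) (hκ : 0 ≤ κ)
    (hum : Measurable u) (hrm : Measurable r) (hum' : Measurable u') (hrm' : Measurable r')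
    (hu2 : ∀ n : ℕ, IntegrableOn (fun v => u v ^ 2) (Set.Ioc 0 (n : ℝ)))
    (hu2' : ∀ n : ℕ, IntegrableOn (fun v => u' v ^ 2) (Set.Ioc 0 (n : ℝ)))
    (hJ : IntegrableOn (fun v => |u v| * Real.exp (-(c * v))) (Set.Ioi 0))
    (hJ' : IntegrableOn (fun v => |u' v| * Real.exp (-(c * v))) (Set.Ioi 0))
    (hz : ∀ v, 0 ≤ v → |r v - b - u v| ≤ κ * Real.exp (-(c * v)))
    (hz' : ∀ v, 0 ≤ v → |r' v - b' - u' v| ≤ κ * Real.exp (-(c * v))) :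
    ∃ K, ∀ T, 0 < T → ∀ s ∈ Set.Icc 0 t,
      |((1 / T) * (∫ v in (0 : ℝ)..T, r (s + v) * r' v) -
          (1 / T ^ 2) * ((∫ v in (0 : ℝ)..T, r v) * ∫ v in (0 : ℝ)..T, r' v)) -
        (1 / T) * (∫ v in (0 : ℝ)..T, u (s + v) * u' v) +
        ((1 / T) * (∫ v in (0 : ℝ)..T, r v) - b) * ((1 / T) * (∫ v in (0 : ℝ)..T, r' v) - b')| ≤
      (1 / T) * (K + |b'| * ∫ v in T..(T + t), |u v|) := by
  -- integrability
  have sqi : ∀ {u : ℝ → ℝ}, (∀ n : ℕ, IntegrableOn (fun v => u v ^ 2) (Set.Ioc 0 (n : ℝ))) →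
      ∀ {p q : ℝ}, 0 ≤ p → p ≤ q → IntervalIntegrable (fun v => u v ^ 2) volume p q := by
    intro u hu2 p q hp hpq
    obtain ⟨n, hn⟩ := exists_nat_ge q
    exact (intervalIntegrable_iff_integrableOn_Ioc_of_le hpq).2
      ((hu2 n).mono_set (Set.Ioc_subset_Ioc hp hn))
  have linu : ∀ {u : ℝ → ℝ}, Measurable u →
      (∀ n : ℕ, IntegrableOn (fun v => u v ^ 2) (Set.Ioc 0 (n : ℝ))) →
      ∀ {p q : ℝ}, 0 ≤ p → p ≤ q → IntervalIntegrable u volume p q := by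
    intro u hum hu2 p q hp hpq
    refine ((sqi hu2 hp hpq).add (intervalIntegrable_const (c := 1))).mono_fun'
      hum.aestronglyMeasurable (ae_of_all _ fun v => ?_)
    simp only [Real.norm_eq_abs, abs_le]
    constructor <;> nlinarith [sq_nonneg (u v - 1), sq_nonneg (u v + 1)]
  have zle : ∀ {r u : ℝ → ℝ} {b : ℝ}, (∀ v, 0 ≤ v → |r v - b - u v| ≤ κ * Real.exp (-(c * v))) →
      ∀ v, 0 ≤ v → |r v - b - u v| ≤ κ := by
    intro r u b hz v hv
    refine (hz v hv).trans (mul_le_of_le_one_right hκ ?_)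
    rw [Real.exp_le_one_iff]
    have := mul_nonneg hc.le hv
    linarith
  have linz : ∀ {r u : ℝ → ℝ} {b : ℝ}, Measurable r → Measurable u →
      (∀ v, 0 ≤ v → |r v - b - u v| ≤ κ * Real.exp (-(c * v))) → ∀ {p q : ℝ}, 0 ≤ p → p ≤ q →
      IntervalIntegrable (fun v => r v - b - u v) volume p q := by
    intro r u b hrm hum hz p q hp hpq
    refine (intervalIntegrable_const (c := κ)).mono_fun'
      ((hrm.sub_const b).sub hum).aestronglyMeasurable ?_
    filter_upwards [ae_restrict_mem measurableSet_uIoc] with v hv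
    rw [Set.uIoc_of_le hpq] at hv
    exact zle hz v (hp.trans hv.1.le)
  set z : ℝ → ℝ := fun v => r v - b - u v with hzdef
  set z' : ℝ → ℝ := fun v => r' v - b' - u' v with hzdef'
  have hzm : Measurable z := (hrm.sub_const b).sub hum
  have hzm' : Measurable z' := (hrm'.sub_const b').sub hum'
  have hr : ∀ v, r v = b + u v + z v := fun v => by simp only [hzdef]; ring
  have hr' : ∀ v, r' v = b' + u' v + z' v := fun v => by simp only [hzdef']; ring
  have linr : ∀ {p q : ℝ}, 0 ≤ p → p ≤ q → IntervalIntegrable r volume p q := by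
    intro p q hp hpq
    have := ((intervalIntegrable_const (c := b)).add (linu hum hu2 hp hpq)).add
      (linz hrm hum hz hp hpq)
    exact this.congr fun v _ => (hr v).symm
  have linr' : ∀ {p q : ℝ}, 0 ≤ p → p ≤ q → IntervalIntegrable r' volume p q := by
    intro p q hp hpq
    have := ((intervalIntegrable_const (c := b')).add (linu hum' hu2' hp hpq)).add
      (linz hrm' hum' hz' hp hpq)
    exact this.congr fun v _ => (hr' v).symm
  set J := ∫ v in Set.Ioi (0 : ℝ), |u v| * Real.exp (-(c * v)) with hJdef
  set J' := ∫ v in Set.Ioi (0 : ℝ), |u' v| * Real.exp (-(c * v)) with hJdef'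
  have hE : IntegrableOn (fun v => Real.exp (-(c * v))) (Set.Ioi 0) := by
    have := integrableOn_exp_mul_Ioi (neg_lt_zero.2 hc) 0
    simp only [neg_mul] at this
    exact this
  set E := ∫ v in Set.Ioi (0 : ℝ), Real.exp (-(c * v)) with hEdef
  set R := ∫ v in (0 : ℝ)..t, |r v| with hR
  -- The first three terms bound the products that contain a decaying factor; the last one bounds
  -- the boundary pieces created by the lag. The integral of `|u|` over `[T, T + t]` need not be
  -- bounded along a path and stays explicit.
  refine ⟨κ * Real.exp (c * t) * J + κ * J' + κ ^ 2 * E + |b'| * (R + t * (|b| + κ)), ?_⟩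
  intro T hT s hs
  have shift : ∀ {f : ℝ → ℝ}, IntervalIntegrable f volume s (s + T) →
      IntervalIntegrable (fun v => f (s + v)) volume 0 T := by
    intro f hf
    have := hf.comp_add_left s
    simpa using this
  have hsT : s ≤ s + T := by linarith
  have iu2 := shift (sqi hu2 hs.1 hsT)
  have ir := shift (linr hs.1 hsT)
  have iu2' := sqi hu2' le_rfl hT.le
  have ir' := linr' le_rfl hT.le
  have hms : Measurable fun v : ℝ => s + v := measurable_const_add s
  have iuu : IntervalIntegrable (fun v => u (s + v) * u' v) volume 0 T := by
    refine (iu2.add iu2').mono_fun' ((hum.comp hms).mul hum').aestronglyMeasurable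
      (ae_of_all _ fun v => ?_)
    simp only [Real.norm_eq_abs, abs_le]
    constructor <;> nlinarith [sq_nonneg (u (s + v) - u' v), sq_nonneg (u (s + v) + u' v)]
  -- The decay at time `v` is rewritten at time `s + v`, where `u` is evaluated; since `s ≤ t`, this
  -- costs a factor `e^{ct}`.
  have b1 : ∀ v ∈ Set.Ioc 0 T, ‖u (s + v) * z' v‖ ≤
      κ * Real.exp (c * t) * (|u (s + v)| * Real.exp (-(c * (s + v)))) := by
    intro v hv
    rw [Real.norm_eq_abs, abs_mul]
    calc |u (s + v)| * |z' v| ≤ |u (s + v)| * (κ * Real.exp (-(c * v))) := by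
          gcongr; exact hz' v hv.1.le
      _ ≤ |u (s + v)| * (κ * (Real.exp (c * t) * Real.exp (-(c * (s + v))))) := by
          rw [← Real.exp_add]
          gcongr
          have := mul_le_mul_of_nonneg_left hs.2 hc.le
          linarith
      _ = _ := by ring
  have b2 : ∀ v ∈ Set.Ioc 0 T, ‖z (s + v) * u' v‖ ≤ κ * (|u' v| * Real.exp (-(c * v))) := by
    intro v hv
    rw [Real.norm_eq_abs, abs_mul]
    calc |z (s + v)| * |u' v| ≤ (κ * Real.exp (-(c * (s + v)))) * |u' v| := by
          gcongr; exact hz _ (add_nonneg hs.1 hv.1.le)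
      _ ≤ (κ * Real.exp (-(c * v))) * |u' v| := by
          gcongr
          linarith [hs.1]
      _ = _ := by ring
  have b3 : ∀ v ∈ Set.Ioc 0 T, ‖z (s + v) * z' v‖ ≤ κ ^ 2 * Real.exp (-(c * v)) := by
    intro v hv
    rw [Real.norm_eq_abs, abs_mul]
    calc |z (s + v)| * |z' v| ≤ κ * (κ * Real.exp (-(c * v))) := by
          gcongr
          · exact zle hz _ (add_nonneg hs.1 hv.1.le)
          · exact hz' v hv.1.le
      _ = _ := by ring
  have g1 : IntervalIntegrable (fun v => κ * Real.exp (c * t) *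
      (|u (s + v)| * Real.exp (-(c * (s + v))))) volume 0 T :=
    (shift (intervalIntegrable_of_integrableOn_Ioi hJ hs.1 hsT)).const_mul _
  have g2 : IntervalIntegrable (fun v => κ * (|u' v| * Real.exp (-(c * v)))) volume 0 T :=
    (intervalIntegrable_of_integrableOn_Ioi hJ' le_rfl hT.le).const_mul _
  have g3 : IntervalIntegrable (fun v => κ ^ 2 * Real.exp (-(c * v))) volume 0 T :=
    (intervalIntegrable_of_integrableOn_Ioi hE le_rfl hT.le).const_mul _
  have dom : ∀ {f g : ℝ → ℝ}, Measurable f → IntervalIntegrable g volume 0 T →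
      (∀ v ∈ Set.Ioc 0 T, ‖f v‖ ≤ g v) → IntervalIntegrable f volume 0 T ∧
      |∫ v in (0 : ℝ)..T, f v| ≤ ∫ v in (0 : ℝ)..T, g v := by
    intro f g hf hg h
    refine ⟨hg.mono_fun' hf.aestronglyMeasurable ?_,
      intervalIntegral.norm_integral_le_of_norm_le hT.le (ae_of_all _ h) hg⟩
    filter_upwards [ae_restrict_mem measurableSet_uIoc] with v hv
    rw [Set.uIoc_of_le hT.le] at hv
    exact h v hv
  obtain ⟨i1, l1⟩ := dom (f := fun v => u (s + v) * z' v) ((hum.comp hms).mul hzm') g1 b1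
  obtain ⟨i2, l2⟩ := dom (f := fun v => z (s + v) * u' v) ((hzm.comp hms).mul hum') g2 b2
  obtain ⟨i3, l3⟩ := dom (f := fun v => z (s + v) * z' v) ((hzm.comp hms).mul hzm') g3 b3
  have l1' : ∫ v in (0 : ℝ)..T, κ * Real.exp (c * t) *
      (|u (s + v)| * Real.exp (-(c * (s + v)))) ≤ κ * Real.exp (c * t) * J := by
    rw [intervalIntegral.integral_const_mul,
      intervalIntegral.integral_comp_add_left (fun v => |u v| * Real.exp (-(c * v)))]
    gcongr
    exact intervalIntegral_le_integral_Ioi hJ (fun v => by positivity) (by simpa using hs.1)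
      (by linarith)
  have l2' : ∫ v in (0 : ℝ)..T, κ * (|u' v| * Real.exp (-(c * v))) ≤ κ * J' := by
    rw [intervalIntegral.integral_const_mul]
    gcongr
    exact intervalIntegral_le_integral_Ioi hJ' (fun v => by positivity) le_rfl hT.le
  have l3' : ∫ v in (0 : ℝ)..T, κ ^ 2 * Real.exp (-(c * v)) ≤ κ ^ 2 * E := by
    rw [intervalIntegral.integral_const_mul]
    gcongr
    exact intervalIntegral_le_integral_Ioi hE (fun v => by positivity) le_rfl hT.le
  -- the algebraic identity
  have hprod : ∫ v in (0 : ℝ)..T, r (s + v) * r' v =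
      (∫ v in (0 : ℝ)..T, u (s + v) * u' v) + (∫ v in (0 : ℝ)..T, u (s + v) * z' v) +
      (∫ v in (0 : ℝ)..T, z (s + v) * u' v) + (∫ v in (0 : ℝ)..T, z (s + v) * z' v) +
      b * (∫ v in (0 : ℝ)..T, r' v) + b' * (∫ v in (0 : ℝ)..T, r (s + v)) - b * b' * T := by
    have e : ∀ v, r (s + v) * r' v = u (s + v) * u' v + u (s + v) * z' v + z (s + v) * u' v +
        z (s + v) * z' v + b * r' v + b' * r (s + v) - b * b' := fun v => by
      rw [hr (s + v), hr' v]; ring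
    have j1 : IntervalIntegrable (fun v => u (s + v) * u' v + u (s + v) * z' v) volume 0 T :=
      iuu.add i1
    have j2 : IntervalIntegrable (fun v => u (s + v) * u' v + u (s + v) * z' v +
        z (s + v) * u' v) volume 0 T := j1.add i2
    have j3 : IntervalIntegrable (fun v => u (s + v) * u' v + u (s + v) * z' v +
        z (s + v) * u' v + z (s + v) * z' v) volume 0 T := j2.add i3
    have j4 : IntervalIntegrable (fun v => u (s + v) * u' v + u (s + v) * z' v +
        z (s + v) * u' v + z (s + v) * z' v + b * r' v) volume 0 T := j3.add (ir'.const_mul b)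
    have j5 : IntervalIntegrable (fun v => u (s + v) * u' v + u (s + v) * z' v +
        z (s + v) * u' v + z (s + v) * z' v + b * r' v + b' * r (s + v)) volume 0 T :=
      j4.add (ir.const_mul b')
    simp only [e]
    rw [intervalIntegral.integral_sub j5 intervalIntegrable_const,
      intervalIntegral.integral_add j4 (ir.const_mul b'),
      intervalIntegral.integral_add j3 (ir'.const_mul b), intervalIntegral.integral_add j2 i3,
      intervalIntegral.integral_add j1 i2, intervalIntegral.integral_add iuu i1]
    simp only [intervalIntegral.integral_const_mul, intervalIntegral.integral_const, smul_eq_mul]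
    ring
  have hsh : ∫ v in (0 : ℝ)..T, r (s + v) =
      (∫ v in (0 : ℝ)..T, r v) + (∫ v in T..(T + s), r v) - ∫ v in (0 : ℝ)..s, r v := by
    rw [intervalIntegral.integral_comp_add_left (fun v => r v), add_zero, add_comm s T]
    have h1 := intervalIntegral.integral_add_adjacent_intervals (linr le_rfl hs.1)
      (linr (p := s) (q := T + s) hs.1 (by linarith))
    have h2 := intervalIntegral.integral_add_adjacent_intervals (linr le_rfl hT.le)
      (linr (p := T) (q := T + s) hT.le (by linarith [hs.1]))
    linarith
  have hb1 : |∫ v in (0 : ℝ)..s, r v| ≤ R := by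
    refine (intervalIntegral.abs_integral_le_integral_abs hs.1).trans ?_
    exact intervalIntegral.integral_mono_interval le_rfl hs.1 hs.2
      (ae_of_all _ fun v => abs_nonneg _) (linr le_rfl ht).abs
  have hb2 : |∫ v in T..(T + s), r v| ≤ t * (|b| + κ) + ∫ v in T..(T + t), |u v| := by
    have hTs : T ≤ T + s := by linarith [hs.1]
    have hTt : T ≤ T + t := by linarith
    refine (intervalIntegral.abs_integral_le_integral_abs hTs).trans ?_
    refine (intervalIntegral.integral_mono_interval le_rfl hTs (by linarith [hs.2])
      (ae_of_all _ fun v => abs_nonneg _) (linr hT.le hTt).abs).trans ?_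
    have hle : ∫ v in T..(T + t), |r v| ≤ ∫ v in T..(T + t), ((|b| + κ) + |u v|) := by
      refine intervalIntegral.integral_mono_on hTt (linr hT.le hTt).abs
        (intervalIntegrable_const.add (linu hum hu2 hT.le hTt).abs) fun v hv => ?_
      rw [hr v]
      have h1 := zle hz v (hT.le.trans hv.1)
      have h2 := abs_add_le (b + u v) (z v)
      have h3 := abs_add_le b (u v)
      linarith
    refine hle.trans (le_of_eq ?_)
    rw [intervalIntegral.integral_add intervalIntegrable_const (linu hum hu2 hT.le hTt).abs,
      intervalIntegral.integral_const, add_sub_cancel_left, smul_eq_mul]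
  rw [hprod, hsh]
  set I1 := ∫ v in (0 : ℝ)..T, u (s + v) * u' v
  set I2 := ∫ v in (0 : ℝ)..T, u (s + v) * z' v
  set I3 := ∫ v in (0 : ℝ)..T, z (s + v) * u' v
  set I4 := ∫ v in (0 : ℝ)..T, z (s + v) * z' v
  set m := ∫ v in (0 : ℝ)..T, r v
  set m' := ∫ v in (0 : ℝ)..T, r' v
  set w1 := ∫ v in T..(T + s), r v
  set w2 := ∫ v in (0 : ℝ)..s, r v
  -- The product of the two errors of the mean absorbs every term in `b` and `b'` except the
  -- boundary effect `w1 - w2`.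
  have hid : (1 / T) * (I1 + I2 + I3 + I4 + b * m' + b' * (m + w1 - w2) - b * b' * T) -
      (1 / T ^ 2) * (m * m') - (1 / T) * I1 + ((1 / T) * m - b) * ((1 / T) * m' - b') =
      (1 / T) * (I2 + I3 + I4 + b' * (w1 - w2)) := by
    field_simp
    ring
  rw [hid, abs_mul, abs_of_pos (by positivity : 0 < 1 / T)]
  gcongr
  have h1 : |b' * (w1 - w2)| ≤ |b'| * ((t * (|b| + κ) + ∫ v in T..(T + t), |u v|) + R) := by
    rw [abs_mul]
    gcongr
    exact (abs_sub _ _).trans (add_le_add hb2 hb1)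
  have h2 := abs_add_le (I2 + I3 + I4) (b' * (w1 - w2))
  have h3 := abs_add_le (I2 + I3) I4
  have h4 := abs_add_le I2 I3
  have h5 : |b'| * ((t * (|b| + κ) + ∫ v in T..(T + t), |u v|) + R) =
    |b'| * (R + t * (|b| + κ)) + |b'| * ∫ v in T..(T + t), |u v| := by ring
  linarith

end Pathwise

/-! ### The Riccati equation -/

section Riccati

variable {d : ℕ}

theorem isHermitian_iff_transpose {A : Mat d} : A.IsHermitian ↔ Aᵀ = A := by
  rw [Matrix.IsHermitian, Matrix.conjTranspose_eq_transpose_of_trivial]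

theorem posSemidef_transpose_mul_mul {A : Mat d} (hA : A.PosSemidef) (B : Mat d) :
    (Bᵀ * A * B).PosSemidef := by
  have := hA.conjTranspose_mul_mul_same B
  rwa [Matrix.conjTranspose_eq_transpose_of_trivial] at this

theorem trace_mul_diagonalized (A Q : Mat d) (c : Fin d → ℝ) :
    (A * (Q * Matrix.diagonal c * Qᵀ)).trace = ∑ k, (Qᵀ * A * Q) k k * c k := by
  rw [← Matrix.mul_assoc, Matrix.trace_mul_comm, ← Matrix.mul_assoc, ← Matrix.mul_assoc]
  simp [Matrix.trace, Matrix.mul_diagonal]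

theorem trace_mul_nonneg {A B : Mat d} (hA : A.PosSemidef) (hB : B.PosSemidef) :
    0 ≤ (A * B).trace := by
  obtain ⟨Q, c, hc, h1, h2, hQ⟩ := exists_orthogonal_diagonalization hB.1
  rw [hQ, trace_mul_diagonalized]
  refine Finset.sum_nonneg fun k _ => mul_nonneg ?_ ?_
  · exact (posSemidef_transpose_mul_mul hA Q).diag_nonneg
  · rw [hc]
    exact hB.eigenvalues_nonneg k

/-- In an eigenbasis of `B` the trace is the sum of the nonnegative diagonal entries of `A` weighted
by the eigenvalues of `B`; a positive lower bound for these eigenvalues is the constant. -/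
theorem exists_trace_mul_lower_bound {B : Mat d} (hB : B.PosDef) :
    ∃ c₀, 0 < c₀ ∧ ∀ A : Mat d, A.PosSemidef → c₀ * A.trace ≤ (A * B).trace := by
  obtain ⟨Q, c, hc, h1, h2, hQ⟩ := exists_orthogonal_diagonalization hB.1
  obtain ⟨c₀, hc₀, hle⟩ := exists_uniform_lower_bound (c := c) fun k => by
    rw [hc]; exact hB.eigenvalues_pos k
  refine ⟨c₀, hc₀, fun A hA => ?_⟩
  have ht : A.trace = ∑ k, (Qᵀ * A * Q) k k := by
    have : (Qᵀ * A * Q).trace = A.trace := by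
      rw [Matrix.trace_mul_comm, ← Matrix.mul_assoc, h1, Matrix.one_mul]
    rw [← this]
    rfl
  rw [hQ, trace_mul_diagonalized, ht, Finset.mul_sum]
  refine Finset.sum_le_sum fun k _ => ?_
  rw [mul_comm]
  exact mul_le_mul_of_nonneg_left (hle k) (posSemidef_transpose_mul_mul hA Q).diag_nonneg

theorem eq_zero_of_trace_mul_eq_zero {A B : Mat d} (hA : A.PosSemidef) (hB : B.PosDef)
    (h : (A * B).trace ≤ 0) : A = 0 := by
  obtain ⟨c₀, hc₀, hle⟩ := exists_trace_mul_lower_bound hB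
  have h1 := hle A hA
  have h2 := hA.trace_nonneg
  have h3 : A.trace = 0 := by nlinarith
  exact hA.trace_eq_zero_iff.1 h3

/-- By cyclicity the trace of `(H Hᵀ) S` vanishes, and a definite `S` detects the semidefinite
factor `H Hᵀ`. -/
theorem eq_zero_of_transpose_mul_mul_eq_zero {S H : Mat d} (hS : S.PosDef)
    (h : Hᵀ * S * H = 0) : H = 0 := by
  have h1 : (H * Hᵀ).PosSemidef := by
    have := Matrix.posSemidef_self_mul_conjTranspose H
    rwa [Matrix.conjTranspose_eq_transpose_of_trivial] at this
  have h2 : H * Hᵀ = 0 := by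
    refine eq_zero_of_trace_mul_eq_zero h1 hS ?_
    rw [Matrix.mul_assoc, Matrix.trace_mul_comm, h]
    simp
  have h3 : (H * Hᴴ).trace = 0 := by
    rw [Matrix.conjTranspose_eq_transpose_of_trivial, h2, Matrix.trace_zero]
  exact Matrix.trace_mul_conjTranspose_self_eq_zero_iff.1 h3

theorem posDef_transpose_mul_mul {A B : Mat d} (hA : A.PosDef) (hB : IsUnit B) :
    (Bᵀ * A * B).PosDef := by
  have := hA.conjTranspose_mul_mul_same (B := B)
    (Matrix.mulVec_injective_iff_isUnit.2 hB)
  rwa [Matrix.conjTranspose_eq_transpose_of_trivial] at this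

/-- Conjugation by `Θ⁻¹` gives the dual Lyapunov equation, the form that fits the trace argument in
`sylvester_injective`. -/
theorem inverse_lyapunov {Θ A Q : Mat d} (hΘ : Θ.PosDef)
    (h : Aᵀ * Θ + Θ * A = -Q) : Θ⁻¹ * Aᵀ + A * Θ⁻¹ = -(Θ⁻¹ * Q * Θ⁻¹) := by
  have hdet := (Matrix.isUnit_iff_isUnit_det _).1 hΘ.isUnit
  have h1 : Θ⁻¹ * Θ = 1 := Matrix.nonsing_inv_mul _ hdet
  have h2 : Θ * Θ⁻¹ = 1 := Matrix.mul_nonsing_inv _ hdet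
  calc Θ⁻¹ * Aᵀ + A * Θ⁻¹ = Θ⁻¹ * Aᵀ * (Θ * Θ⁻¹) + (Θ⁻¹ * Θ) * A * Θ⁻¹ := by
        rw [h1, h2, Matrix.mul_one, Matrix.one_mul]
    _ = Θ⁻¹ * (Aᵀ * Θ + Θ * A) * Θ⁻¹ := by noncomm_ring
    _ = _ := by rw [h]; noncomm_ring

/-- A Sylvester operator is injective when both coefficients have positive definite Lyapunov
certificates. -/
theorem sylvester_injective {Θ₁ Θ₂ A₁ A₂ Q₁ Q₂ H : Mat d} (hΘ₁ : Θ₁.PosDef) (hΘ₂ : Θ₂.PosDef)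
    (hQ₁ : Q₁.PosSemidef) (hQ₂ : Q₂.PosDef) (h₁ : A₁ᵀ * Θ₁ + Θ₁ * A₁ = -Q₁)
    (h₂ : A₂ᵀ * Θ₂ + Θ₂ * A₂ = -Q₂) (hH : A₁ᵀ * H + H * A₂ = 0) : H = 0 := by
  have i1 := inverse_lyapunov hΘ₁ h₁
  have i2 := inverse_lyapunov hΘ₂ h₂
  have hP1 := hΘ₁.inv
  have hP2 := hΘ₂.inv
  set P₁ := Θ₁⁻¹
  set P₂ := Θ₂⁻¹
  have hT1 : P₁ᵀ = P₁ := isHermitian_iff_transpose.1 hP1.1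
  have hT2 : P₂ᵀ = P₂ := isHermitian_iff_transpose.1 hP2.1
  have hS1 : (P₁ * Q₁ * P₁).PosSemidef := by
    have := posSemidef_transpose_mul_mul hQ₁ P₁
    rwa [hT1] at this
  have hS2 : (P₂ * Q₂ * P₂).PosDef := by
    have := posDef_transpose_mul_mul hQ₂ hP2.isUnit
    rwa [hT2] at this
  -- The equation is paired with `P₁ H P₂` in the trace inner product. Adding transposes and using
  -- the dual Lyapunov equations, twice the pairing is minus a sum of two nonnegative traces. Both
  -- vanish, and the one with the definite `Q₂` gives `Hᵀ P₁ H = 0`.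
  have e0 : (P₂ * Hᵀ * P₁ * A₁ᵀ * H).trace + (Hᵀ * P₁ * H * A₂ * P₂).trace = 0 := by
    have : (P₂ * Hᵀ * P₁ * (A₁ᵀ * H + H * A₂)).trace = 0 := by rw [hH]; simp
    rw [Matrix.mul_add, Matrix.trace_add] at this
    rw [← this]
    congr 1
    · simp only [Matrix.mul_assoc]
    · rw [Matrix.trace_mul_comm]
      simp only [Matrix.mul_assoc]
  have e1 : (P₂ * Hᵀ * P₁ * A₁ᵀ * H).trace = (P₂ * Hᵀ * A₁ * P₁ * H).trace := by
    rw [← Matrix.trace_transpose]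
    simp only [Matrix.transpose_mul, Matrix.transpose_transpose, hT1, hT2]
    rw [← Matrix.mul_assoc, ← Matrix.mul_assoc, ← Matrix.mul_assoc, Matrix.trace_mul_comm]
    simp only [Matrix.mul_assoc]
  have e2 : (Hᵀ * P₁ * H * A₂ * P₂).trace = (Hᵀ * P₁ * H * P₂ * A₂ᵀ).trace := by
    rw [← Matrix.trace_transpose]
    simp only [Matrix.transpose_mul, Matrix.transpose_transpose, hT1, hT2]
    rw [← Matrix.mul_assoc, Matrix.trace_mul_comm]
    simp only [Matrix.mul_assoc]
  have e3 : (P₂ * Hᵀ * P₁ * A₁ᵀ * H).trace + (P₂ * Hᵀ * A₁ * P₁ * H).trace =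
      -((Hᵀ * (P₁ * Q₁ * P₁) * H) * P₂).trace := by
    have : P₂ * Hᵀ * P₁ * A₁ᵀ * H + P₂ * Hᵀ * A₁ * P₁ * H =
        P₂ * Hᵀ * (P₁ * A₁ᵀ + A₁ * P₁) * H := by noncomm_ring
    rw [← Matrix.trace_add, this, i1, Matrix.trace_mul_comm _ P₂, ← Matrix.trace_neg]
    congr 1
    noncomm_ring
  have e4 : (Hᵀ * P₁ * H * A₂ * P₂).trace + (Hᵀ * P₁ * H * P₂ * A₂ᵀ).trace =
      -((Hᵀ * P₁ * H) * (P₂ * Q₂ * P₂)).trace := by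
    have : Hᵀ * P₁ * H * A₂ * P₂ + Hᵀ * P₁ * H * P₂ * A₂ᵀ =
        (Hᵀ * P₁ * H) * (P₂ * A₂ᵀ + A₂ * P₂) := by noncomm_ring
    rw [← Matrix.trace_add, this, i2, ← Matrix.trace_neg]
    congr 1
    noncomm_ring
  have n1 := trace_mul_nonneg (posSemidef_transpose_mul_mul hS1 H) hP2.posSemidef
  have z : Hᵀ * P₁ * H = 0 := by
    refine eq_zero_of_trace_mul_eq_zero (posSemidef_transpose_mul_mul hP1.posSemidef H) hS2 ?_
    linarith
  exact eq_zero_of_transpose_mul_mul_eq_zero hP1 z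

/-- Rewritten around the closed-loop matrix `B - C Θ`, the Riccati equation makes the solution its
own Lyapunov certificate. -/
theorem IsCARE.lyapunov {C B D Θ : Mat d} (h : IsCARE C B D Θ) (hC : Cᵀ = C) (hΘ : Θᵀ = Θ) :
    (B - C * Θ)ᵀ * Θ + Θ * (B - C * Θ) = -(D + Θ * C * Θ) := by
  rw [IsCARE] at h
  rw [Matrix.transpose_sub, Matrix.transpose_mul, hC, hΘ]
  have : Bᵀ * Θ + Θ * B = Θ * C * Θ - D := by
    rw [← sub_eq_zero, ← h]
    noncomm_ring
  calc (Bᵀ - Θ * C) * Θ + Θ * (B - C * Θ) = (Bᵀ * Θ + Θ * B) - 2 • (Θ * C * Θ) := by noncomm_ring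
    _ = _ := by rw [this]; noncomm_ring

theorem posDef_add_sandwich {C D Θ : Mat d} (hC : C.PosDef) (hD : D.PosSemidef)
    (hΘ : Θ.PosDef) : (D + Θ * C * Θ).PosDef := by
  have h := posDef_transpose_mul_mul hC hΘ.isUnit
  rw [isHermitian_iff_transpose.1 hΘ.1] at h
  exact h.posSemidef_add hD

/-- The difference of two solutions satisfies a Sylvester equation whose coefficients are the two
closed-loop matrices, each certified by its own solution. -/
theorem IsCARE.eq_of_posDef {C B D Θ Θ₀ : Mat d} (h : IsCARE C B D Θ) (h₀ : IsCARE C B D Θ₀)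
    (hC : C.PosDef) (hD : D.PosSemidef) (hΘ : Θ.PosDef) (hΘ₀ : Θ₀.PosDef) : Θ₀ = Θ := by
  have hCT := isHermitian_iff_transpose.1 hC.1
  have hT := isHermitian_iff_transpose.1 hΘ.1
  have hT₀ := isHermitian_iff_transpose.1 hΘ₀.1
  rw [← sub_eq_zero]
  refine sylvester_injective hΘ₀ hΘ (posDef_add_sandwich hC hD hΘ₀).posSemidef
    (posDef_add_sandwich hC hD hΘ) (h₀.lyapunov hCT hT₀) (h.lyapunov hCT hT) ?_
  rw [Matrix.transpose_sub, Matrix.transpose_mul, hCT, hT₀]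
  rw [IsCARE] at h h₀
  calc _ = (Bᵀ * Θ₀ + Θ₀ * B - Θ₀ * C * Θ₀ + D) - (Bᵀ * Θ + Θ * B - Θ * C * Θ + D) := by
        noncomm_ring
    _ = 0 := by rw [h, h₀, sub_zero]

/-- The orthogonal projection on the kernel of a symmetric matrix. -/
theorem exists_kernel_projection {A : Mat d} (hA : A.IsHermitian) :
    ∃ R G : Mat d, Rᵀ = R ∧ R * R = R ∧ A * R = 0 ∧ R + G * A = 1 := by
  obtain ⟨Q, c, -, h1, h2, hQ⟩ := exists_orthogonal_diagonalization hA
  have key : ∀ a b : Fin d → ℝ, (Q * Matrix.diagonal a * Qᵀ) * (Q * Matrix.diagonal b * Qᵀ) =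
      Q * Matrix.diagonal (fun k => a k * b k) * Qᵀ := by
    intro a b
    calc _ = Q * Matrix.diagonal a * (Qᵀ * Q) * Matrix.diagonal b * Qᵀ := by
          simp only [Matrix.mul_assoc]
      _ = _ := by
          rw [h2, Matrix.mul_one, Matrix.mul_assoc Q, Matrix.diagonal_mul_diagonal]
  set p : Fin d → ℝ := fun k => if c k = 0 then 1 else 0 with hp
  -- `R` is the spectral projection at eigenvalue zero and `G` the pseudo-inverse, obtained from the
  -- convention `0⁻¹ = 0`.
  refine ⟨Q * Matrix.diagonal p * Qᵀ, Q * Matrix.diagonal (fun k => (c k)⁻¹) * Qᵀ, ?_, ?_, ?_, ?_⟩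
  · simp [Matrix.transpose_mul, Matrix.mul_assoc]
  · rw [key]
    congr 3
    ext k
    simp only [hp]
    split_ifs <;> simp
  · rw [hQ, key]
    have : (fun k => c k * p k) = 0 := by
      ext k
      simp only [hp]
      split_ifs with h <;> simp [h]
    rw [this]
    simp
  · rw [hQ, key, ← Matrix.add_mul, ← Matrix.mul_add, Matrix.diagonal_add]
    have : (fun k => p k + (c k)⁻¹ * c k) = fun _ => 1 := by
      ext k
      simp only [hp]
      split_ifs with h <;> simp [h]
    rw [this, Matrix.diagonal_one, Matrix.mul_one, h1]

/-- If the linear coefficient is skew-symmetric and there is a positive definite solution, then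
every positive semidefinite solution is positive definite. -/
theorem IsCARE.posDef_of_posSemidef {C B D Θ Θ₀ : Mat d} (h : IsCARE C B D Θ)
    (h₀ : IsCARE C B D Θ₀) (hB : Bᵀ = -B) (hC : C.PosDef) (hD : D.PosSemidef) (hΘ : Θ.PosDef)
    (hΘ₀ : Θ₀.PosSemidef) : Θ₀.PosDef := by
  obtain ⟨R, G, hRT, hRR, hR, hG⟩ := exists_kernel_projection hΘ₀.1
  have hT := isHermitian_iff_transpose.1 hΘ.1
  have hT₀ := isHermitian_iff_transpose.1 hΘ₀.1
  have hDT := isHermitian_iff_transpose.1 hD.1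
  have hR' : R * Θ₀ = 0 := by
    have := congrArg Matrix.transpose hR
    rwa [Matrix.transpose_mul, hRT, hT₀, Matrix.transpose_zero] at this
  rw [IsCARE] at h h₀
  -- Compressed to the kernel of `Θ₀`, its equation retains only `D`; semidefiniteness then upgrades
  -- this to `D R = 0`.
  have hRDR : Rᵀ * D * R = 0 := by
    have := congrArg (fun M => R * M * R) h₀
    simp only [Matrix.mul_zero, Matrix.zero_mul] at this
    rw [hRT, ← this]
    have e : R * (Bᵀ * Θ₀ + Θ₀ * B - Θ₀ * C * Θ₀ + D) * R =
      R * Bᵀ * (Θ₀ * R) + (R * Θ₀) * B * R - (R * Θ₀) * C * (Θ₀ * R) + R * D * R := by noncomm_ring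
    rw [e, hR, hR']
    noncomm_ring
  have hDR : D * R = 0 := by
    obtain ⟨Q, c, hc, h1, h2, hQ⟩ := exists_orthogonal_diagonalization hD.1
    set S : Mat d := Matrix.diagonal (fun k => Real.sqrt (c k)) * Qᵀ with hS
    have hSS : Sᵀ * S = D := by
      rw [hS, Matrix.transpose_mul, Matrix.transpose_transpose, Matrix.diagonal_transpose, hQ,
        Matrix.mul_assoc, ← Matrix.mul_assoc (Matrix.diagonal _), Matrix.diagonal_mul_diagonal,
        Matrix.mul_assoc]
      congr 3
      ext k
      exact Real.mul_self_sqrt (by rw [hc]; exact hD.eigenvalues_nonneg k)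
    have hSR : S * R = 0 := by
      have : (S * R)ᴴ * (S * R) = 0 := by
        rw [Matrix.conjTranspose_eq_transpose_of_trivial, Matrix.transpose_mul, ← hRDR, ← hSS]
        simp only [Matrix.mul_assoc]
      exact Matrix.conjTranspose_mul_self_eq_zero.1 this
    rw [← hSS, Matrix.mul_assoc, hSR, Matrix.mul_zero]
  have hBR : Θ₀ * B * R = 0 := by
    have := congrArg (fun M => M * R) h₀
    simp only [Matrix.zero_mul] at this
    rw [← this]
    have e : (Bᵀ * Θ₀ + Θ₀ * B - Θ₀ * C * Θ₀ + D) * R =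
      Bᵀ * (Θ₀ * R) + Θ₀ * B * R - Θ₀ * C * (Θ₀ * R) + D * R := by noncomm_ring
    rw [e, hR, hDR]
    noncomm_ring
  -- `Θ₀ B R = 0` says that `B` preserves the kernel of `Θ₀`. A skew-symmetric matrix then preserves
  -- the orthogonal complement too, so it commutes with `R`.
  have hc1 : B * R = R * B * R := by
    calc B * R = (R + G * Θ₀) * (B * R) := by rw [hG, Matrix.one_mul]
      _ = R * B * R + G * (Θ₀ * B * R) := by noncomm_ring
      _ = _ := by rw [hBR, Matrix.mul_zero, add_zero]
  have hc2 : R * B = R * B * R := by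
    have := congrArg Matrix.transpose hc1
    simp only [Matrix.transpose_mul, hRT, hB, Matrix.neg_mul, Matrix.mul_neg, neg_inj,
      ← Matrix.mul_assoc] at this
    exact this
  have hcomm : B * R = R * B := hc1.trans hc2.symm
  have htr : (R * (Bᵀ * Θ + Θ * B) * R).trace = 0 := by
    have e : R * (Bᵀ * Θ + Θ * B) * R = R * (Θ * B * R) - R * B * (Θ * R) := by
      rw [hB]; noncomm_ring
    have e1 : (R * (Θ * B * R)).trace = (Θ * R * B).trace := by
      rw [Matrix.trace_mul_comm, Matrix.mul_assoc, hRR, Matrix.mul_assoc, hcomm, Matrix.mul_assoc]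
    have e2 : (R * B * (Θ * R)).trace = (Θ * R * B).trace := by
      rw [Matrix.trace_mul_comm, Matrix.mul_assoc Θ, ← Matrix.mul_assoc R, hRR, Matrix.mul_assoc]
    rw [e, Matrix.trace_sub, e1, e2, sub_self]
  -- Now the equation of the definite solution is compressed to the same kernel: its linear part has
  -- trace zero and `D` vanishes there, so only the quadratic term is left.
  have hCT : ((Θ * R)ᵀ * C * (Θ * R)).trace = 0 := by
    have e : (Θ * R)ᵀ * C * (Θ * R) = R * (Bᵀ * Θ + Θ * B) * R + R * (D * R)
        - R * (Bᵀ * Θ + Θ * B - Θ * C * Θ + D) * R := by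
      rw [Matrix.transpose_mul, hT, hRT]; noncomm_ring
    rw [e, h, hDR]
    simp [htr]
  have hΘR : Θ * R = 0 := by
    refine eq_zero_of_transpose_mul_mul_eq_zero hC ?_
    exact (posSemidef_transpose_mul_mul hC.posSemidef (Θ * R)).trace_eq_zero_iff.1 hCT
  have hR0 : R = 0 := by
    have hdet := (Matrix.isUnit_iff_isUnit_det _).1 hΘ.isUnit
    calc R = Θ⁻¹ * (Θ * R) := by
          rw [← Matrix.mul_assoc, Matrix.nonsing_inv_mul _ hdet, Matrix.one_mul]
      _ = 0 := by rw [hΘR, Matrix.mul_zero]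
  rw [hR0, zero_add] at hG
  have hunit : IsUnit Θ₀ := by
    rw [Matrix.isUnit_iff_isUnit_det]
    exact Matrix.isUnit_det_of_left_inverse hG
  exact hΘ₀.posDef_iff_isUnit.2 hunit

/-- Limits of positive definite solutions are a priori only semidefinite, so the compactness
argument needs uniqueness in this larger class. -/
theorem IsCARE.eq_of_posSemidef {C B D Θ Θ₀ : Mat d} (h : IsCARE C B D Θ)
    (h₀ : IsCARE C B D Θ₀) (hB : Bᵀ = -B) (hC : C.PosDef) (hD : D.PosSemidef) (hΘ : Θ.PosDef)
    (hΘ₀ : Θ₀.PosSemidef) : Θ₀ = Θ :=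
  h.eq_of_posDef h₀ hC hD hΘ (h.posDef_of_posSemidef h₀ hB hC hD hΘ hΘ₀)

/-- The linearization of the Riccati equation in the unknown. -/
def lyapunovMap (A : Mat d) : Mat d →ₗ[ℝ] Mat d where
  toFun H := Aᵀ * H + H * A
  map_add' H K := by noncomm_ring
  map_smul' a H := by simp

theorem IsCARE.lyapunovMap_injective {C B D Θ : Mat d} (h : IsCARE C B D Θ) (hC : C.PosDef)
    (hD : D.PosSemidef) (hΘ : Θ.PosDef) :
    Function.Injective (lyapunovMap (B - C * Θ)) := by
  have hl := h.lyapunov (isHermitian_iff_transpose.1 hC.1) (isHermitian_iff_transpose.1 hΘ.1)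
  rw [injective_iff_map_eq_zero]
  intro H hH
  exact sylvester_injective hΘ hΘ (posDef_add_sandwich hC hD hΘ).posSemidef
    (posDef_add_sandwich hC hD hΘ) hl hl hH

/-- The linearization of the Riccati equation in the coefficients. -/
def coefficientMap (Θ : Mat d) : (Mat d × Mat d × Mat d) →ₗ[ℝ] Mat d where
  toFun δ := δ.2.1ᵀ * Θ + Θ * δ.2.1 - Θ * δ.1 * Θ + δ.2.2
  map_add' δ ε := by
    simp only [Prod.fst_add, Prod.snd_add, Matrix.transpose_add]
    noncomm_ring
  map_smul' a δ := by
    simp [smul_add, smul_sub]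

/-- The derivative of the solution of the Riccati equation with respect to its coefficients. -/
noncomputable def riccatiDerivative (C B Θ : Mat d)
    (hinj : Function.Injective (lyapunovMap (B - C * Θ))) :
    (Mat d × Mat d × Mat d) →ₗ[ℝ] Mat d :=
  -((LinearEquiv.ofInjectiveEndo _ hinj).symm.toLinearMap ∘ₗ coefficientMap Θ)

/-- An injective endomorphism in finite dimension is bijective, so the linearized equation has
exactly one solution, linear in the perturbation. -/
theorem riccatiDerivative_eq_iff {C B Θ : Mat d}
    (hinj : Function.Injective (lyapunovMap (B - C * Θ))) (δ : Mat d × Mat d × Mat d)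
    (H : Mat d) : riccatiDerivative C B Θ hinj δ = H ↔
      lyapunovMap (B - C * Θ) H + coefficientMap Θ δ = 0 := by
  have e : ∀ K, lyapunovMap (B - C * Θ) ((LinearEquiv.ofInjectiveEndo _ hinj).symm K) = K :=
    fun K => (LinearEquiv.ofInjectiveEndo _ hinj).apply_symm_apply K
  have hv : lyapunovMap (B - C * Θ) (riccatiDerivative C B Θ hinj δ) = -coefficientMap Θ δ := by
    simp only [riccatiDerivative, LinearMap.neg_apply, LinearMap.comp_apply, map_neg,
      LinearEquiv.coe_coe, e]
  constructor
  · rintro rfl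
    rw [hv, neg_add_cancel]
  · intro h
    apply hinj
    rw [hv, eq_comm, eq_neg_iff_add_eq_zero, h]

end Riccati

/-! ### Perturbation of the Riccati equation -/

theorem exists_norm_le_of_linear {E F : Type*} [NormedAddCommGroup E] [NormedSpace ℝ E]
    [FiniteDimensional ℝ E] [NormedAddCommGroup F] [NormedSpace ℝ F] (L : E →ₗ[ℝ] F) :
    ∃ M, 0 < M ∧ ∀ x, ‖L x‖ ≤ M * ‖x‖ := by
  refine ⟨‖LinearMap.toContinuousLinearMap L‖ + 1, by positivity, fun x => ?_⟩
  refine ((LinearMap.toContinuousLinearMap L).le_opNorm x).trans ?_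
  gcongr
  linarith

section Perturbation

attribute [local instance] Matrix.normedAddCommGroup Matrix.normedSpace

variable {d : ℕ}

theorem norm_mul_le_card (A B : Mat d) : ‖A * B‖ ≤ d * ‖A‖ * ‖B‖ := by
  rw [Matrix.norm_le_iff (by positivity)]
  intro i j
  rw [Matrix.mul_apply]
  refine (norm_sum_le _ _).trans ?_
  calc ∑ k, ‖A i k * B k j‖ ≤ ∑ _k : Fin d, ‖A‖ * ‖B‖ := by
        refine Finset.sum_le_sum fun k _ => ?_
        rw [norm_mul]
        gcongr
        · exact Matrix.norm_entry_le_entrywise_sup_norm A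
        · exact Matrix.norm_entry_le_entrywise_sup_norm B
    _ = _ := by simp [mul_assoc]

theorem abs_trace_le (A : Mat d) : |A.trace| ≤ d * ‖A‖ := by
  rw [Matrix.trace]
  refine (Finset.abs_sum_le_sum_abs _ _).trans ?_
  calc ∑ i, |A.diag i| ≤ ∑ _i : Fin d, ‖A‖ :=
        Finset.sum_le_sum fun i _ => Matrix.norm_entry_le_entrywise_sup_norm A
    _ = _ := by simp

/-- The norm is the largest absolute entry, and the trace is the squared Frobenius norm. -/
theorem norm_sq_le_trace (A : Mat d) : ‖A‖ ^ 2 ≤ (A * Aᵀ).trace := by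
  have h0 : 0 ≤ (A * Aᵀ).trace := by
    simp only [Matrix.trace, Matrix.diag_apply, Matrix.mul_apply, Matrix.transpose_apply]
    exact Finset.sum_nonneg fun i _ => Finset.sum_nonneg fun j _ => mul_self_nonneg _
  have : ‖A‖ ≤ Real.sqrt (A * Aᵀ).trace := by
    rw [Matrix.norm_le_iff (Real.sqrt_nonneg _)]
    intro i j
    rw [Real.norm_eq_abs]
    refine Real.abs_le_sqrt ?_
    simp only [Matrix.trace, Matrix.diag_apply, Matrix.mul_apply, Matrix.transpose_apply, sq]
    refine (Finset.single_le_sum (f := fun j => A i j * A i j)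
      (fun j _ => mul_self_nonneg _) (Finset.mem_univ j)).trans ?_
    exact Finset.single_le_sum (f := fun i => ∑ j, A i j * A i j)
      (fun i _ => Finset.sum_nonneg fun j _ => mul_self_nonneg _) (Finset.mem_univ i)
  calc ‖A‖ ^ 2 ≤ Real.sqrt (A * Aᵀ).trace ^ 2 := by gcongr
    _ = _ := Real.sq_sqrt h0

theorem isClosed_posSemidef : IsClosed {A : Mat d | A.PosSemidef} := by
  have h : {A : Mat d | A.PosSemidef} =
      {A | Aᵀ = A} ∩ ⋂ x : Fin d → ℝ, {A | 0 ≤ x ⬝ᵥ (A *ᵥ x)} := by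
    ext A
    simp only [Set.mem_ofPred_eq, Set.mem_inter_iff, Set.mem_iInter,
      Matrix.posSemidef_iff_dotProduct_mulVec, isHermitian_iff_transpose, star_trivial]
  rw [h]
  refine IsClosed.inter ?_ (isClosed_iInter fun x => ?_)
  · exact isClosed_eq continuous_id.matrix_transpose continuous_id
  · refine isClosed_le continuous_const ?_
    exact continuous_const.dotProduct (continuous_id.matrix_mulVec continuous_const)

/-- Solutions of Riccati equations with nearby coefficients are bounded. -/
theorem eventually_norm_le_of_isCARE {C : Mat d} (hC : C.PosDef) (B D : Mat d) :
    ∃ R, ∀ᶠ c' : Mat d × Mat d × Mat d in 𝓝 (C, B, D), ∀ Θ' : Mat d, Θ'.PosDef →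
      c'.2.1ᵀ = -c'.2.1 → IsCARE c'.1 c'.2.1 c'.2.2 Θ' → ‖Θ'‖ ≤ R := by
  obtain ⟨c₀, hc₀, hle⟩ := exists_trace_mul_lower_bound hC
  -- The estimates below give `c₀ ‖Θ'‖² ≤ (c₀/2) ‖Θ'‖² + trace D'` with `trace D' < trace D + 1`;
  -- this is the resulting radius.
  refine ⟨Real.sqrt (2 * (D.trace + 1) / c₀), ?_⟩
  have e1 : ∀ᶠ c' : Mat d × Mat d × Mat d in 𝓝 (C, B, D), c'.2.2.trace < D.trace + 1 := by
    have : Continuous fun c' : Mat d × Mat d × Mat d => c'.2.2.trace :=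
      (continuous_snd.comp continuous_snd).matrix_trace
    exact this.tendsto (C, B, D) |>.eventually (gt_mem_nhds (by simp))
  have e2 : ∀ᶠ c' : Mat d × Mat d × Mat d in 𝓝 (C, B, D), d ^ 3 * ‖C - c'.1‖ < c₀ / 2 := by
    have : Continuous fun c' : Mat d × Mat d × Mat d => (d : ℝ) ^ 3 * ‖C - c'.1‖ := by fun_prop
    exact this.tendsto (C, B, D) |>.eventually (gt_mem_nhds (by simpa using hc₀))
  filter_upwards [e1, e2] with c' h1 h2 Θ' hΘ' hB' hcare
  have hT := isHermitian_iff_transpose.1 hΘ'.1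
  refine Real.le_sqrt_of_sq_le ?_
  rw [le_div_iff₀ hc₀]
  have hPSD : (Θ' * Θ').PosSemidef := by
    have := Matrix.posSemidef_self_mul_conjTranspose Θ'
    rwa [Matrix.conjTranspose_eq_transpose_of_trivial, hT] at this
  have i1 := hle _ hPSD
  have i2 := norm_sq_le_trace Θ'
  rw [hT] at i2
  have i3 : (Θ' * Θ' * C).trace = (Θ' * Θ' * (C - c'.1)).trace + (Θ' * c'.1 * Θ').trace := by
    rw [Matrix.trace_mul_comm (Θ' * c'.1), ← Matrix.mul_assoc, ← Matrix.trace_add]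
    congr 1
    noncomm_ring
  -- The linear terms cancel under the trace because the perturbed `B` is skew-symmetric too.
  have i4 : (Θ' * c'.1 * Θ').trace = c'.2.2.trace := by
    have h := congrArg Matrix.trace hcare
    rw [hB', Matrix.trace_add, Matrix.trace_sub, Matrix.trace_add, Matrix.trace_zero,
      Matrix.neg_mul, Matrix.trace_neg, Matrix.trace_mul_comm c'.2.1] at h
    linarith
  have i5 : |(Θ' * Θ' * (C - c'.1)).trace| ≤ d ^ 3 * ‖C - c'.1‖ * ‖Θ'‖ ^ 2 := by
    refine (abs_trace_le _).trans ?_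
    calc (d : ℝ) * ‖Θ' * Θ' * (C - c'.1)‖ ≤ d * (d * ‖Θ' * Θ'‖ * ‖C - c'.1‖) := by
          gcongr; exact norm_mul_le_card _ _
      _ ≤ d * (d * (d * ‖Θ'‖ * ‖Θ'‖) * ‖C - c'.1‖) := by
          gcongr; exact norm_mul_le_card _ _
      _ = _ := by ring
  have i6 := (abs_le.1 i5).2
  have i7 : d ^ 3 * ‖C - c'.1‖ * ‖Θ'‖ ^ 2 ≤ c₀ / 2 * ‖Θ'‖ ^ 2 := by gcongr
  have i8 : c₀ * ‖Θ'‖ ^ 2 ≤ c₀ * (Θ' * Θ').trace := by gcongr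
  linarith

theorem continuous_care : Continuous fun p : (Mat d × Mat d × Mat d) × Mat d =>
    p.1.2.1ᵀ * p.2 + p.2 * p.1.2.1 - p.2 * p.1.1 * p.2 + p.1.2.2 := by
  have hB : Continuous fun p : (Mat d × Mat d × Mat d) × Mat d => p.1.2.1 := by fun_prop
  have hC : Continuous fun p : (Mat d × Mat d × Mat d) × Mat d => p.1.1 := by fun_prop
  have hD : Continuous fun p : (Mat d × Mat d × Mat d) × Mat d => p.1.2.2 := by fun_prop
  have hT : Continuous fun p : (Mat d × Mat d × Mat d) × Mat d => p.2 := by fun_prop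
  exact (((hB.matrix_transpose.matrix_mul hT).add (hT.matrix_mul hB)).sub
    ((hT.matrix_mul hC).matrix_mul hT)).add hD

/-- Positive definite solutions depend continuously on the coefficients. -/
theorem IsCARE.eventually_mem {C B D Θ : Mat d} (h : IsCARE C B D Θ) (hB : Bᵀ = -B)
    (hC : C.PosDef) (hD : D.PosSemidef) (hΘ : Θ.PosDef) {W : Set (Mat d)} (hW : W ∈ 𝓝 Θ) :
    ∀ᶠ c' : Mat d × Mat d × Mat d in 𝓝 (C, B, D), ∀ Θ' : Mat d, Θ'.PosDef →
      c'.2.1ᵀ = -c'.2.1 → IsCARE c'.1 c'.2.1 c'.2.2 Θ' → Θ' ∈ W := by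
  obtain ⟨R, hR⟩ := eventually_norm_le_of_isCARE hC B D
  -- No matrix in `K` solves the limiting equation, by uniqueness among semidefinite solutions.
  -- Compactness of `K` keeps the residual nonzero for all nearby coefficients at once.
  set K : Set (Mat d) := Metric.closedBall 0 R ∩ ({A : Mat d | A.PosSemidef} ∩ (interior W)ᶜ)
  have hK : IsCompact K := by
    have : ProperSpace (Mat d) := FiniteDimensional.proper ℝ (Mat d)
    exact (isCompact_closedBall _ _).inter_right
      (isClosed_posSemidef.inter isOpen_interior.isClosed_compl)
  have hne : ∀ Θ' ∈ K, ∀ᶠ p : (Mat d × Mat d × Mat d) × Mat d in 𝓝 ((C, B, D), Θ'),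
      p.1.2.1ᵀ * p.2 + p.2 * p.1.2.1 - p.2 * p.1.1 * p.2 + p.1.2.2 ≠ 0 := by
    intro Θ' hΘ'
    refine continuous_care.continuousAt.eventually_ne ?_
    intro h0
    have heq := h.eq_of_posSemidef (Θ₀ := Θ') h0 hB hC hD hΘ hΘ'.2.1
    exact hΘ'.2.2 (heq ▸ mem_interior_iff_mem_nhds.2 hW)
  have hcomp := hK.eventually_forall_of_forall_eventually (x₀ := (C, B, D))
    (P := fun c' Θ' => c'.2.1ᵀ * Θ' + Θ' * c'.2.1 - Θ' * c'.1 * Θ' + c'.2.2 ≠ 0) hne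
  filter_upwards [hR, hcomp] with c' h1 h2 Θ' hΘ' hB' hcare
  by_contra hcon
  refine h2 Θ' ⟨by simpa using h1 Θ' hΘ' hB' hcare, hΘ'.posSemidef, fun hi => ?_⟩ hcare
  exact hcon (interior_subset hi)

/-- First order expansion of positive definite solutions in the coefficients. -/
theorem IsCARE.eventually_norm_sub_le {C B D Θ : Mat d} (h : IsCARE C B D Θ) (hB : Bᵀ = -B)
    (hC : C.PosDef) (hD : D.PosSemidef) (hΘ : Θ.PosDef)
    (hinj : Function.Injective (lyapunovMap (B - C * Θ))) {η : ℝ} (hη : 0 < η) :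
    ∀ᶠ c' : Mat d × Mat d × Mat d in 𝓝 (C, B, D), ∀ Θ' : Mat d, Θ'.PosDef →
      c'.2.1ᵀ = -c'.2.1 → c'.1ᵀ = c'.1 → IsCARE c'.1 c'.2.1 c'.2.2 Θ' →
      ‖Θ' - Θ - riccatiDerivative C B Θ hinj (c' - (C, B, D))‖ ≤ η * ‖c' - (C, B, D)‖ := by
  set L := riccatiDerivative C B Θ hinj with hL
  obtain ⟨K, hK0, hK⟩ : ∃ K, 0 < K ∧ ∀ H, ‖H‖ ≤ K * ‖lyapunovMap (B - C * Θ) H‖ := by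
    obtain ⟨K, hK0, hK⟩ := exists_norm_le_of_linear
      (LinearEquiv.ofInjectiveEndo _ hinj).symm.toLinearMap
    refine ⟨K, hK0, fun H => ?_⟩
    have h1 := hK (lyapunovMap (B - C * Θ) H)
    have h2 : (LinearEquiv.ofInjectiveEndo _ hinj).symm (lyapunovMap (B - C * Θ) H) = H :=
      (LinearEquiv.ofInjectiveEndo _ hinj).symm_apply_apply H
    rwa [LinearEquiv.coe_coe, h2] at h1
  obtain ⟨M, hM0, hM⟩ : ∃ M, 0 < M ∧ ∀ δ, ‖L δ‖ ≤ M * ‖δ‖ := exists_norm_le_of_linear L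
  -- the admissible size of the perturbation of the coefficients of the Sylvester operator
  obtain ⟨ε, hε0, hε1, hε2⟩ : ∃ ε, 0 < ε ∧ K * ε ≤ 1 / 2 ∧ 2 * (K * ε) * M ≤ η := by
    refine ⟨min (1 / 2 / K) (η / (2 * K * M)), by positivity, ?_, ?_⟩
    · calc K * _ ≤ K * (1 / 2 / K) := by gcongr; exact min_le_left _ _
        _ = _ := by field_simp
    · calc 2 * (K * _) * M ≤ 2 * (K * (η / (2 * K * M))) * M := by gcongr; exact min_le_right _ _
        _ = _ := by field_simp
  have hc1 : Continuous fun p : (Mat d × Mat d × Mat d) × Mat d =>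
      d * (‖(B - C * Θ - (p.1.2.1 - p.1.1 * p.2))ᵀ‖ + ‖B - C * Θ - (p.1.2.1 - p.1.1 * Θ)‖) := by
    have h1 : Continuous fun p : (Mat d × Mat d × Mat d) × Mat d => p.1.2.1 := by fun_prop
    have h2 : Continuous fun p : (Mat d × Mat d × Mat d) × Mat d => p.1.1 := by fun_prop
    have h3 : Continuous fun p : (Mat d × Mat d × Mat d) × Mat d => p.2 := by fun_prop
    refine continuous_const.mul (Continuous.add (Continuous.norm ?_) (Continuous.norm ?_))
    · exact (continuous_const.sub (h1.sub (h2.matrix_mul h3))).matrix_transpose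
    · exact continuous_const.sub (h1.sub (h2.matrix_mul continuous_const))
  have hev : ∀ᶠ p : (Mat d × Mat d × Mat d) × Mat d in 𝓝 ((C, B, D), Θ),
      d * (‖(B - C * Θ - (p.1.2.1 - p.1.1 * p.2))ᵀ‖ + ‖B - C * Θ - (p.1.2.1 - p.1.1 * Θ)‖) < ε :=
    hc1.tendsto ((C, B, D), Θ) |>.eventually (gt_mem_nhds (by simpa using hε0))
  rw [nhds_prod_eq, eventually_prod_iff] at hev
  obtain ⟨pa, hpa, pb, hpb, hab⟩ := hev
  filter_upwards [hpa, h.eventually_mem hB hC hD hΘ hpb] with c' h1 h2 Θ' hΘ' hB' hC' hcare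
  have hsmall := hab h1 (h2 Θ' hΘ' hB' hcare)
  simp only at hsmall
  set Δ := Θ' - Θ with hΔ
  set δ := c' - (C, B, D) with hδ
  set E₁ := B - C * Θ - (c'.2.1 - c'.1 * Θ') with hE₁
  set E₂ := B - C * Θ - (c'.2.1 - c'.1 * Θ) with hE₂
  have hT := isHermitian_iff_transpose.1 hΘ'.1
  -- The difference of the two Riccati equations is exactly a Sylvester equation in `Δ`, with `Θ'`
  -- in the left coefficient and `Θ` in the right one. The error is therefore `Δ` times small
  -- coefficient perturbations, with no separate quadratic remainder.
  have key : lyapunovMap (B - C * Θ) (Δ - L δ) = E₁ᵀ * Δ + Δ * E₂ := by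
    have hLδ := (riccatiDerivative_eq_iff hinj δ (L δ)).1 rfl
    have hLδ' : lyapunovMap (B - C * Θ) (L δ) = -coefficientMap Θ δ := by
      rw [eq_neg_iff_add_eq_zero, hLδ]
    rw [map_sub, hLδ', sub_neg_eq_add]
    have e1 : coefficientMap Θ δ = c'.2.1ᵀ * Θ + Θ * c'.2.1 - Θ * c'.1 * Θ + c'.2.2 := by
      have : coefficientMap Θ δ = (c'.2.1ᵀ * Θ + Θ * c'.2.1 - Θ * c'.1 * Θ + c'.2.2) -
          (Bᵀ * Θ + Θ * B - Θ * C * Θ + D) := by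
        change (c'.2.1 - B)ᵀ * Θ + Θ * (c'.2.1 - B) - Θ * (c'.1 - C) * Θ + (c'.2.2 - D) = _
        rw [Matrix.transpose_sub]
        noncomm_ring
      rw [this, h, sub_zero]
    have e2 : c'.2.1ᵀ * Θ' + Θ' * c'.2.1 - Θ' * c'.1 * Θ' + c'.2.2 = 0 := hcare
    have e3 : (c'.2.1 - c'.1 * Θ')ᵀ * Δ + Δ * (c'.2.1 - c'.1 * Θ) = -coefficientMap Θ δ := by
      rw [e1, Matrix.transpose_sub, Matrix.transpose_mul, hC', hT, ← zero_sub, ← e2, hΔ]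
      noncomm_ring
    change (B - C * Θ)ᵀ * Δ + Δ * (B - C * Θ) + coefficientMap Θ δ = _
    rw [← neg_neg (coefficientMap Θ δ), ← e3, hE₁, hE₂, Matrix.transpose_sub (B - C * Θ)]
    noncomm_ring
  have hb : ‖E₁ᵀ * Δ + Δ * E₂‖ ≤ ε * ‖Δ‖ := by
    calc ‖E₁ᵀ * Δ + Δ * E₂‖ ≤ d * ‖E₁ᵀ‖ * ‖Δ‖ + d * ‖Δ‖ * ‖E₂‖ :=
          (norm_add_le _ _).trans (add_le_add (norm_mul_le_card _ _) (norm_mul_le_card _ _))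
      _ = d * (‖E₁ᵀ‖ + ‖E₂‖) * ‖Δ‖ := by ring
      _ ≤ _ := by gcongr
  have h3 : ‖Δ - L δ‖ ≤ K * ε * ‖Δ‖ := by
    refine (hK _).trans ?_
    rw [key, mul_assoc]
    gcongr
  have h4 : ‖Δ‖ ≤ ‖Δ - L δ‖ + ‖L δ‖ := by
    have := norm_add_le (Δ - L δ) (L δ)
    rwa [sub_add_cancel] at this
  have h5 := hM δ
  have h6 : K * ε * ‖Δ‖ ≤ 1 / 2 * ‖Δ‖ := by gcongr
  have h7 : ‖Δ‖ ≤ 2 * (M * ‖δ‖) := by linarith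
  calc ‖Δ - L δ‖ ≤ K * ε * (2 * (M * ‖δ‖)) := h3.trans (by gcongr)
    _ = 2 * (K * ε) * M * ‖δ‖ := by ring
    _ ≤ η * ‖δ‖ := by gcongr

end Perturbation

/-! ### Convergence in distribution and in probability -/

section Convergence

variable {Ω Ω' ι : Type*} [MeasurableSpace Ω] [MeasurableSpace Ω']
  {P : Measure Ω} [IsProbabilityMeasure P] {P' : Measure Ω'} [IsProbabilityMeasure P']
  {l : Filter ι}

/-- A family of real functions that is bounded in probability along a filter. -/
def IsBoundedInProbability (P : Measure Ω) (W : ι → Ω → ℝ) (l : Filter ι) : Prop :=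
  ∀ ε : ENNReal, 0 < ε → ∃ M : ℝ, ∀ᶠ i in l, P {ω | M ≤ W i ω} ≤ ε

/-- By the portmanteau theorem, the mass of a closed half-line is asymptotically at most its mass
under the limit law, which is small far out. -/
theorem isBoundedInProbability_of_tendstoInDistribution {W : ι → Ω → ℝ} {Z : Ω' → ℝ}
    (h : TendstoInDistribution W l Z (fun _ => P) P') : IsBoundedInProbability P W l := by
  intro ε hε
  have hν := h.aemeasurable_limit
  have : IsProbabilityMeasure (P'.map Z) := Measure.isProbabilityMeasure_map hν
  have h0 : Tendsto (fun n : ℕ => (P'.map Z) (Set.Ici (n : ℝ))) atTop (𝓝 0) := by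
    have he : ⋂ n : ℕ, Set.Ici (n : ℝ) = ∅ := by
      ext x
      simpa using exists_nat_gt x
    rw [← measure_empty (μ := P'.map Z), ← he]
    refine tendsto_measure_iInter_atTop (fun n => measurableSet_Ici.nullMeasurableSet) ?_
      ⟨0, measure_ne_top _ _⟩
    intro m n hmn
    exact Set.Ici_subset_Ici.2 (by exact_mod_cast hmn)
  obtain ⟨n, hn⟩ := (h0.eventually (gt_mem_nhds hε)).exists
  refine ⟨n, ?_⟩
  have hlim := ProbabilityMeasure.limsup_measure_closed_le_of_tendsto h.tendsto
    (isClosed_Ici (a := (n : ℝ)))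
  filter_upwards [eventually_lt_of_limsup_lt (hlim.trans_lt hn)] with i hi
  have hi' : (P.map (W i)) (Set.Ici (n : ℝ)) < ε := hi
  rw [Measure.map_apply_of_aemeasurable (h.forall_aemeasurable i) measurableSet_Ici] at hi'
  exact hi'.le

theorem isBoundedInProbability_comp {E : Type*} [TopologicalSpace E] [MeasurableSpace E]
    [OpensMeasurableSpace E] {W : ι → Ω → E} {Z : Ω' → E}
    (h : TendstoInDistribution W l Z (fun _ => P) P') {f : E → ℝ} (hf : Continuous f) :
    IsBoundedInProbability P (fun i ω => f (W i ω)) l :=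
  isBoundedInProbability_of_tendstoInDistribution (h.continuous_comp hf)

theorem tendstoInMeasure_iff_le {W : ι → Ω → ℝ} :
    TendstoInMeasure P W l 0 ↔
      ∀ δ > 0, Tendsto (fun i => P {ω | δ ≤ |W i ω|}) l (𝓝 0) := by
  rw [tendstoInMeasure_iff_norm]
  simp

/-- A bounded family multiplied by a null sequence tends to zero in probability. -/
theorem IsBoundedInProbability.tendstoInMeasure_mul {W : ι → Ω → ℝ}
    (hW : IsBoundedInProbability P W l) (h0 : ∀ i ω, 0 ≤ W i ω) {a : ι → ℝ}
    (ha : Tendsto a l (𝓝 0)) : TendstoInMeasure P (fun i ω => a i * W i ω) l 0 := by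
  rw [tendstoInMeasure_iff_le]
  intro δ hδ
  rw [ENNReal.tendsto_nhds_zero]
  intro ε hε
  obtain ⟨M, hM⟩ := hW ε hε
  have hlim : Tendsto (fun i => |a i| * (|M| + 1)) l (𝓝 0) := by
    simpa using ha.abs.mul_const (|M| + 1)
  filter_upwards [hM, hlim.eventually (gt_mem_nhds hδ)] with i h1 h2
  refine (measure_mono fun ω hω => ?_).trans h1
  by_contra hcon
  have hlt : W i ω < M := not_le.1 hcon
  have : |a i * W i ω| ≤ |a i| * (|M| + 1) := by
    rw [abs_mul, abs_of_nonneg (h0 i ω)]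
    gcongr
    linarith [le_abs_self M]
  exact absurd (hω.trans this) (not_le.2 h2)

/-- Families that are bounded in mean tend to zero in probability after multiplication by a null
sequence. -/
theorem tendstoInMeasure_mul_of_integral_le {W : ι → Ω → ℝ} {M : ℝ}
    (hi : ∀ i, Integrable (W i) P) (h0 : ∀ i ω, 0 ≤ W i ω) (hM : ∀ i, ∫ ω, W i ω ∂P ≤ M)
    {a : ι → ℝ} (ha : Tendsto a l (𝓝 0)) :
    TendstoInMeasure P (fun i ω => a i * W i ω) l 0 := by
  rw [tendstoInMeasure_iff_le]
  intro δ hδ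
  have hb : ∀ i, P {ω | δ ≤ |a i * W i ω|} ≤ ENNReal.ofReal (|a i| * M / δ) := by
    intro i
    have h1 := mul_meas_ge_le_integral_of_nonneg (μ := P) (f := fun ω => |a i * W i ω|)
      (Eventually.of_forall fun ω => abs_nonneg _) ((hi i).const_mul (a i)).abs δ
    have h2 : ∫ ω, |a i * W i ω| ∂P ≤ |a i| * M := by
      simp_rw [abs_mul, abs_of_nonneg (h0 i _)]
      rw [integral_const_mul]
      gcongr
      exact hM i
    rw [← ENNReal.ofReal_toReal (measure_ne_top P _)]
    refine ENNReal.ofReal_le_ofReal ?_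
    rw [le_div_iff₀ hδ, mul_comm]
    exact h1.trans h2
  refine tendsto_of_tendsto_of_tendsto_of_le_of_le tendsto_const_nhds ?_ (fun _ => zero_le) hb
  have : Tendsto (fun i => |a i| * M / δ) l (𝓝 0) := by
    simpa using (ha.abs.mul_const M).div_const δ
  simpa using ENNReal.tendsto_ofReal this

theorem tendstoInMeasure_add {W W' : ι → Ω → ℝ} (h : TendstoInMeasure P W l 0)
    (h' : TendstoInMeasure P W' l 0) :
    TendstoInMeasure P (fun i ω => W i ω + W' i ω) l 0 := by
  rw [tendstoInMeasure_iff_le] at h h' ⊢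
  intro δ hδ
  have hs := (h (δ / 2) (by positivity)).add (h' (δ / 2) (by positivity))
  rw [add_zero] at hs
  refine tendsto_of_tendsto_of_tendsto_of_le_of_le tendsto_const_nhds hs (fun _ => zero_le)
    fun i => ?_
  refine (measure_mono fun ω hω => ?_).trans (measure_union_le _ _)
  by_contra hcon
  simp only [Set.mem_union, Set.mem_ofPred_eq, not_or, not_le] at hcon hω
  have := abs_add_le (W i ω) (W' i ω)
  linarith [hcon.1, hcon.2]

/-- Domination up to an almost surely finite (not necessarily measurable) multiple of a null
sequence. -/
theorem tendstoInMeasure_of_le {D W : ι → Ω → ℝ} {a : ι → ℝ} {K : Ω → ℝ}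
    (hD : ∀ i, AEMeasurable (D i) P) (hW : ∀ i, AEMeasurable (W i) P)
    (hW0 : TendstoInMeasure P W l 0) (ha : Tendsto a l (𝓝 0))
    (h : ∀ᶠ i in l, ∀ᵐ ω ∂P, |D i ω| ≤ W i ω + a i * K ω) :
    TendstoInMeasure P D l 0 := by
  rw [tendstoInMeasure_iff_le] at hW0 ⊢
  intro δ hδ
  set A : ℕ → Set Ω := fun n => {ω | |K ω| ≤ n} with hA
  -- Continuity from below holds for increasing sets that need not be measurable, so nothing is
  -- required of `K`.
  have hA1 : Tendsto (fun n => P (A n)) atTop (𝓝 1) := by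
    have hu : ⋃ n, A n = Set.univ := by
      ext ω
      simpa [hA] using exists_nat_ge |K ω|
    rw [← measure_univ (μ := P), ← hu]
    refine tendsto_measure_iUnion_atTop ?_
    intro m n hmn ω hω
    exact le_trans (show |K ω| ≤ m from hω) (by exact_mod_cast hmn)
  have hA0 : Tendsto (fun n => 1 - P (A n)) atTop (𝓝 0) := by
    have := ENNReal.Tendsto.sub (tendsto_const_nhds (x := (1 : ENNReal))) hA1 (by simp)
    simpa using this
  rw [ENNReal.tendsto_nhds_zero]
  intro ε hε
  obtain ⟨n, hn⟩ := (hA0.eventually (gt_mem_nhds (ENNReal.half_pos hε.ne'))).exists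
  have hlim : Tendsto (fun i => |a i| * n) l (𝓝 0) := by simpa using ha.abs.mul_const (n : ℝ)
  have e1 := ENNReal.tendsto_nhds_zero.1 (hW0 (δ / 2) (by positivity)) _
    (ENNReal.half_pos hε.ne')
  filter_upwards [h, e1, hlim.eventually (gt_mem_nhds (half_pos hδ))] with i h1 h2 h3
  set B : Set Ω := {ω | δ / 2 ≤ |D i ω| - W i ω} with hB
  have hBm : NullMeasurableSet B P :=
    nullMeasurableSet_le aemeasurable_const ((hD i).abs.sub (hW i))
  have hAB : A n ≤ᵐ[P] (Bᶜ : Set Ω) := by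
    filter_upwards [h1] with ω hω hωA hωB
    have h4 : a i * K ω ≤ |a i| * n := by
      refine (le_abs_self _).trans ?_
      rw [abs_mul]
      gcongr
      exact hωA
    have h5 : δ / 2 ≤ |D i ω| - W i ω := hωB
    linarith
  -- `B` is null measurable and almost surely disjoint from `A n`, so its probability is at most `1
  -- - P (A n)`.
  have hPB : P B ≤ ε / 2 := by
    have h6 := measure_mono_ae hAB
    rw [prob_compl_eq_one_sub₀ hBm] at h6
    refine le_trans ?_ hn.le
    refine ENNReal.le_sub_of_add_le_right (measure_ne_top _ _) ?_
    calc P B + P (A n) ≤ P B + (1 - P B) := by gcongr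
      _ = 1 := add_tsub_cancel_of_le prob_le_one
  calc P {ω | δ ≤ |D i ω|} ≤ P (B ∪ {ω | δ / 2 ≤ |W i ω|}) := by
        refine measure_mono fun ω hω => ?_
        by_contra hcon
        simp only [hB, Set.mem_union, Set.mem_ofPred_eq, not_or, not_le] at hcon hω
        have := le_abs_self (W i ω)
        linarith [hcon.1, hcon.2]
    _ ≤ P B + P {ω | δ / 2 ≤ |W i ω|} := measure_union_le _ _
    _ ≤ ε / 2 + ε / 2 := add_le_add hPB h2
    _ = ε := ENNReal.add_halves ε

/-- Domination by arbitrarily small multiples of a family bounded in probability, outside events of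
small probability. -/
theorem tendstoInMeasure_of_le_mul {D W : ι → Ω → ℝ} (hW : IsBoundedInProbability P W l)
    (h : ∀ η > 0, Tendsto (fun i => P {ω | ¬ |D i ω| ≤ η * W i ω}) l (𝓝 0)) :
    TendstoInMeasure P D l 0 := by
  rw [tendstoInMeasure_iff_le]
  intro δ hδ
  rw [ENNReal.tendsto_nhds_zero]
  intro ε hε
  obtain ⟨M, hM⟩ := hW (ε / 2) (ENNReal.half_pos hε.ne')
  have hη : 0 < δ / 2 / (|M| + 1) := by positivity
  filter_upwards [hM, ENNReal.tendsto_nhds_zero.1 (h _ hη) _ (ENNReal.half_pos hε.ne')]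
    with i h1 h2
  calc P {ω | δ ≤ |D i ω|}
      ≤ P ({ω | ¬ |D i ω| ≤ δ / 2 / (|M| + 1) * W i ω} ∪ {ω | M ≤ W i ω}) := by
        refine measure_mono fun ω hω => ?_
        by_contra hcon
        simp only [Set.mem_union, Set.mem_ofPred_eq, not_or, not_le] at hcon hω
        have : δ / 2 / (|M| + 1) * W i ω ≤ δ / 2 / (|M| + 1) * (|M| + 1) := by
          gcongr
          linarith [hcon.2, le_abs_self M]
        rw [div_mul_cancel₀ _ (by positivity)] at this
        linarith [hcon.1]
    _ ≤ _ := measure_union_le _ _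
    _ ≤ ε / 2 + ε / 2 := add_le_add h2 h1
    _ = ε := ENNReal.add_halves ε

/-- Multiplying by a null sequence a family that converges in distribution. -/
theorem tendsto_measure_norm_ge {E : Type*} [SeminormedAddCommGroup E] [NormedSpace ℝ E]
    {δ : ι → Ω → E} {a : ι → ℝ}
    (hb : IsBoundedInProbability P (fun i ω => ‖a i • δ i ω‖) l) (ha : Tendsto a l atTop)
    {ε : ℝ} (hε : 0 < ε) : Tendsto (fun i => P {ω | ε ≤ ‖δ i ω‖}) l (𝓝 0) := by
  have h := tendstoInMeasure_iff_le.1 (hb.tendstoInMeasure_mul (fun _ _ => norm_nonneg _)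
    (tendsto_inv_atTop_zero.comp ha)) ε hε
  refine h.congr' ?_
  filter_upwards [ha.eventually_gt_atTop 0] with i hi
  congr 1
  ext ω
  simp only [Set.mem_ofPred_eq, Function.comp_apply, norm_smul, Real.norm_eq_abs, abs_of_pos hi]
  rw [inv_mul_cancel_left₀ hi.ne', abs_norm]

end Convergence

/-! ### The covariance estimator of the observed process -/

section Remainder

variable {Ω : Type*} [MeasurableSpace Ω] {d : ℕ} {P : Measure Ω} [IsProbabilityMeasure P]

namespace IsStationarySolution

variable {Y : ℝ → Ω → Fin d → ℝ} {Θ : Mat d} {γ : ℝ → Mat d} {u : ℝ → Ω → Fin d → ℝ}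

theorem measurable_apply (hu : IsStationarySolution P Y Θ γ u) (i : Fin d) :
    Measurable (Function.uncurry fun s ω => u s ω i) :=
  (measurable_pi_apply i).comp hu.measurable

theorem ae_integrableOn_sq (hu : IsStationarySolution P Y Θ γ u) :
    ∀ᵐ ω ∂P, ∀ (i : Fin d) (n : ℕ), IntegrableOn (fun v => u v ω i ^ 2) (Set.Ioc 0 (n : ℝ)) := by
  rw [ae_all_iff]
  intro i
  rw [ae_all_iff]
  intro n
  obtain ⟨M, hM, hb⟩ := hu.bound
  have hm : Measurable fun q : ℝ × Ω => u q.1 q.2 i ^ 2 := (hu.measurable_apply i).pow_const 2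
  have h : Integrable (fun q : ℝ × Ω => u q.1 q.2 i ^ 2)
      ((volume.restrict (Set.Ioc 0 (n : ℝ))).prod P) := by
    refine (integrable_prod_iff hm.aestronglyMeasurable).2
      ⟨ae_of_all _ fun v => (hu.memLp v i).integrable_sq, ?_⟩
    refine (integrable_const (M ^ 2)).mono' ?_ (ae_of_all _ fun v => ?_)
    · exact hm.norm.stronglyMeasurable.integral_prod_right'.aestronglyMeasurable
    · simp only [Real.norm_eq_abs, abs_pow, sq_abs]
      rw [abs_of_nonneg (integral_nonneg fun ω => sq_nonneg _)]
      exact hb v i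
  exact h.prod_left_ae

theorem ae_integrableOn_exp (hu : IsStationarySolution P Y Θ γ u) {c : ℝ} (hc : 0 < c) :
    ∀ᵐ ω ∂P, ∀ i : Fin d,
      IntegrableOn (fun v => |u v ω i| * Real.exp (-(c * v))) (Set.Ioi 0) := by
  rw [ae_all_iff]
  intro i
  obtain ⟨M, hM, hb⟩ := hu.bound
  refine ae_integrable_of_memLp (f := fun v ω => |u v ω i| * Real.exp (-(c * v)))
    (φ := fun v => M * Real.exp (-(c * v))) ?_ (fun v => ?_) ?_ (fun v => by positivity)
    (fun v => ?_)
  · exact (continuous_abs.measurable.comp (hu.measurable_apply i)).mul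
      ((by fun_prop : Measurable fun v : ℝ => Real.exp (-(c * v))).comp measurable_fst)
  · exact (hu.memLp v i).abs.mul_const _
  · simp_rw [← neg_mul]
    exact (exp_neg_integrableOn_Ioi 0 hc).const_mul M
  · simp_rw [mul_pow, sq_abs]
    rw [integral_mul_const]
    gcongr
    exact hb v i

/-- These window integrals need not be bounded along a path, but the uniform second-moment bound
controls their means uniformly in `T`. -/
theorem integral_abs_window (hu : IsStationarySolution P Y Θ γ u) {t : ℝ} (ht : 0 ≤ t) :
    ∃ M, ∀ T : ℝ, Integrable (fun ω => ∑ k, ∫ v in T..(T + t), |u v ω k|) P ∧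
      ∫ ω, (∑ k, ∫ v in T..(T + t), |u v ω k|) ∂P ≤ M := by
  obtain ⟨M, hM, hb⟩ := hu.bound
  refine ⟨∑ _k : Fin d, t * M, fun T => ?_⟩
  have h : ∀ k : Fin d, MemLp (fun ω => ∫ v in T..(T + t), |u v ω k|) 2 P ∧
      ∫ ω, (∫ v in T..(T + t), |u v ω k|) ^ 2 ∂P ≤ (t * M) ^ 2 := by
    intro k
    have hle : T ≤ T + t := by linarith
    simp_rw [intervalIntegral.integral_of_le hle]
    have := memLp_integral (f := fun v ω => |u v ω k|) (φ := fun _ => M)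
      (μ := volume.restrict (Set.Ioc T (T + t))) (P := P)
      (continuous_abs.measurable.comp (hu.measurable_apply k))
      (fun v => (hu.memLp v k).abs) (integrable_const M) (fun _ => hM)
      (fun v => by simpa only [sq_abs] using hb v k)
    refine ⟨this.1, this.2.trans (le_of_eq ?_)⟩
    simp [ht]
  have hI : ∀ k : Fin d, Integrable (fun ω => ∫ v in T..(T + t), |u v ω k|) P :=
    fun k => (h k).1.integrable one_le_two
  refine ⟨integrable_finsetSum _ fun k _ => hI k, ?_⟩
  rw [integral_finsetSum _ fun k _ => hI k]
  refine Finset.sum_le_sum fun k _ => ?_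
  have h2 := integral_norm_mul_le (h k).1 (memLp_const (1 : ℝ)) (by positivity) zero_le_one
    (h k).2 (by simp)
  simp only [mul_one] at h2
  refine le_trans (integral_mono (hI k) (hI k).norm fun ω => le_abs_self _) h2

end IsStationarySolution

/-- The covariance estimator of the observed process is the one of the stationary solution,
corrected by the square of the error of the mean, up to a remainder of order `1 / T`. -/
theorem IsVasicek.exists_remainder_bound {X r : ℝ → Ω → Fin d → ℝ} {Θ σ : Mat d}
    {b : Fin d → ℝ} (hr : IsVasicek P X Θ σ b r) (hΘ : Θ.PosDef) {γ : ℝ → Mat d}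
    {u : ℝ → Ω → Fin d → ℝ} (hu : IsStationarySolution P (fun τ ω => σ *ᵥ X τ ω) Θ γ u)
    {t : ℝ} (ht : 0 ≤ t) :
    ∃ β, 0 ≤ β ∧ ∀ᵐ ω ∂P, ∃ K, ∀ T : ℝ≥0, 0 < T → ∀ s ∈ Set.Icc 0 t, ∀ i j,
      |covEst r T ω s i j - covEstU u T ω s i j +
        (meanEst r T ω i - b i) * (meanEst r T ω j - b j)| ≤
      (1 / (T : ℝ)) * (K + β * ∑ k, ∫ v in (T : ℝ)..(T + t), |u v ω k|) := by
  obtain ⟨c₀, hc₀, hdecay⟩ := hr.exists_decay hΘ hu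
  refine ⟨∑ j, |b j|, Finset.sum_nonneg fun j _ => abs_nonneg _, ?_⟩
  filter_upwards [hdecay, hu.ae_integrableOn_sq, hu.ae_integrableOn_exp hc₀]
    with ω ⟨κ, hκ, hz⟩ hsq hexp
  have hum : ∀ i, Measurable fun v => u v ω i := fun i =>
    (hu.measurable_apply i).comp measurable_prodMk_right
  have hrm : ∀ i, Measurable fun v => r v ω i := fun i =>
    ((measurable_pi_apply i).comp hr.measurable).comp measurable_prodMk_right
  choose K hK using fun i j => exists_covariance_bound ht hc₀ hκ (hum i) (hrm i) (hum j) (hrm j)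
    (hsq i) (hsq j) (hexp i) (hexp j) (fun v hv => hz v hv i) (fun v hv => hz v hv j)
  refine ⟨∑ i, ∑ j, |K i j|, fun T hT s hs i j => ?_⟩
  refine (hK i j T hT s hs).trans ?_
  have hw : ∀ k, 0 ≤ ∫ v in (T : ℝ)..(T + t), |u v ω k| := fun k =>
    intervalIntegral.integral_nonneg (by linarith) fun v _ => abs_nonneg _
  gcongr
  · calc K i j ≤ |K i j| := le_abs_self _
      _ ≤ ∑ j, |K i j| := Finset.single_le_sum (f := fun j => |K i j|)
          (fun _ _ => abs_nonneg _) (Finset.mem_univ j)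
      _ ≤ _ := Finset.single_le_sum (f := fun i => ∑ j, |K i j|)
          (fun _ _ => Finset.sum_nonneg fun _ _ => abs_nonneg _) (Finset.mem_univ i)
  · exact hw i
  · exact Finset.single_le_sum (f := fun j => |b j|) (fun _ _ => abs_nonneg _) (Finset.mem_univ j)
  · exact Finset.single_le_sum (f := fun k => ∫ v in (T : ℝ)..(T + t), |u v ω k|)
      (fun k _ => hw k) (Finset.mem_univ i)

end Remainder

/-! ### Measurability of the estimators -/

section Measurability

variable {Ω : Type*} [MeasurableSpace Ω] {d : ℕ}

theorem measurable_mat_iff {α : Type*} [MeasurableSpace α] {f : α → Mat d} :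
    Measurable f ↔ ∀ i j, Measurable fun a => f a i j := by
  refine ⟨fun h i j => (measurable_pi_apply j).comp ((measurable_pi_apply i).comp h), fun h => ?_⟩
  exact measurable_pi_iff.2 fun i => measurable_pi_iff.2 fun j => h i j

theorem measurable_intervalIntegral {α : Type*} [MeasurableSpace α] {f : α → ℝ → ℝ}
    (hf : Measurable (Function.uncurry f)) (x y : ℝ) :
    Measurable fun a => ∫ v in x..y, f a v := by
  unfold intervalIntegral
  exact (hf.stronglyMeasurable.integral_prod_right'.measurable).sub
    hf.stronglyMeasurable.integral_prod_right'.measurable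

variable {r : ℝ → Ω → Fin d → ℝ}

theorem measurable_covEst (hr : Measurable (Function.uncurry r)) (T : ℝ≥0) (i j : Fin d) :
    Measurable fun q : ℝ × Ω => covEst r T q.2 q.1 i j := by
  have h : ∀ i, Measurable fun q : ℝ × Ω => r q.1 q.2 i := fun i =>
    (measurable_pi_apply i).comp hr
  have h1 : ∀ i, Measurable fun q : (ℝ × Ω) × ℝ => r q.2 q.1.2 i := fun i =>
    (h i).comp (measurable_snd.prodMk (measurable_snd.comp measurable_fst))
  have h2 : Measurable fun q : (ℝ × Ω) × ℝ => r (q.1.1 + q.2) q.1.2 i :=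
    (h i).comp (((measurable_fst.comp measurable_fst).add measurable_snd).prodMk
      (measurable_snd.comp measurable_fst))
  simp only [covEst, Matrix.of_apply]
  exact ((measurable_intervalIntegral (h2.mul (h1 j)) 0 T).const_mul _).sub
    (((measurable_intervalIntegral (h1 i) 0 T).mul
      (measurable_intervalIntegral (h1 j) 0 T)).const_mul _)

theorem measurable_covEst_apply (hr : Measurable (Function.uncurry r)) (T : ℝ≥0) (s : ℝ)
    (i j : Fin d) : Measurable fun ω => covEst r T ω s i j :=
  (measurable_covEst hr T i j).comp measurable_prodMk_left

theorem measurable_estB (hr : Measurable (Function.uncurry r)) (t : ℝ) (T : ℝ≥0) :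
    Measurable fun ω => estB r t T ω := by
  refine measurable_mat_iff.2 fun i j => ?_
  have h : Measurable fun q : Ω × ℝ => covEst r T q.1 q.2 i j - covEst r T q.1 q.2 j i :=
    ((measurable_covEst hr T i j).comp measurable_swap).sub
      ((measurable_covEst hr T j i).comp measurable_swap)
  simp only [estB, riccatiB, Matrix.of_apply]
  exact measurable_intervalIntegral (f := fun ω s => covEst r T ω s i j - covEst r T ω s j i) h 0 t

theorem measurable_estC (hr : Measurable (Function.uncurry r)) (t : ℝ) (T : ℝ≥0) :
    Measurable fun ω => estC r t T ω := by
  refine measurable_mat_iff.2 fun i j => ?_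
  have h : Measurable fun q : ℝ × Ω => lagExtend (covEst r T q.2) q.1 i j := by
    have : (fun q : ℝ × Ω => lagExtend (covEst r T q.2) q.1 i j) = fun q : ℝ × Ω =>
        if 0 ≤ q.1 then covEst r T q.2 q.1 i j else covEst r T q.2 (-q.1) j i := by
      ext q
      rw [lagExtend]
      split_ifs <;> rfl
    rw [this]
    refine Measurable.ite (measurableSet_le measurable_const measurable_fst)
      (measurable_covEst hr T i j) ?_
    exact (measurable_covEst hr T j i).comp (measurable_fst.neg.prodMk measurable_snd)
  simp only [estC, riccatiC, Matrix.of_apply]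
  refine measurable_intervalIntegral (f := fun ω s =>
    ∫ u in (0 : ℝ)..t, lagExtend (covEst r T ω) (u - s) i j) ?_ 0 t
  refine measurable_intervalIntegral (f := fun (q : Ω × ℝ) u =>
    lagExtend (covEst r T q.1) (u - q.2) i j) ?_ 0 t
  exact h.comp ((measurable_snd.sub (measurable_snd.comp measurable_fst)).prodMk
    (measurable_fst.comp measurable_fst))

theorem measurable_const_mul_mat {f : Ω → Mat d} (hf : Measurable f) (A : Mat d) :
    Measurable fun ω => A * f ω :=
  (by fun_prop : Continuous fun B : Mat d => A * B).measurable.comp hf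

theorem measurable_sigmaSqEst (P : Measure Ω) (X : ℝ → Ω → Fin d → ℝ)
    (hr : Measurable (Function.uncurry r)) (N : ℕ) :
    Measurable fun ω => sigmaSqEst P X r N ω := by
  refine measurable_const_mul_mat (measurable_mat_iff.2 fun i j => ?_) _
  have h : ∀ s i, Measurable fun ω => r s ω i := fun s i =>
    ((measurable_pi_apply i).comp hr).comp measurable_prodMk_left
  simp only [Matrix.smul_apply, Matrix.sum_apply, Matrix.vecMulVec_apply, Pi.sub_apply]
  refine Measurable.const_mul (Finset.measurable_fun_sum _ fun k _ => ?_) (1 / (N : ℝ))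
  exact ((h _ i).sub (h _ i)).mul ((h _ j).sub (h _ j))

theorem measurable_estD (P : Measure Ω) (X : ℝ → Ω → Fin d → ℝ)
    (hr : Measurable (Function.uncurry r)) (t : ℝ) (T : ℝ≥0) (N : ℕ) :
    Measurable fun ω => estD P X r t T N ω := by
  refine measurable_mat_iff.2 fun i j => ?_
  have h1 := measurable_mat_iff.1 (measurable_const_mul_mat (measurable_sigmaSqEst P X hr N)
    (covMat P (X t))) i j
  simp only [estD, Matrix.sub_apply, Matrix.smul_apply, Matrix.transpose_apply]
  exact h1.sub ((((measurable_covEst_apply hr T 0 i j).const_mul 2).sub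
    (measurable_covEst_apply hr T t i j)).sub (measurable_covEst_apply hr T t j i))

end Measurability

/-! ### The limit of the errors of the Riccati coefficients -/

section LimitMap

variable {d : ℕ} {t : ℝ}

/-- Evaluation is jointly continuous in the path and the lag, so integrals over the compact interval
depend continuously on the path. -/
theorem continuous_limitMap (ht : 0 ≤ t) (V : Mat d) (c₁ c₂ c₃ : ℝ) :
    Continuous (limitMap t ht V c₁ c₂ c₃) := by
  have hy : Continuous fun q : (Mat d × Path d t × Mat d) × ℝ =>
      q.1.2.1 (Set.projIcc 0 t ht q.2) :=
    (continuous_fst.comp (continuous_snd.comp continuous_fst)).eval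
      (continuous_projIcc.comp continuous_snd)
  have hyij : ∀ i j, Continuous fun q : (Mat d × Path d t × Mat d) × ℝ =>
      q.1.2.1 (Set.projIcc 0 t ht q.2) i j := fun i j => hy.matrix_elem i j
  have hpt : ∀ s : Set.Icc (0 : ℝ) t, Continuous fun p : Mat d × Path d t × Mat d => p.2.1 s :=
    fun s => (continuous_fst.comp continuous_snd).eval continuous_const
  have hM : Continuous fun p : Mat d × Path d t × Mat d => p.1 := continuous_fst
  have hS : Continuous fun p : Mat d × Path d t × Mat d => p.2.2 :=
    continuous_snd.comp continuous_snd
  have hCint : Continuous fun p : Mat d × Path d t × Mat d => (Matrix.of fun i j =>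
      ∫ s in (0 : ℝ)..t, (t - s) * (p.2.1 (Set.projIcc 0 t ht s) i j +
        p.2.1 (Set.projIcc 0 t ht s) j i) : Mat d) :=
    continuous_matrix fun i j =>
      intervalIntegral.continuous_parametric_intervalIntegral_of_continuous'
        (f := fun (p : Mat d × Path d t × Mat d) (s : ℝ) => (t - s) *
          (p.2.1 (Set.projIcc 0 t ht s) i j + p.2.1 (Set.projIcc 0 t ht s) j i))
        ((continuous_const.sub continuous_snd).mul ((hyij i j).add (hyij j i))) 0 t
  have hBint : Continuous fun p : Mat d × Path d t × Mat d => (Matrix.of fun i j =>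
      ∫ s in (0 : ℝ)..t, (p.2.1 (Set.projIcc 0 t ht s) i j -
        p.2.1 (Set.projIcc 0 t ht s) j i) : Mat d) :=
    continuous_matrix fun i j =>
      intervalIntegral.continuous_parametric_intervalIntegral_of_continuous'
        (f := fun (p : Mat d × Path d t × Mat d) (s : ℝ) =>
          (p.2.1 (Set.projIcc 0 t ht s) i j - p.2.1 (Set.projIcc 0 t ht s) j i))
        ((hyij i j).sub (hyij j i)) 0 t
  have h1 := (hCint.const_smul c₂).sub (hM.const_smul (c₁ * t ^ 2))
  have h2 := hBint.const_smul c₂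
  have h3 := ((continuous_const (y := V)).matrix_mul hS |>.const_smul c₃).add
    ((((hpt ⟨t, ht, le_rfl⟩).add (hpt ⟨t, ht, le_rfl⟩).matrix_transpose).sub
      ((hpt ⟨0, le_rfl, ht⟩).const_smul (2 : ℝ))).const_smul c₂)
  exact h1.prodMk (h2.prodMk h3)

/-- The weights of the limit map may be moved into its arguments. -/
theorem limitMap_weights (ht : 0 ≤ t) (V : Mat d) (c₁ c₂ c₃ : ℝ) (a : Fin d → ℝ) (y : Path d t)
    (S : Mat d) :
    limitMap t ht V c₁⁻¹ 1 1 (Matrix.vecMulVec (c₁ • a) (c₁ • a), c₂ • y, c₃ • S) =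
      limitMap t ht V c₁ c₂ c₃ (Matrix.vecMulVec a a, y, S) := by
  -- The outer product receives the weight `c₁` twice and `c₁⁻¹` removes one factor; at `c₁ = 0`
  -- this relies on `0⁻¹ = 0`.
  have hc : c₁⁻¹ * c₁ * c₁ = c₁ := by
    rcases eq_or_ne c₁ 0 with h | h
    · simp [h]
    · rw [inv_mul_cancel₀ h, one_mul]
  refine Prod.ext ?_ (Prod.ext ?_ ?_)
  · ext i j
    change (1 : ℝ) * (∫ s in (0 : ℝ)..t, (t - s) * (c₂ * y (Set.projIcc 0 t ht s) i j +
      c₂ * y (Set.projIcc 0 t ht s) j i)) - c₁⁻¹ * t ^ 2 * (c₁ * a i * (c₁ * a j)) =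
      c₂ * (∫ s in (0 : ℝ)..t, (t - s) * (y (Set.projIcc 0 t ht s) i j +
        y (Set.projIcc 0 t ht s) j i)) - c₁ * t ^ 2 * (a i * a j)
    rw [one_mul, ← intervalIntegral.integral_const_mul]
    congr 1
    · refine intervalIntegral.integral_congr fun s _ => ?_
      ring
    · linear_combination t ^ 2 * a i * a j * hc
  · ext i j
    change (1 : ℝ) * (∫ s in (0 : ℝ)..t, (c₂ * y (Set.projIcc 0 t ht s) i j -
      c₂ * y (Set.projIcc 0 t ht s) j i)) =
      c₂ * (∫ s in (0 : ℝ)..t, (y (Set.projIcc 0 t ht s) i j - y (Set.projIcc 0 t ht s) j i))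
    rw [one_mul, ← intervalIntegral.integral_const_mul]
    refine intervalIntegral.integral_congr fun s _ => ?_
    ring
  · change (1 : ℝ) • (V * (c₃ • S)) + (1 : ℝ) • (c₂ • y ⟨t, ht, le_rfl⟩ +
      (c₂ • y ⟨t, ht, le_rfl⟩)ᵀ - (2 : ℝ) • (c₂ • y ⟨0, le_rfl, ht⟩)) =
      c₃ • (V * S) + c₂ • (y ⟨t, ht, le_rfl⟩ + (y ⟨t, ht, le_rfl⟩)ᵀ - (2 : ℝ) • y ⟨0, le_rfl, ht⟩)
    rw [Matrix.mul_smul, Matrix.transpose_smul, one_smul, one_smul, smul_sub, smul_add,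
      smul_comm c₂ (2 : ℝ)]

section Bound

attribute [local instance] Matrix.normedAddCommGroup Matrix.normedSpace

/-- Comparison of rescaled errors of the Riccati coefficients with their limit. -/
theorem norm_smul_sub_limitMap_le (ht : 0 ≤ t) (V : Mat d) (c₁ c₂ c₃ : ℝ) {M : Mat d}
    (hM : Mᵀ = M) (y : Path d t) (S : Mat d) {lam w : ℝ} (hw : 0 ≤ w) {e : ℝ → Mat d}
    (he : ∀ i j, IntervalIntegrable (fun s => e s i j) volume 0 t) {E δC δB δD : Mat d}
    (hf : ∀ s : Set.Icc (0 : ℝ) t, ∀ i j, |lam * e s i j - c₂ * y s i j + c₁ * M i j| ≤ w)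
    (hS : ∀ i j, |lam * E i j - c₃ * S i j| ≤ w)
    (hC : ∀ i j, δC i j = ∫ s in (0 : ℝ)..t, (t - s) * (e s i j + e s j i))
    (hB : ∀ i j, δB i j = ∫ s in (0 : ℝ)..t, (e s i j - e s j i))
    (hD : δD = V * E + (e t + (e t)ᵀ - (2 : ℝ) • e 0)) :
    ‖lam • (δC, δB, δD) - limitMap t ht V c₁ c₂ c₃ (M, y, S)‖ ≤
      (2 * t ^ 2 + 2 * t + 4 + d * ‖V‖) * w := by
  have hMij : ∀ i j, M j i = M i j := fun i j => congrFun (congrFun hM i) j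
  have hyc : ∀ i j, Continuous fun s : ℝ => y (Set.projIcc 0 t ht s) i j := fun i j =>
    (y.continuous.comp continuous_projIcc).matrix_elem i j
  -- `f` is the rescaled covariance error minus its prediction. Its part `c₁ M` does not depend on
  -- the lag: it integrates to `c₁ t² M` in the first component and, being symmetric, cancels in the
  -- other two.
  set f : ℝ → Mat d := fun s => Matrix.of fun i j =>
    lam * e s i j - c₂ * y (Set.projIcc 0 t ht s) i j + c₁ * M i j with hfdef
  have hfi : ∀ i j, IntervalIntegrable (fun s => f s i j) volume 0 t := fun i j =>
    (((he i j).const_mul lam).sub ((hyc i j).const_mul c₂ |>.intervalIntegrable 0 t)).add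
      intervalIntegrable_const
  have hfb : ∀ s ∈ Set.Icc 0 t, ∀ i j, |f s i j| ≤ w := fun s hs i j => by
    have := hf ⟨s, hs⟩ i j
    simp only [hfdef, Matrix.of_apply, Set.projIcc_of_mem ht hs]
    exact this
  have hV : 0 ≤ (d : ℝ) * ‖V‖ := by positivity
  have hcs : Continuous fun s : ℝ => t - s := by fun_prop
  have hu : ∀ s ∈ Set.uIoc 0 t, s ∈ Set.Icc 0 t := fun s hs => by
    rw [Set.uIoc_of_le ht] at hs
    exact ⟨hs.1.le, hs.2⟩
  rw [Prod.norm_def, Prod.norm_def]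
  -- The three components contribute `2 t²`, `2 t` and `4 + d ‖V‖` to the constant.
  refine max_le ?_ (max_le ?_ ?_)
  · rw [Matrix.norm_le_iff (by positivity)]
    intro i j
    have e1 : (lam • δC - (limitMap t ht V c₁ c₂ c₃ (M, y, S)).1) i j =
        ∫ s in (0 : ℝ)..t, (t - s) * (f s i j + f s j i) := by
      change lam * δC i j - (c₂ * (∫ s in (0 : ℝ)..t, (t - s) *
        (y (Set.projIcc 0 t ht s) i j + y (Set.projIcc 0 t ht s) j i)) - c₁ * t ^ 2 * M i j) = _
      have h1 : IntervalIntegrable (fun s => (t - s) * (e s i j + e s j i)) volume 0 t :=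
        ((he i j).add (he j i)).continuousOn_mul hcs.continuousOn
      have h2 : IntervalIntegrable (fun s => (t - s) * (y (Set.projIcc 0 t ht s) i j +
          y (Set.projIcc 0 t ht s) j i)) volume 0 t :=
        (hcs.mul ((hyc i j).add (hyc j i))).intervalIntegrable 0 t
      have h3 : IntervalIntegrable (fun s => (t - s) * (2 * c₁ * M i j)) volume 0 t :=
        (hcs.mul continuous_const).intervalIntegrable 0 t
      have h4 : ∫ s in (0 : ℝ)..t, (t - s) * (2 * c₁ * M i j) = c₁ * t ^ 2 * M i j := by
        rw [intervalIntegral.integral_mul_const, intervalIntegral.integral_sub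
          intervalIntegrable_const intervalIntegral.intervalIntegrable_id]
        simp
        ring
      rw [hC, ← h4, ← intervalIntegral.integral_const_mul, ← intervalIntegral.integral_const_mul,
        ← intervalIntegral.integral_sub (h2.const_mul c₂) h3,
        ← intervalIntegral.integral_sub (h1.const_mul lam) ((h2.const_mul c₂).sub h3)]
      refine intervalIntegral.integral_congr fun s _ => ?_
      simp only [hfdef, Matrix.of_apply, hMij i j]
      ring
    change ‖(lam • δC - (limitMap t ht V c₁ c₂ c₃ (M, y, S)).1) i j‖ ≤ _
    rw [e1]
    refine (intervalIntegral.norm_integral_le_of_norm_le_const (C := t * (w + w))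
      fun s hs => ?_).trans ?_
    · have hs' := hu s hs
      rw [norm_mul, Real.norm_eq_abs, abs_of_nonneg (by linarith [hs'.2])]
      gcongr
      · linarith [hs'.1]
      · exact (norm_add_le _ _).trans (add_le_add (hfb s hs' i j) (hfb s hs' j i))
    · rw [sub_zero, abs_of_nonneg ht]
      nlinarith [mul_nonneg ht hw, mul_nonneg hV hw]
  · rw [Matrix.norm_le_iff (by positivity)]
    intro i j
    have e1 : (lam • δB - (limitMap t ht V c₁ c₂ c₃ (M, y, S)).2.1) i j =
        ∫ s in (0 : ℝ)..t, (f s i j - f s j i) := by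
      change lam * δB i j - c₂ * (∫ s in (0 : ℝ)..t,
        (y (Set.projIcc 0 t ht s) i j - y (Set.projIcc 0 t ht s) j i)) = _
      have h1 : IntervalIntegrable (fun s => e s i j - e s j i) volume 0 t := (he i j).sub (he j i)
      have h2 : IntervalIntegrable (fun s => y (Set.projIcc 0 t ht s) i j -
          y (Set.projIcc 0 t ht s) j i) volume 0 t :=
        ((hyc i j).sub (hyc j i)).intervalIntegrable 0 t
      rw [hB, ← intervalIntegral.integral_const_mul, ← intervalIntegral.integral_const_mul,
        ← intervalIntegral.integral_sub (h1.const_mul lam) (h2.const_mul c₂)]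
      refine intervalIntegral.integral_congr fun s _ => ?_
      simp only [hfdef, Matrix.of_apply, hMij i j]
      ring
    change ‖(lam • δB - (limitMap t ht V c₁ c₂ c₃ (M, y, S)).2.1) i j‖ ≤ _
    rw [e1]
    refine (intervalIntegral.norm_integral_le_of_norm_le_const (C := w + w)
      fun s hs => ?_).trans ?_
    · have hs' := hu s hs
      exact (norm_sub_le _ _).trans (add_le_add (hfb s hs' i j) (hfb s hs' j i))
    · rw [sub_zero, abs_of_nonneg ht]
      nlinarith [mul_nonneg (sq_nonneg t) hw, mul_nonneg hV hw]
  · have e1 : lam • δD - (limitMap t ht V c₁ c₂ c₃ (M, y, S)).2.2 =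
        V * (lam • E - c₃ • S) + (f t + (f t)ᵀ - (2 : ℝ) • f 0) := by
      have hft : f t = lam • e t - c₂ • y ⟨t, ht, le_rfl⟩ + c₁ • M := by
        ext i j
        simp only [hfdef, Matrix.of_apply, Set.projIcc_right]
        rfl
      have hf0 : f 0 = lam • e 0 - c₂ • y ⟨0, le_rfl, ht⟩ + c₁ • M := by
        ext i j
        simp only [hfdef, Matrix.of_apply, Set.projIcc_left]
        rfl
      change lam • δD - (c₃ • (V * S) + c₂ • (y ⟨t, ht, le_rfl⟩ + (y ⟨t, ht, le_rfl⟩)ᵀ -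
        (2 : ℝ) • y ⟨0, le_rfl, ht⟩)) = _
      rw [hft, hf0, hD, Matrix.transpose_add, Matrix.transpose_sub, Matrix.transpose_smul,
        Matrix.transpose_smul, Matrix.transpose_smul, hM, Matrix.mul_sub, Matrix.mul_smul,
        Matrix.mul_smul]
      module
    change ‖lam • δD - (limitMap t ht V c₁ c₂ c₃ (M, y, S)).2.2‖ ≤ _
    rw [e1]
    have hn : ∀ s ∈ Set.Icc 0 t, ‖f s‖ ≤ w := fun s hs =>
      (Matrix.norm_le_iff hw).2 fun i j => hfb s hs i j
    have n1 := hn t ⟨ht, le_rfl⟩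
    have n0 := hn 0 ⟨le_rfl, ht⟩
    have nT : ‖(f t)ᵀ‖ ≤ w := by rwa [Matrix.norm_transpose]
    have nS : ‖lam • E - c₃ • S‖ ≤ w := (Matrix.norm_le_iff hw).2 fun i j => hS i j
    have h2 : ‖(2 : ℝ) • f 0‖ ≤ 2 * w := by
      rw [norm_smul]
      simpa using n0
    have h3 : ‖V * (lam • E - c₃ • S)‖ ≤ d * ‖V‖ * w :=
      (norm_mul_le_card _ _).trans (by gcongr)
    have h4 := norm_add_le (V * (lam • E - c₃ • S)) (f t + (f t)ᵀ - (2 : ℝ) • f 0)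
    have h5 := norm_sub_le (f t + (f t)ᵀ) ((2 : ℝ) • f 0)
    have h6 := norm_add_le (f t) (f t)ᵀ
    nlinarith [mul_nonneg ht hw, mul_nonneg (sq_nonneg t) hw]

end Bound

end LimitMap

/-! ### Asymptotics of the estimators -/

section PathNorm

variable {d : ℕ} {t : ℝ}

/-- An entry of a path of matrices. -/
def pathEntry (i j : Fin d) (y : Path d t) : C(Set.Icc (0 : ℝ) t, ℝ) :=
  (⟨fun A : Mat d => A i j, continuous_id.matrix_elem i j⟩ : C(Mat d, ℝ)).comp y

/-- A norm for the topology of uniform convergence of paths of matrices. -/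
noncomputable def pathNorm (y : Path d t) : ℝ := ∑ i, ∑ j, ‖pathEntry i j y‖

theorem continuous_pathNorm : Continuous (pathNorm : Path d t → ℝ) :=
  continuous_finsetSum _ fun _ _ => continuous_finsetSum _ fun _ _ =>
    (ContinuousMap.continuous_postcomp _).norm

theorem pathNorm_nonneg (y : Path d t) : 0 ≤ pathNorm y :=
  Finset.sum_nonneg fun _ _ => Finset.sum_nonneg fun _ _ => norm_nonneg _

theorem abs_apply_le_pathNorm (y : Path d t) (s : Set.Icc (0 : ℝ) t) (i j : Fin d) :
    |y s i j| ≤ pathNorm y :=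
  calc |y s i j| ≤ ‖pathEntry i j y‖ := (pathEntry i j y).norm_coe_le_norm s
    _ ≤ ∑ j, ‖pathEntry i j y‖ := Finset.single_le_sum (f := fun j => ‖pathEntry i j y‖)
        (fun _ _ => norm_nonneg _) (Finset.mem_univ j)
    _ ≤ _ := Finset.single_le_sum (f := fun i => ∑ j, ‖pathEntry i j y‖)
        (fun _ _ => Finset.sum_nonneg fun _ _ => norm_nonneg _) (Finset.mem_univ i)

end PathNorm

section Asymptotics

attribute [local instance] Matrix.normedAddCommGroup Matrix.normedSpace

variable {Ω Ω' : Type*} [MeasurableSpace Ω] [MeasurableSpace Ω']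
  {P : Measure Ω} [IsProbabilityMeasure P] {P' : Measure Ω'} [IsProbabilityMeasure P'] {d : ℕ}

theorem tendstoInDistribution_of_norm_sub {ι E : Type*} [NormedAddCommGroup E] [MeasurableSpace E]
    (hE : BorelSpace E) (hE' : SecondCountableTopology E) {l : Filter ι} [l.IsCountablyGenerated]
    {V W : ι → Ω → E} {Z : Ω' → E} (hV : TendstoInDistribution V l Z (fun _ => P) P')
    (hW : ∀ i, AEMeasurable (W i) P)
    (h : TendstoInMeasure P (fun i ω => ‖W i ω - V i ω‖) l 0) :
    TendstoInDistribution W l Z (fun _ => P) P' := by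
  refine tendstoInDistribution_of_tendstoInMeasure_sub W Z hV ?_ hW
  rw [tendstoInMeasure_iff_norm] at h ⊢
  simpa using h

theorem aemeasurable_norm {E : Type*} [NormedAddCommGroup E] [MeasurableSpace E]
    (hE : BorelSpace E) {f : Ω → E} (hf : AEMeasurable f P) :
    AEMeasurable (fun ω => ‖f ω‖) P :=
  hf.norm

variable {X r : ℝ → Ω → Fin d → ℝ} {Θ σ : Mat d} {b : Fin d → ℝ} {t : ℝ}

/-- Passage from `u` to `stationarySol`. The remainder consists of `K`, finite along each path but
chosen without measurability, and the window term `ρ` with bounded mean; after division by `T` both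
are negligible at the rate in question. -/
theorem IsVasicek.exists_covEst_error_bound (hr : IsVasicek P X Θ σ b r) (hΘ : Θ.PosDef)
    (hX : IsNoise P X) (ht : 0 ≤ t) {G : ℝ≥0 → Ω → Path d t}
    (hG : ∀ T : ℝ≥0, ∀ᵐ ω ∂P, ∀ s : Set.Icc (0 : ℝ) t,
      G T ω s = covEstU (stationarySol X Θ σ) T ω s - autocov P X Θ σ s) :
    ∃ (K : Ω → ℝ) (ρ : ℝ≥0 → Ω → ℝ) (M : ℝ), (∀ T, Integrable (ρ T) P) ∧ (∀ T ω, 0 ≤ ρ T ω) ∧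
      (∀ T, ∫ ω, ρ T ω ∂P ≤ M) ∧ ∀ T : ℝ≥0, 0 < T → ∀ᵐ ω ∂P,
        ∀ s : Set.Icc (0 : ℝ) t, ∀ i j,
          |covEst r T ω s i j - autocov P X Θ σ s i j - G T ω s i j +
            (meanEst r T ω - b) i * (meanEst r T ω - b) j| ≤ (1 / (T : ℝ)) * (|K ω| + ρ T ω) := by
  obtain ⟨u, hu, hU⟩ := exists_isStationarySolution hX hΘ σ
  obtain ⟨β, hβ, hrem⟩ := hr.exists_remainder_bound hΘ hu ht
  obtain ⟨K, hK⟩ := hrem.choice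
  obtain ⟨M, hM⟩ := hu.integral_abs_window ht
  refine ⟨K, fun T ω => β * ∑ k, ∫ v in (T : ℝ)..(T + t), |u v ω k|, β * M,
    fun T => (hM T).1.const_mul β, fun T ω => mul_nonneg hβ (Finset.sum_nonneg fun k _ =>
      intervalIntegral.integral_nonneg (by linarith) fun v _ => abs_nonneg _), fun T => ?_,
    fun T hT => ?_⟩
  · rw [integral_const_mul]
    exact mul_le_mul_of_nonneg_left (hM T).2 hβ
  · filter_upwards [hK, hU, hG T] with ω h1 h2 h3 s i j
    have h4 : covEstU (stationarySol X Θ σ) T ω s = covEstU u T ω s := by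
      ext i j
      simp only [covEstU, Matrix.of_apply, h2]
    have h5 := h1 T hT s s.2 i j
    rw [h3 s, h4, Matrix.sub_apply]
    refine le_trans (le_of_eq ?_) (h5.trans ?_)
    · congr 1
      simp only [Pi.sub_apply]
      ring
    · gcongr
      exact le_abs_self _

theorem intervalIntegrable_covEst (hrm : Measurable (Function.uncurry r)) (ht : 0 ≤ t) {T : ℝ≥0}
    {ω : Ω} {i j : Fin d} {C : ℝ} (h : ∀ s ∈ Set.Icc 0 t, |covEst r T ω s i j| ≤ C) :
    IntervalIntegrable (fun s => covEst r T ω s i j) volume 0 t := by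
  refine (intervalIntegrable_const (c := C)).mono_fun' ?_ ?_
  · exact ((measurable_covEst hrm T i j).comp measurable_prodMk_right).aestronglyMeasurable
  · rw [Set.uIoc_of_le ht]
    exact (ae_restrict_iff' measurableSet_Ioc).2 (ae_of_all _ fun s hs => h s ⟨hs.1.le, hs.2⟩)

/-- Boundedness over `[0, t]` is read off from the error bound, since the autocovariance and the
continuous path `G T ω` are bounded. -/
theorem IsVasicek.ae_intervalIntegrable_covEst (hr : IsVasicek P X Θ σ b r) (hΘ : Θ.PosDef)
    (hX : IsNoise P X) (ht : 0 ≤ t) {G : ℝ≥0 → Ω → Path d t}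
    (hG : ∀ T : ℝ≥0, ∀ᵐ ω ∂P, ∀ s : Set.Icc (0 : ℝ) t,
      G T ω s = covEstU (stationarySol X Θ σ) T ω s - autocov P X Θ σ s)
    {T : ℝ≥0} (hT : 0 < T) :
    ∀ᵐ ω ∂P, ∀ i j, IntervalIntegrable (fun s => covEst r T ω s i j) volume 0 t := by
  obtain ⟨u, hu, hU⟩ := exists_isStationarySolution hX hΘ σ
  obtain ⟨C, hC⟩ := hu.exists_abs_autocov_le
  obtain ⟨K, ρ, M, -, -, -, hb⟩ := hr.exists_covEst_error_bound hΘ hX ht hG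
  filter_upwards [hb T hT] with ω hω i j
  refine intervalIntegrable_covEst hr.measurable ht
    (C := (1 / (T : ℝ)) * (|K ω| + ρ T ω) + C + pathNorm (G T ω) +
      |(meanEst r T ω - b) i * (meanEst r T ω - b) j|) fun s hs => ?_
  have h1 := abs_le.1 (hω ⟨s, hs⟩ i j)
  have h2 := abs_le.1 (hC s i j)
  have h3 : |G T ω ⟨s, hs⟩ i j| ≤ pathNorm (G T ω) :=
    abs_apply_le_pathNorm _ _ _ _
  have h4 := abs_le.1 h3
  have h5 := neg_abs_le ((meanEst r T ω - b) i * (meanEst r T ω - b) j)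
  have h6 := le_abs_self ((meanEst r T ω - b) i * (meanEst r T ω - b) j)
  simp only at h1
  rw [abs_le]
  constructor <;> linarith [h1.1, h1.2, h2.1, h2.2, h4.1, h4.2]

/-- Comparison of the rescaled errors of the Riccati coefficients with the limit map applied to the
rescaled errors of the mean, of the covariance and of the volatility. -/
theorem IsVasicek.ae_norm_error_sub_limitMap_le (hr : IsVasicek P X Θ σ b r) (hΘ : Θ.PosDef)
    (hσ : σ.IsDiag) (hX : IsNoise P X) (ht : 0 ≤ t) {G : ℝ≥0 → Ω → Path d t}
    (hG : ∀ T : ℝ≥0, ∀ᵐ ω ∂P, ∀ s : Set.Icc (0 : ℝ) t,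
      G T ω s = covEstU (stationarySol X Θ σ) T ω s - autocov P X Θ σ s)
    {T : ℝ≥0} (hT : 0 < T) {a : Ω → ℝ} (ha0 : ∀ ω, 0 ≤ a ω)
    (ha : ∀ᵐ ω ∂P, ∀ s : Set.Icc (0 : ℝ) t, ∀ i j,
      |covEst r T ω s i j - autocov P X Θ σ s i j - G T ω s i j +
        (meanEst r T ω - b) i * (meanEst r T ω - b) j| ≤ a ω)
    {l₁ l₂ l₃ lam : ℝ} (hl₁ : l₁ ≠ 0) (hl₂ : l₂ ≠ 0) (hl₃ : l₃ ≠ 0) (c₁ c₂ c₃ : ℝ) (n : ℕ) :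
    ∀ᵐ ω ∂P, ‖lam • (estC r t T ω - trueC P X Θ σ t, estB r t T ω - trueB P X Θ σ t,
        estD P X r t T n ω - trueD P X Θ σ t) -
      limitMap t ht (covMat P (X t)) c₁ c₂ c₃
        (Matrix.vecMulVec (l₁ • (meanEst r T ω - b)) (l₁ • (meanEst r T ω - b)), l₂ • G T ω,
          l₃ • (sigmaSqEst P X r n ω - σ * σᵀ))‖ ≤
      (2 * t ^ 2 + 2 * t + 4 + d * ‖covMat P (X t)‖) *
        (|lam / l₁ ^ 2 - c₁| * ‖l₁ • (meanEst r T ω - b)‖ ^ 2 +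
          |lam / l₂ - c₂| * pathNorm (l₂ • G T ω) +
          |lam / l₃ - c₃| * ‖l₃ • (sigmaSqEst P X r n ω - σ * σᵀ)‖ + |lam| * a ω) := by
  obtain ⟨u, hu, hU⟩ := exists_isStationarySolution hX hΘ σ
  filter_upwards [ha, hr.ae_intervalIntegrable_covEst hΘ hX ht hG hT] with ω hω hint
  have hγ := fun i j => hu.intervalIntegrable_autocov i j 0 t
  have hp := pathNorm_nonneg (l₂ • G T ω)
  have hp0 := ha0 ω
  refine norm_smul_sub_limitMap_le ht (covMat P (X t)) c₁ c₂ c₃ ?_ _ _ (by positivity)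
    (e := fun s => covEst r T ω s - autocov P X Θ σ s)
    (E := sigmaSqEst P X r n ω - σ * σᵀ) (fun i j => (hint i j).sub (hγ i j)) ?_ ?_ ?_ ?_ ?_
  · rw [Matrix.transpose_vecMulVec]
  · intro s i j
    set z := l₁ • (meanEst r T ω - b) with hz
    -- The first two terms carry the errors of the rate ratios, and the last is the covariance
    -- remainder, bounded by `a`.
    have e1 : lam * (covEst r T ω s - autocov P X Θ σ s) i j - c₂ * (l₂ • G T ω) s i j +
        c₁ * Matrix.vecMulVec z z i j =
        -((lam / l₁ ^ 2 - c₁) * (z i * z j)) + (lam / l₂ - c₂) * (l₂ • G T ω) s i j +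
        lam * (covEst r T ω s i j - autocov P X Θ σ s i j - G T ω s i j +
        (meanEst r T ω - b) i * (meanEst r T ω - b) j) := by
      have h2 : (l₂ • G T ω) s i j = l₂ * G T ω s i j := rfl
      have hzi : ∀ i, z i = l₁ * (meanEst r T ω - b) i := fun i => rfl
      rw [h2, Matrix.vecMulVec_apply, hzi, hzi, Matrix.sub_apply]
      field_simp
      ring
    rw [e1]
    have hzi : ∀ i, |z i| ≤ ‖z‖ := fun i => norm_le_pi_norm z i
    have b1 : |-((lam / l₁ ^ 2 - c₁) * (z i * z j))| ≤ |lam / l₁ ^ 2 - c₁| * ‖z‖ ^ 2 := by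
      rw [abs_neg, abs_mul, abs_mul, pow_two ‖z‖]
      gcongr
      · exact hzi i
      · exact hzi j
    have b2 : |(lam / l₂ - c₂) * (l₂ • G T ω) s i j| ≤ |lam / l₂ - c₂| * pathNorm (l₂ • G T ω) := by
      rw [abs_mul]
      gcongr
      exact abs_apply_le_pathNorm _ _ _ _
    have b3 : |lam * (covEst r T ω s i j - autocov P X Θ σ s i j - G T ω s i j +
        (meanEst r T ω - b) i * (meanEst r T ω - b) j)| ≤ |lam| * a ω := by
      rw [abs_mul]
      gcongr
      exact hω s i j
    have b4 : 0 ≤ |lam / l₃ - c₃| * ‖l₃ • (sigmaSqEst P X r n ω - σ * σᵀ)‖ := by positivity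
    refine (abs_add_le _ _).trans ((add_le_add (abs_add_le _ _) le_rfl).trans ?_)
    linarith
  · intro i j
    set S := l₃ • (sigmaSqEst P X r n ω - σ * σᵀ) with hS
    have e1 : lam * (sigmaSqEst P X r n ω - σ * σᵀ) i j - c₃ * S i j = (lam / l₃ - c₃) * S i j := by
      have : S i j = l₃ * (sigmaSqEst P X r n ω - σ * σᵀ) i j := rfl
      rw [this]
      field_simp
    rw [e1, abs_mul]
    have b1 : |lam / l₃ - c₃| * |S i j| ≤ |lam / l₃ - c₃| * ‖S‖ := by
      gcongr
      rw [← Real.norm_eq_abs]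
      exact Matrix.norm_entry_le_entrywise_sup_norm S
    have b2 : 0 ≤ |lam / l₁ ^ 2 - c₁| * ‖l₁ • (meanEst r T ω - b)‖ ^ 2 := by positivity
    have b3 : 0 ≤ |lam / l₂ - c₂| * pathNorm (l₂ • G T ω) := by positivity
    have b4 : 0 ≤ |lam| * a ω := by positivity
    linarith
  · intro i j
    have hc : Continuous fun s : ℝ => t - s := by fun_prop
    rw [Matrix.sub_apply, estC, trueC, riccatiC_apply ht hint, riccatiC_apply ht hγ,
      ← intervalIntegral.integral_sub
        (((hint i j).add (hint j i)).continuousOn_mul hc.continuousOn)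
        (((hγ i j).add (hγ j i)).continuousOn_mul hc.continuousOn)]
    refine intervalIntegral.integral_congr fun s _ => ?_
    simp only [Matrix.sub_apply]
    ring
  · intro i j
    rw [Matrix.sub_apply, estB, trueB, riccatiB, riccatiB, Matrix.of_apply, Matrix.of_apply,
      ← intervalIntegral.integral_sub ((hint i j).sub (hint j i)) ((hγ i j).sub (hγ j i))]
    refine intervalIntegral.integral_congr fun s _ => ?_
    simp only [Matrix.sub_apply]
    ring
  · rw [trueD_eq hU, (hu.covMat_increment t).1, hX.covMat_mul_comm hσ, estD, Matrix.transpose_sub,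
      Matrix.mul_sub]
    module

end Asymptotics

/-! ### Limits in distribution of the coefficients and the delta method. -/

section Main

attribute [local instance] Matrix.normedAddCommGroup Matrix.normedSpace

variable {Ω Ω' : Type*} [MeasurableSpace Ω] [MeasurableSpace Ω']
  {P : Measure Ω} [IsProbabilityMeasure P] {P' : Measure Ω'} [IsProbabilityMeasure P'] {d : ℕ}
  {X r : ℝ → Ω → Fin d → ℝ} {Θ σ : Mat d} {b : Fin d → ℝ} {t : ℝ}

/-- The errors of the Riccati coefficients converge in distribution. -/
theorem IsVasicek.tendstoInDistribution_coefficients (hr : IsVasicek P X Θ σ b r) (hΘ : Θ.PosDef)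
    (hσ : σ.IsDiag) (hX : IsNoise P X) (ht : 0 ≤ t) {l₁ l₂ l₃ lam : ℝ≥0 → ℝ} {N : ℝ≥0 → ℕ}
    (hl₁ : Tendsto l₁ atTop atTop) (hl₂ : Tendsto l₂ atTop atTop) (hl₃ : Tendsto l₃ atTop atTop)
    (hlT : Tendsto (fun T : ℝ≥0 => lam T / (T : ℝ)) atTop (𝓝 0)) {c₁ c₂ c₃ : ℝ}
    (hc₁ : Tendsto (fun T => lam T / l₁ T ^ 2) atTop (𝓝 c₁))
    (hc₂ : Tendsto (fun T => lam T / l₂ T) atTop (𝓝 c₂))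
    (hc₃ : Tendsto (fun T => lam T / l₃ T) atTop (𝓝 c₃))
    {Y₁ : Ω' → Fin d → ℝ} {Y₂ : Ω' → Path d t} {Y₃ : Ω' → Mat d} {G : ℝ≥0 → Ω → Path d t}
    (hG : ∀ T : ℝ≥0, ∀ᵐ ω ∂P, ∀ s : Set.Icc (0 : ℝ) t,
      G T ω s = covEstU (stationarySol X Θ σ) T ω s - autocov P X Θ σ s)
    (h₁ : TendstoInDistribution (fun (T : ℝ≥0) ω => l₁ T • (meanEst r T ω - b))
      atTop Y₁ (fun _ => P) P')
    (h₂ : TendstoInDistribution (fun (T : ℝ≥0) ω => l₂ T • G T ω) atTop Y₂ (fun _ => P) P')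
    (h₃ : TendstoInDistribution
      (fun (T : ℝ≥0) ω => l₃ T • (sigmaSqEst P X r (N T) ω - σ * σᵀ)) atTop Y₃ (fun _ => P) P')
    (hjoint : TendstoInDistribution
      (fun (T : ℝ≥0) ω =>
        (c₁ • (l₁ T • (meanEst r T ω - b)), c₂ • (l₂ T • G T ω),
          c₃ • (l₃ T • (sigmaSqEst P X r (N T) ω - σ * σᵀ))))
      atTop (fun ω' => (c₁ • Y₁ ω', c₂ • Y₂ ω', c₃ • Y₃ ω')) (fun _ => P) P') :
    TendstoInDistribution
      (fun (T : ℝ≥0) ω => lam T • (estC r t T ω - trueC P X Θ σ t,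
        estB r t T ω - trueB P X Θ σ t, estD P X r t T (N T) ω - trueD P X Θ σ t))
      atTop
      (fun ω' => limitMap t ht (covMat P (X t)) c₁ c₂ c₃
        (Matrix.vecMulVec (Y₁ ω') (Y₁ ω'), Y₂ ω', Y₃ ω'))
      (fun _ => P) P' := by
  set V := covMat P (X t) with hV
  -- the main term
  have hΨ : Continuous fun p : (Fin d → ℝ) × Path d t × Mat d =>
      limitMap t ht V c₁⁻¹ 1 1 (Matrix.vecMulVec p.1 p.1, p.2.1, p.2.2) := by
    refine (continuous_limitMap ht V c₁⁻¹ 1 1).comp ?_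
    exact (continuous_fst.matrix_vecMulVec continuous_fst).prodMk
      ((continuous_fst.comp continuous_snd).prodMk (continuous_snd.comp continuous_snd))
  -- Joint convergence is available only for the weighted errors, so continuous mapping is applied
  -- to them and `limitMap_weights` moves the weights back into the map.
  have hmain := hjoint.continuous_comp hΨ
  have hmain' : TendstoInDistribution
      (fun (T : ℝ≥0) ω => limitMap t ht V c₁ c₂ c₃
        (Matrix.vecMulVec (l₁ T • (meanEst r T ω - b)) (l₁ T • (meanEst r T ω - b)),
          l₂ T • G T ω, l₃ T • (sigmaSqEst P X r (N T) ω - σ * σᵀ))) atTop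
      (fun ω' => limitMap t ht V c₁ c₂ c₃
        (Matrix.vecMulVec (Y₁ ω') (Y₁ ω'), Y₂ ω', Y₃ ω')) (fun _ => P) P' := by
    refine TendstoInDistribution.congr (fun T => ae_of_all _ fun ω => ?_)
      (ae_of_all _ fun ω' => ?_) hmain
    · exact limitMap_weights ht V c₁ c₂ c₃ _ _ _
    · exact limitMap_weights ht V c₁ c₂ c₃ _ _ _
  have hYm : ∀ T : ℝ≥0, AEMeasurable (fun ω => lam T • (estC r t T ω - trueC P X Θ σ t,
      estB r t T ω - trueB P X Θ σ t, estD P X r t T (N T) ω - trueD P X Θ σ t)) P := fun T =>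
    ((((measurable_estC hr.measurable t T).sub_const _).prodMk
      (((measurable_estB hr.measurable t T).sub_const _).prodMk
        ((measurable_estD P X hr.measurable t T (N T)).sub_const _))).const_smul
          (lam T)).aemeasurable
  have hE : BorelSpace (Mat d × Mat d × Mat d) := inferInstance
  have hE' : SecondCountableTopology (Mat d × Mat d × Mat d) := inferInstance
  refine tendstoInDistribution_of_norm_sub hE hE' hmain' hYm ?_
  obtain ⟨K, ρ, M, hρi, hρ0, hρM, hb⟩ := hr.exists_covEst_error_bound hΘ hX ht hG
  set A : ℝ := 2 * t ^ 2 + 2 * t + 4 + d * ‖V‖ with hA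
  -- the rescaled errors are bounded in probability
  have t₁ := (isBoundedInProbability_comp h₁
    (f := fun z => ‖z‖ ^ 2) (by fun_prop)).tendstoInMeasure_mul (fun _ _ => by positivity)
    (a := fun T => A * |lam T / l₁ T ^ 2 - c₁|) (by
      simpa using ((hc₁.sub_const c₁).abs).const_mul A)
  have t₂ := (isBoundedInProbability_comp h₂ continuous_pathNorm).tendstoInMeasure_mul
    (fun _ _ => pathNorm_nonneg _) (a := fun T => A * |lam T / l₂ T - c₂|) (by
      simpa using ((hc₂.sub_const c₂).abs).const_mul A)
  have t₃ := (isBoundedInProbability_comp h₃ continuous_norm).tendstoInMeasure_mul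
    (fun _ _ => norm_nonneg _) (a := fun T => A * |lam T / l₃ T - c₃|) (by
      simpa using ((hc₃.sub_const c₃).abs).const_mul A)
  have hAT : Tendsto (fun T : ℝ≥0 => A * |lam T / (T : ℝ)|) atTop (𝓝 0) := by
    simpa using hlT.abs.const_mul A
  have t₄ := tendstoInMeasure_mul_of_integral_le hρi hρ0 hρM hAT
  have m₁ : ∀ T : ℝ≥0, AEMeasurable (fun ω => ‖l₁ T • (meanEst r T ω - b)‖ ^ 2) P := fun T =>
    (by fun_prop : Continuous fun z : Fin d → ℝ => ‖z‖ ^ 2).measurable.comp_aemeasurable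
      (h₁.forall_aemeasurable T)
  have m₂ : ∀ T : ℝ≥0, AEMeasurable (fun ω => pathNorm (l₂ T • G T ω)) P := fun T =>
    continuous_pathNorm.measurable.comp_aemeasurable (h₂.forall_aemeasurable T)
  have m₃ : ∀ T : ℝ≥0,
      AEMeasurable (fun ω => ‖l₃ T • (sigmaSqEst P X r (N T) ω - σ * σᵀ)‖) P := fun T =>
    aemeasurable_norm (instBorelSpaceMat d) (h₃.forall_aemeasurable T)
  have hW := tendstoInMeasure_add (tendstoInMeasure_add (tendstoInMeasure_add t₁ t₂) t₃) t₄
  refine tendstoInMeasure_of_le (K := fun ω => |K ω|) (a := fun T => A * |lam T / (T : ℝ)|)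
    (fun T => ?_) (fun T => ?_) hW hAT ?_
  · exact aemeasurable_norm hE ((hYm T).sub (hmain'.forall_aemeasurable T))
  · exact ((((m₁ T).const_mul _).add ((m₂ T).const_mul _)).add ((m₃ T).const_mul _)).add
      ((hρi T).aemeasurable.const_mul _)
  · filter_upwards [eventually_gt_atTop 0, hl₁.eventually_gt_atTop 0, hl₂.eventually_gt_atTop 0,
      hl₃.eventually_gt_atTop 0] with T hT i₁ i₂ i₃
    have hTr : (0 : ℝ) < T := by exact_mod_cast hT
    have hnn : ∀ ω, 0 ≤ (1 / (T : ℝ)) * (|K ω| + ρ T ω) := fun ω =>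
      mul_nonneg (by positivity) (add_nonneg (abs_nonneg _) (hρ0 T ω))
    filter_upwards [hr.ae_norm_error_sub_limitMap_le hΘ hσ hX ht hG hT hnn (hb T hT) i₁.ne' i₂.ne'
      i₃.ne' c₁ c₂ c₃ (N T) (lam := lam T)] with ω hω
    rw [abs_of_nonneg (norm_nonneg _)]
    refine hω.trans (le_of_eq ?_)
    rw [abs_div (lam T), abs_of_pos hTr]
    ring

/-- The delta method for positive definite solutions of Riccati equations. -/
theorem IsCARE.tendstoInDistribution {C B D : Mat d} (h : IsCARE C B D Θ) (hB : Bᵀ = -B)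
    (hC : C.PosDef) (hD : D.PosSemidef) (hΘ : Θ.PosDef)
    (hinj : Function.Injective (lyapunovMap (B - C * Θ))) {ι : Type*} {l : Filter ι}
    [l.IsCountablyGenerated] {lam : ι → ℝ} (hlam : Tendsto lam l atTop)
    {c : ι → Ω → Mat d × Mat d × Mat d} {Z : Ω' → Mat d × Mat d × Mat d} {Θhat : ι → Ω → Mat d}
    (hm : ∀ i, AEMeasurable (Θhat i) P)
    (hc : TendstoInDistribution (fun i ω => lam i • (c i ω - (C, B, D))) l Z (fun _ => P) P')
    (hsymm : ∀ᶠ i in l, ∀ᵐ ω ∂P, (c i ω).2.1ᵀ = -(c i ω).2.1 ∧ (c i ω).1ᵀ = (c i ω).1)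
    (hsol : Tendsto (fun i => P {ω | ¬ ((Θhat i ω).PosDef ∧
      IsCARE (c i ω).1 (c i ω).2.1 (c i ω).2.2 (Θhat i ω))}) l (𝓝 0)) :
    TendstoInDistribution (fun i ω => lam i • (Θhat i ω - Θ)) l
      (fun ω' => riccatiDerivative C B Θ hinj (Z ω')) (fun _ => P) P' := by
  have hL : Continuous (riccatiDerivative C B Θ hinj) :=
    LinearMap.continuous_of_finiteDimensional _
  have hmain := hc.continuous_comp hL
  have hDm : ∀ i, AEMeasurable (fun ω => lam i • (Θhat i ω - Θ)) P := fun i =>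
    ((hm i).sub_const Θ).const_smul (lam i)
  have hbdd := isBoundedInProbability_comp hc continuous_norm
  refine tendstoInDistribution_of_norm_sub (instBorelSpaceMat d) (instSecondCountableMat d) hmain
    hDm ?_
  refine tendstoInMeasure_of_le_mul hbdd fun η hη => ?_
  -- The expansion is deterministic and uniform over all positive definite solutions. Only two
  -- events need small probability: coefficients far from the truth, and `Θhat` failing to be such a
  -- solution.
  obtain ⟨ε, hε, hball⟩ := Metric.eventually_nhds_iff.1
    (h.eventually_norm_sub_le hB hC hD hΘ hinj hη)
  have hsmall := tendsto_measure_norm_ge hbdd hlam hε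
  have hsum := hsmall.add hsol
  rw [add_zero] at hsum
  refine tendsto_of_tendsto_of_tendsto_of_le_of_le' tendsto_const_nhds hsum
    (Eventually.of_forall fun _ => zero_le) ?_
  filter_upwards [hsymm] with i hi
  refine le_trans (measure_mono_ae ?_) (measure_union_le _ _)
  filter_upwards [hi] with ω hω hbad
  by_contra hcon
  have hcon' := not_or.1 hcon
  have g1 : ‖c i ω - (C, B, D)‖ < ε := not_le.1 hcon'.1
  have g2 := not_not.1 hcon'.2
  refine hbad ?_
  have hb := hball (by rwa [dist_eq_norm]) (Θhat i ω) g2.1 hω.1 hω.2 g2.2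
  simp only [Function.comp_apply, abs_norm]
  rw [map_smul, ← smul_sub, norm_smul, norm_smul]
  calc _ ≤ ‖lam i‖ * (η * ‖c i ω - (C, B, D)‖) := by gcongr
    _ = _ := by ring

end Main

end Vasicek

/-! ### The theorem. -/

theorem theorem2p5 {Ω Ω' : Type*} [MeasurableSpace Ω] [MeasurableSpace Ω']
    (P : Measure Ω) [IsProbabilityMeasure P] (P' : Measure Ω') [IsProbabilityMeasure P']
    {d : ℕ} (X r : ℝ → Ω → Fin d → ℝ) (Θ σ : Vasicek.Mat d) (b : Fin d → ℝ)
    (hΘ : Θ.PosDef) (hσ : σ.PosDef) (hσdiag : σ.IsDiag)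
    (hX : Vasicek.IsNoise P X)
    (hV : ∀ᶠ n : ℕ in atTop, IsUnit (Vasicek.covMat P (X (1 / (n : ℝ)))))
    (hr : Vasicek.IsVasicek P X Θ σ b r)
    (t : ℝ) (ht : 0 ≤ t)
    -- the rates, and the number of observations used for `σ σᵀ`
    (l₁ l₂ : ℝ≥0 → ℝ) (l₃ : ℕ → ℝ) (N : ℝ≥0 → ℕ) (lΘ : ℝ≥0 → ℝ)
    (hl₁ : Tendsto l₁ atTop atTop) (hl₂ : Tendsto l₂ atTop atTop)
    (hl₃ : Tendsto l₃ atTop atTop) (hN : Tendsto N atTop atTop)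
    (hlΘ : ∀ T, lΘ T = min (l₁ T ^ 2) (min (l₂ T) (l₃ (N T))))
    (hlT : Tendsto (fun T : ℝ≥0 => lΘ T / (T : ℝ)) atTop (𝓝 0))
    -- the relation between the rates
    (c₁ c₂ c₃ : ℝ)
    (hc₁ : Tendsto (fun T => lΘ T / l₁ T ^ 2) atTop (𝓝 c₁))
    (hc₂ : Tendsto (fun T => lΘ T / l₂ T) atTop (𝓝 c₂))
    (hc₃ : Tendsto (fun T => lΘ T / l₃ (N T)) atTop (𝓝 c₃))
    -- the limits
    (Y₁ : Ω' → Fin d → ℝ) (Y₂ : Ω' → Vasicek.Path d t) (Y₃ : Ω' → Vasicek.Mat d)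
    -- the covariance error `γ̂_{U,T} - γ`, as a random element of `C([0, t])`
    (G : ℝ≥0 → Ω → Vasicek.Path d t)
    (hG : ∀ T : ℝ≥0, ∀ᵐ ω ∂P, ∀ s : Set.Icc (0 : ℝ) t,
      G T ω s = Vasicek.covEstU (Vasicek.stationarySol X Θ σ) T ω s - Vasicek.autocov P X Θ σ s)
    -- convergence in distribution of the three rescaled errors
    (h₁ : TendstoInDistribution (fun (T : ℝ≥0) ω => l₁ T • (Vasicek.meanEst r T ω - b))
      atTop Y₁ (fun _ => P) P')
    (h₂ : TendstoInDistribution (fun (T : ℝ≥0) ω => l₂ T • G T ω) atTop Y₂ (fun _ => P) P')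
    (h₃ : TendstoInDistribution
      (fun (T : ℝ≥0) ω => l₃ (N T) • (Vasicek.sigmaSqEst P X r (N T) ω - σ * σᵀ))
      atTop Y₃ (fun _ => P) P')
    -- the convergence is joint for those errors whose weight is not zero
    (hjoint : TendstoInDistribution
      (fun (T : ℝ≥0) ω =>
        (c₁ • (l₁ T • (Vasicek.meanEst r T ω - b)), c₂ • (l₂ T • G T ω),
          c₃ • (l₃ (N T) • (Vasicek.sigmaSqEst P X r (N T) ω - σ * σᵀ))))
      atTop (fun ω' => (c₁ • Y₁ ω', c₂ • Y₂ ω', c₃ • Y₃ ω')) (fun _ => P) P') :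
    TendstoInDistribution
      (fun (T : ℝ≥0) ω => lΘ T •
        (Vasicek.estC r t T ω - Vasicek.trueC P X Θ σ t,
          Vasicek.estB r t T ω - Vasicek.trueB P X Θ σ t,
          Vasicek.estD P X r t T (N T) ω - Vasicek.trueD P X Θ σ t))
      atTop
      (fun ω' => Vasicek.limitMap t ht (Vasicek.covMat P (X t)) c₁ c₂ c₃
        (Matrix.vecMulVec (Y₁ ω') (Y₁ ω'), Y₂ ω', Y₃ ω'))
      (fun _ => P) P' ∧
    ((Vasicek.trueC P X Θ σ t).PosDef → (Vasicek.trueD P X Θ σ t).PosSemidef →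
      ∃ L₂ : (Vasicek.Mat d × Vasicek.Mat d × Vasicek.Mat d) →ₗ[ℝ] Vasicek.Mat d,
        (∀ δC δB δD H : Vasicek.Mat d, L₂ (δC, δB, δD) = H ↔
          Vasicek.IsLinearizedCARE (Vasicek.trueC P X Θ σ t) (Vasicek.trueB P X Θ σ t) Θ
            δC δB δD H) ∧
        ∀ Θhat : ℝ≥0 → Ω → Vasicek.Mat d,
          (∀ T, AEMeasurable (Θhat T) P) →
          Tendsto (fun T => P {ω | ¬ ((Θhat T ω).PosDef ∧
            Vasicek.IsCARE (Vasicek.estC r t T ω) (Vasicek.estB r t T ω)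
              (Vasicek.estD P X r t T (N T) ω) (Θhat T ω))}) atTop (𝓝 0) →
          TendstoInDistribution (fun (T : ℝ≥0) ω => lΘ T • (Θhat T ω - Θ))
            atTop
            (fun ω' => L₂ (Vasicek.limitMap t ht (Vasicek.covMat P (X t)) c₁ c₂ c₃
              (Matrix.vecMulVec (Y₁ ω') (Y₁ ω'), Y₂ ω', Y₃ ω')))
            (fun _ => P) P') := by
  have hl₃N : Tendsto (fun T => l₃ (N T)) atTop atTop := hl₃.comp hN
  have hlam : Tendsto lΘ atTop atTop := by
    refine tendsto_atTop.2 fun x => ?_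
    filter_upwards [((tendsto_pow_atTop two_ne_zero).comp hl₁).eventually_ge_atTop x,
      hl₂.eventually_ge_atTop x, hl₃N.eventually_ge_atTop x] with T h1 h2 h3
    rw [hlΘ]
    exact le_min h1 (le_min h2 h3)
  have hcoef := hr.tendstoInDistribution_coefficients hΘ hσdiag hX ht hl₁ hl₂ hl₃N hlT hc₁ hc₂ hc₃
    hG h₁ h₂ h₃ hjoint
  refine ⟨hcoef, fun hC hD => ?_⟩
  obtain ⟨u, hu, hU⟩ := Vasicek.exists_isStationarySolution hX hΘ σ
  have hcare := Vasicek.isCARE_true hX hΘ.1 hu hU ht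
  have hinj := hcare.lyapunovMap_injective hC hD hΘ
  refine ⟨Vasicek.riccatiDerivative _ _ Θ hinj, fun δC δB δD H =>
    Vasicek.riccatiDerivative_eq_iff hinj (δC, δB, δD) H, fun Θhat hm hsol => ?_⟩
  refine hcare.tendstoInDistribution (Vasicek.transpose_riccatiB _ t) hC hD hΘ hinj hlam
    (c := fun T ω => (Vasicek.estC r t T ω, Vasicek.estB r t T ω,
      Vasicek.estD P X r t T (N T) ω)) hm hcoef ?_ hsol
  -- Symmetry of `estC` rests on integrability of the estimated covariance, which holds almost
  -- surely for each positive `T`.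
  filter_upwards [eventually_gt_atTop 0] with T hT
  filter_upwards [hr.ae_intervalIntegrable_covEst hΘ hX ht hG hT] with ω hω
  exact ⟨Vasicek.transpose_riccatiB _ t, Vasicek.transpose_riccatiC ht hω⟩
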